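/- **Setting.** Let $\phi,\psi\in L^2(\mathbb R)$ (complex-valued), $\langle f,g\rangle=\int_{\mathbb R} f\overline g$. On $\mathcal D=\{f\in L^2(\mathbb R):\ \exists\, c_f\in\mathbb C,\ xf(x)-c_f\in L^2(\mathbb R)\}$ (the constant $c_f$ is then unique) put $\Gamma_1 f=\lim_{R\to\infty}\int_{-R}^{R}f(x)\,dx$ (the limit exists), $\Gamma_2 f=c_f$, and $$(\widetilde A^*f)(x)=xf(x)-c_f+\langle f,\phi\rangle\,\psi(x),\qquad f\in\mathcal D .$$ For $B\in\mathbb C$ let $A_B$ be the restriction of $\widetilde A^*$ to $\ker(\Gamma_1-B\Gamma_2)$ and $\rho(A_B)$ its resolvent set. The detectable subspace is the closed linear span $$\overline{\mathcal S}=\overline{\mathrm{Span}}\,\Big\{\ker(\widetilde A^*-\lambda):\ \lambda\in\bigcup_{B\in\mathbb C}\rho(A_B)\Big\}\subseteq L^2(\mathbb R).$$ For a function $F$ on $\mathbb R$ write $\widehat F(\lambda)=\int_{\mathbb R}\frac{F(x)}{x-\lambda}\,dx$ for $\lambda\notin\mathbb R$ and $\widehat F(k\pm i0)=\lim_{\varepsilon\downarrow0}\widehat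 F(k\pm i\varepsilon)$, $k\in\mathbb R$. Equalities on subsets of $\mathbb R$ are meant almost everywhere. **Theorem.** Assume $\phi\psi=0$ a.e., and that either $\phi\in L^2$ and $\psi\in L^2\cap L^\infty$, or $\phi,\psi\in L^2\cap L^4$. Let $\Omega_\psi=\{\psi\ne0\}$, $\Omega_\phi=\{\phi\neq0\}$, $\Omega=\mathbb R\setminus(\Omega_\psi\cup\Omega_\phi)$. The boundary values $\widehat{\overline\phi}(k-i0)$ and, for $g\in L^2(\mathbb R)$, $\widehat{\psi\chi_{\Omega_\psi}\overline g}(k+i0)$ exist for a.e. $k\in\mathbb R$. A function $g\in L^2(\mathbb R)$ lies in $\overline{\mathcal S}^\perp$ if and only if, for a.e. $k\in\mathbb R$, $$\chi_{\Omega_\phi}(k)\,\overline g(k)=\overline\phi(k)\,\widehat{\psi\chi_{\Omega_\psi}\overline g}(k+i0),\qquad \chi_{\Omega_\psi}(k)\,\overline g(k)\Big(1-\widehat{\overline\phi}(k-i0)\,\psi(k)\Big)=0,\qquad g|_\Omega=0 .$$ Let $\Omega_{\psi,0}=\{k\in\mathbb R:\ \widehat{\overline\phi}(k-i0)\,\psi(k)=1\}$.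 Then, additionally: 1. If $\Omega_{\psi,0}$ has measure zero, then $\overline{\mathcal S}=L^2(\mathbb R)$. 2. Assume that either $\phi\in L^2\cap L^{2+\varepsilon}$ for some $\varepsilon>0$ and $\psi\in L^2\cap L^\infty$, or $\phi,\psi\in L^2\cap L^4$. If $\Omega_{\psi,0}$ has non-zero measure, then $\overline{\mathcal S}^\perp\ne\{0\}$. Moreover, for every $f\in L^2(\mathbb R)$ the boundary value $\widehat{f\overline\phi}(k-i0)$ exists for a.e. $k$, and $$\overline{\mathcal S}\subseteq\big\{f\in L^2(\mathbb R):\ f(k)=\psi(k)\,\widehat{f\overline\phi}(k-i0)\ \text{ for a.e. } k\in\Omega_{\psi,0}\big\}.$$ 3. If $\phi,\psi\in L^2\cap L^\infty$, then $$\overline{\mathcal S}=\big\{f\in L^2(\mathbb R):\ f(k)=\psi(k)\,\widehat{f\overline\phi}(k-i0)\ \text{ for a.e. } k\in\Omega_{\psi,0}\big\}.$$ -/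

import Mathlib

open MeasureTheory Filter Topology Set
open scoped ENNReal ComplexConjugate

noncomputable section

namespace Friedrichs

/-- The Hilbert space `L²(ℝ)` of complex-valued functions. The inner product
`inner ℂ u v = ∫ conj (u x) * v x` is linear in the second argument, so `∫ f * conj φ` is
`inner ℂ φ f`. -/
abbrev L2 : Type := Lp ℂ 2 (volume : Measure ℝ)

/-- The constant `c` for which `x f(x) - c` is square integrable is unique. -/
theorem const_unique {f : ℝ → ℂ} {c d : ℂ}
    (hc : MemLp (fun x : ℝ => (x : ℂ) * f x - c) 2 volume)
    (hd : MemLp (fun x : ℝ => (x : ℂ) * f x - d) 2 volume) : c = d := by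
  have h := hd.sub hc
  have h2 : MemLp (fun _ : ℝ => c - d) 2 (volume : Measure ℝ) := by
    convert h using 1
    ext x
    simp
  rw [memLp_const_iff (by norm_num) (by norm_num)] at h2
  simpa [sub_eq_zero] using h2

theorem memLp_add {f g : L2} {c d : ℂ}
    (hc : MemLp (fun x : ℝ => (x : ℂ) * f x - c) 2 volume)
    (hd : MemLp (fun x : ℝ => (x : ℂ) * g x - d) 2 volume) :
    MemLp (fun x : ℝ => (x : ℂ) * (f + g : L2) x - (c + d)) 2 volume := by
  refine (hc.add hd).ae_eq ?_
  filter_upwards [Lp.coeFn_add f g] with x hx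
  simp only [hx, Pi.add_apply]
  ring

theorem memLp_smul {f : L2} {c : ℂ} (a : ℂ)
    (hc : MemLp (fun x : ℝ => (x : ℂ) * f x - c) 2 volume) :
    MemLp (fun x : ℝ => (x : ℂ) * (a • f : L2) x - a * c) 2 volume := by
  refine (hc.const_mul a).ae_eq ?_
  filter_upwards [Lp.coeFn_smul a f] with x hx
  simp only [hx, Pi.smul_apply, smul_eq_mul]
  ring

/-- The domain `{f ∈ L² | ∃ c, x f(x) - c ∈ L²}` of the maximal operator. -/
def maxDomain : Submodule ℂ L2 where
  carrier := {f | ∃ c : ℂ, MemLp (fun x : ℝ => (x : ℂ) * f x - c) 2 volume}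
  add_mem' := fun ⟨c, hc⟩ ⟨d, hd⟩ => ⟨c + d, memLp_add hc hd⟩
  zero_mem' := ⟨0, by
    refine (MemLp.zero' (ε := ℂ) (p := 2) (μ := (volume : Measure ℝ))).ae_eq ?_
    filter_upwards [Lp.coeFn_zero ℂ 2 (volume : Measure ℝ)] with x hx
    rw [hx]
    simp⟩
  smul_mem' := fun a _ ⟨c, hc⟩ => ⟨a * c, memLp_smul a hc⟩

/-- The trace `Γ₂ f = c_f`, the unique constant with `x f(x) - c_f ∈ L²`. -/
def gammaTwo : maxDomain →ₗ[ℂ] ℂ where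
  toFun f := Classical.choose f.2
  map_add' f g := const_unique (Classical.choose_spec (f + g).2)
    (memLp_add (Classical.choose_spec f.2) (Classical.choose_spec g.2))
  map_smul' a f := const_unique (Classical.choose_spec (a • f).2)
    (memLp_smul a (Classical.choose_spec f.2))

theorem gammaTwo_spec (f : maxDomain) :
    MemLp (fun x : ℝ => (x : ℂ) * (f : L2) x - gammaTwo f) 2 volume :=
  Classical.choose_spec f.2

theorem intervalIntegrable (f : L2) (a b : ℝ) : IntervalIntegrable (f : ℝ → ℂ) volume a b :=
  (((Lp.memLp f).locallyIntegrable Fact.out).integrableOn_isCompact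
    isCompact_uIcc).intervalIntegrable

/-- For `f` in the maximal domain the symmetric integrals `∫_{-R}^R f` converge. -/
theorem exists_tendsto_integral (f : maxDomain) :
    ∃ v : ℂ, Tendsto (fun R : ℝ => ∫ x in (-R)..R, (f : L2) x) atTop (𝓝 v) := by
  obtain ⟨c, hc⟩ := f.2
  set u : L2 := (f : L2)
  -- `w` has absolute value `(1 + x²)^{-1/2}`, so it is square integrable
  set w : ℝ → ℂ := fun x => 1 / ((x : ℂ) + Complex.I) with hw
  have hne : ∀ x : ℝ, (x : ℂ) + Complex.I ≠ 0 := fun x h => by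
    simpa using congrArg Complex.im h
  have hwc : Continuous w := by
    refine continuous_const.div (by fun_prop) hne
  have hwn : ∀ x : ℝ, ‖w x‖ ^ 2 = (1 + x ^ 2)⁻¹ := fun x => by
    rw [← Complex.normSq_eq_norm_sq, hw]
    simp only [one_div, map_inv₀]
    congr 1
    simp [Complex.normSq_apply]
    ring
  have hw2 : MemLp w 2 volume := by
    rw [memLp_two_iff_integrable_sq_norm hwc.aestronglyMeasurable]
    simp_rw [hwn]
    exact integrable_inv_one_add_sq
  -- the difference of `u` and an odd function is integrable
  have hs : Integrable (fun x : ℝ => ((x : ℂ) * u x - c + Complex.I * u x) * w x) volume :=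
    (hc.add ((Lp.memLp u).const_mul Complex.I)).integrable_mul hw2
  have hi : Integrable (fun x : ℝ => -(c * Complex.I) * ((1 + x ^ 2 : ℝ)⁻¹ : ℝ)) volume :=
    (integrable_inv_one_add_sq.ofReal (𝕜 := ℂ)).const_mul _
  have ht := intervalIntegral_tendsto_integral (hs.add hi) tendsto_neg_atTop_atBot tendsto_id
  refine ⟨_, ht.congr fun R => ?_⟩
  have hq : ∀ x : ℝ, ((x : ℂ) * u x - c + Complex.I * u x) * w x +
      -(c * Complex.I) * ((1 + x ^ 2 : ℝ)⁻¹ : ℝ) = u x - c * (x * ((1 + x ^ 2 : ℝ)⁻¹ : ℝ)) := by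
    intro x
    have h1 : (1 + (x : ℂ) ^ 2) = ((x : ℂ) + Complex.I) * (x - Complex.I) := by
      ring_nf
      simp
      ring
    have h2 : (x : ℂ) - Complex.I ≠ 0 := fun h => by
      simpa using congrArg Complex.im h
    have h3 := hne x
    simp only [hw]
    push_cast
    rw [h1]
    field_simp
    ring
  have hodd : ∫ x in (-R)..R, c * ((x : ℂ) * ((1 + x ^ 2 : ℝ)⁻¹ : ℝ)) = 0 := by
    have h := intervalIntegral.integral_comp_neg (a := -R) (b := R)
      (fun x : ℝ => c * ((x : ℂ) * ((1 + x ^ 2 : ℝ)⁻¹ : ℝ)))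
    rw [neg_neg] at h
    rw [← self_eq_neg, ← intervalIntegral.integral_neg]
    refine h.symm.trans (intervalIntegral.integral_congr fun x _ => ?_)
    push_cast
    ring
  have hcont : Continuous fun x : ℝ => c * ((x : ℂ) * ((1 + x ^ 2 : ℝ)⁻¹ : ℝ)) := by
    refine continuous_const.mul (Complex.continuous_ofReal.mul
      (Complex.continuous_ofReal.comp (Continuous.inv₀ (by fun_prop) fun x => by positivity)))
  calc ∫ x in (-R)..id R, _ = ∫ x in (-R)..R, (u x - c * (x * ((1 + x ^ 2 : ℝ)⁻¹ : ℝ))) :=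
        intervalIntegral.integral_congr fun x _ => hq x
    _ = ∫ x in (-R)..R, u x := by
        rw [intervalIntegral.integral_sub (intervalIntegrable u _ _)
          (hcont.intervalIntegrable _ _), hodd, sub_zero]

/-- The trace `Γ₁ f = lim_{R → ∞} ∫_{-R}^R f(x) dx`. -/
def gammaOne : maxDomain →ₗ[ℂ] ℂ where
  toFun f := limUnder atTop (fun R : ℝ => ∫ x in (-R)..R, (f : L2) x)
  map_add' f g := by
    refine Tendsto.limUnder_eq ?_
    refine ((exists_tendsto_integral f).choose_spec.limUnder_eq ▸
      (exists_tendsto_integral f).choose_spec).add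
      ((exists_tendsto_integral g).choose_spec.limUnder_eq ▸
      (exists_tendsto_integral g).choose_spec) |>.congr fun R => ?_
    rw [← intervalIntegral.integral_add (intervalIntegrable _ _ _) (intervalIntegrable _ _ _)]
    refine intervalIntegral.integral_congr_ae ?_
    filter_upwards [Lp.coeFn_add (f : L2) (g : L2)] with x hx _
    exact hx.symm
  map_smul' a f := by
    refine Tendsto.limUnder_eq ?_
    refine ((exists_tendsto_integral f).choose_spec.limUnder_eq ▸
      (exists_tendsto_integral f).choose_spec).const_mul a |>.congr fun R => ?_
    rw [← intervalIntegral.integral_const_mul]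
    refine intervalIntegral.integral_congr_ae ?_
    filter_upwards [Lp.coeFn_smul a (f : L2)] with x hx _
    exact hx.symm

/-- The maximal operator `f ↦ x f(x) - c_f + ⟨f, φ⟩ ψ(x)` with domain `maxDomain`. It is the adjoint
of the operator `f ↦ x f(x) + ⟨f, ψ⟩ φ(x)` on
`{f ∈ L² | x f(x) ∈ L², lim_{R → ∞} ∫_{-R}^R f = 0}`. -/
def maxOp (φ ψ : L2) : L2 →ₗ.[ℂ] L2 where
  domain := maxDomain
  toFun :=
    { toFun := fun f => (gammaTwo_spec f).toLp _ + inner ℂ φ (f : L2) • ψ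
      map_add' := fun f g => by
        have h : (gammaTwo_spec (f + g)).toLp _ =
            (gammaTwo_spec f).toLp _ + (gammaTwo_spec g).toLp _ := by
          rw [← MemLp.toLp_add]
          refine MemLp.toLp_congr _ _ ?_
          filter_upwards [Lp.coeFn_add (f : L2) (g : L2)] with x hx
          simp only [Submodule.coe_add, hx, Pi.add_apply, map_add]
          ring
        rw [h, Submodule.coe_add, inner_add_right, add_smul]
        abel
      map_smul' := fun a f => by
        have h : (gammaTwo_spec (a • f)).toLp _ = a • (gammaTwo_spec f).toLp _ := by
          rw [← MemLp.toLp_const_smul]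
          refine MemLp.toLp_congr _ _ ?_
          filter_upwards [Lp.coeFn_smul a (f : L2)] with x hx
          simp only [Submodule.coe_smul, hx, Pi.smul_apply, map_smul, smul_eq_mul]
          ring
        rw [h, Submodule.coe_smul, inner_smul_right, RingHom.id_apply, smul_add, mul_smul] }

/-- The operator `A_B`: the restriction of the maximal operator to `ker (Γ₁ - B Γ₂)`. -/
def opB (φ ψ : L2) (B : ℂ) : L2 →ₗ.[ℂ] L2 :=
  (maxOp φ ψ).domRestrict ((LinearMap.ker (gammaOne - B • gammaTwo)).map maxDomain.subtype)

/-- The resolvent set of an unbounded operator on `L²(ℝ)`: the `z` for which `T - z` is a bijection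
from the domain of `T` onto `L²(ℝ)` with bounded inverse. -/
def resolventSet (T : L2 →ₗ.[ℂ] L2) : Set ℂ :=
  {z | ∃ R : L2 →L[ℂ] L2,
    (∀ h : L2, ∃ hR : R h ∈ T.domain, T ⟨R h, hR⟩ - z • R h = h) ∧
    ∀ f : T.domain, R (T f - z • (f : L2)) = f}

/-- The detectable subspace: the closed linear span of the kernels of `maxOp φ ψ - z`, where `z`
runs over the union of the resolvent sets of all the operators `A_B`. -/
def detectable (φ ψ : L2) : Submodule ℂ L2 :=
  (Submodule.span ℂ {f : L2 | ∃ z ∈ ⋃ B : ℂ, resolventSet (opB φ ψ B),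
    ∃ hf : f ∈ (maxOp φ ψ).domain, maxOp φ ψ ⟨f, hf⟩ = z • f}).topologicalClosure

/-- The Cauchy (Borel) transform of a function on the real line. -/
def cauchy (F : ℝ → ℂ) (z : ℂ) : ℂ := ∫ x : ℝ, F x / ((x : ℂ) - z)

/-- `v` is the boundary value from above of the Cauchy transform of `F` at `k`. -/
def HasUpperValue (F : ℝ → ℂ) (k : ℝ) (v : ℂ) : Prop :=
  Tendsto (fun ε : ℝ => cauchy F ((k : ℂ) + ε * Complex.I)) (𝓝[>] 0) (𝓝 v)

/-- `v` is the boundary value from below of the Cauchy transform of `F` at `k`. -/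
def HasLowerValue (F : ℝ → ℂ) (k : ℝ) (v : ℂ) : Prop :=
  Tendsto (fun ε : ℝ => cauchy F ((k : ℂ) - ε * Complex.I)) (𝓝[>] 0) (𝓝 v)

/-- The boundary value at `k + i0` of the Cauchy transform of `F`. -/
def upperValue (F : ℝ → ℂ) (k : ℝ) : ℂ :=
  limUnder (𝓝[>] 0) (fun ε : ℝ => cauchy F ((k : ℂ) + ε * Complex.I))

/-- The boundary value at `k - i0` of the Cauchy transform of `F`. -/
def lowerValue (F : ℝ → ℂ) (k : ℝ) : ℂ :=
  limUnder (𝓝[>] 0) (fun ε : ℝ => cauchy F ((k : ℂ) - ε * Complex.I))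

/-- The set where a function does not vanish. -/
def nonzeroSet (u : ℝ → ℂ) : Set ℝ := {x | u x ≠ 0}

/-- The function `ψ χ_{ψ ≠ 0} conj g`. -/
def cutProduct (ψ g : L2) (x : ℝ) : ℂ :=
  ψ x * (nonzeroSet ψ).indicator (fun y => conj (g y)) x

/-- The set of the `k` at which the boundary value at `k - i0` of the Cauchy transform of `conj φ`,
multiplied by `ψ k`, is `1`. -/
def unitSet (φ ψ : L2) : Set ℝ := {k | lowerValue (fun x => conj (φ x)) k * ψ k = 1}

end Friedrichs

end

noncomputable section

namespace Friedrichs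

/-! ### Interpolation of integrability exponents -/

/-! Let K F denote the Cauchy transform of F. For nonreal z, a solution of `maxMap φ ψ f = z • f` is
a multiple of (1 - K(conj φ)(z) ψ)/(x - z), because φψ = 0 keeps the rank-one term from acting on
its own output. Each nonreal z lies in the resolvent set of A_B for every B different from Γ₁ of
this eigenvector, and no real z lies in any of these resolvent sets. Hence g is orthogonal to the
detectable subspace iff K(conj g) = K(conj φ) · K(ψ conj g) off the real line
(`mem_orthogonal_detectable_iff`).

To make this pointwise, split u = A + B and v = C + D into boundary values of functions analytic in
the upper and in the lower half-plane. The jump relation `ae_tendsto_cauchy_sub` shows that K is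
injective and that K u has boundary values 2πiA from above and -2πiB from below. On upper functions,
and on lower ones, K is multiplicative up to the factor ±2πi, so K u · K v = K(2πi(uC - Bv)). With u
= conj φ and v = ψ conj g, injectivity gives conj g = conj φ · (K v)(k + i0) + (K u)(k - i0) · ψ
conj g, and the disjoint supports of φ and ψ separate this into the three conditions.

In general v lies only in some L^p with p ≤ 2, so the splitting has to be bounded outside L².
Squaring takes a bound on L^q to one on L^{2q} (`ProjectionBounded.two_mul`), starting from the
orthogonal projection at q = 2; duality then reaches the conjugate exponents
(`ProjectionBounded.dual`, `exists_split_dual`).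

A small piece s of the unit set produces an orthogonal element, conj g = χ_s + conj φ · K(ψχ_s)(k +
i0). It is 1 on s, so the complement is nontrivial when the unit set is not null; pairing f with it
and moving the projection to the other factor gives ∫_s (f - ψ · K(f conj φ)(k - i0)) = 0 for all
such s. For bounded φ and ψ the same duality, applied to an arbitrary orthogonal g, gives the
reverse inclusion. -/

theorem memLp_of_memLp_memLp {α : Type*} [MeasurableSpace α] {μ : Measure α} {f : α → ℂ}
    {p q s : ℝ≥0∞} (hp0 : p ≠ 0) (hps : p ≤ s) (hsq : s ≤ q) (hq : q ≠ ∞)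
    (hp : MemLp f p μ) (hfq : MemLp f q μ) : MemLp f s μ := by
  have hs : s ≠ ∞ := ne_top_of_le_ne_top hq hsq
  have hpt : p ≠ ∞ := ne_top_of_le_ne_top hs hps
  have hs0 : s ≠ 0 := (lt_of_lt_of_le (pos_iff_ne_zero.2 hp0) hps).ne'
  have hq0 : q ≠ 0 := (lt_of_lt_of_le (pos_iff_ne_zero.2 hs0) hsq).ne'
  refine ⟨hp.1, ?_⟩
  rw [eLpNorm_lt_top_iff_lintegral_rpow_enorm_lt_top hs0 hs]
  have h1 := (eLpNorm_lt_top_iff_lintegral_rpow_enorm_lt_top hp0 hpt).1 hp.2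
  have h2 := (eLpNorm_lt_top_iff_lintegral_rpow_enorm_lt_top hq0 hq).1 hfq.2
  refine lt_of_le_of_lt ?_ (ENNReal.add_lt_top.2 ⟨h1, h2⟩)
  rw [← lintegral_add_left' (hp.1.enorm.pow_const _)]
  refine lintegral_mono fun x => ?_
  have a1 : p.toReal ≤ s.toReal := ENNReal.toReal_mono hs hps
  have a2 : s.toReal ≤ q.toReal := ENNReal.toReal_mono hq hsq
  rcases le_total ‖f x‖ₑ 1 with h | h
  · exact (ENNReal.rpow_le_rpow_of_exponent_ge h a1).trans le_self_add
  · exact (ENNReal.rpow_le_rpow_of_exponent_le h a2).trans le_add_self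

theorem memLp_of_memLp_top {α : Type*} [MeasurableSpace α] {μ : Measure α} {f : α → ℂ}
    {p s : ℝ≥0∞} (hp0 : p ≠ 0) (hps : p ≤ s)
    (hp : MemLp f p μ) (hf : MemLp f ∞ μ) : MemLp f s μ := by
  by_cases hs : s = ∞
  · rwa [hs]
  have hpt : p ≠ ∞ := ne_top_of_le_ne_top hs hps
  have hs0 : s ≠ 0 := (lt_of_lt_of_le (pos_iff_ne_zero.2 hp0) hps).ne'
  refine ⟨hp.1, ?_⟩
  rw [eLpNorm_lt_top_iff_lintegral_rpow_enorm_lt_top hs0 hs]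
  have h1 := (eLpNorm_lt_top_iff_lintegral_rpow_enorm_lt_top hp0 hpt).1 hp.2
  have a1 : 0 ≤ s.toReal - p.toReal := sub_nonneg.2 (ENNReal.toReal_mono hs hps)
  have h2 : eLpNormEssSup f μ ^ (s.toReal - p.toReal) < ∞ :=
    ENNReal.rpow_lt_top_of_nonneg a1 (by simpa using hf.2.ne)
  refine lt_of_le_of_lt ?_ (ENNReal.mul_lt_top h2 h1)
  rw [← lintegral_const_mul' _ _ h2.ne]
  refine lintegral_mono_ae ?_
  filter_upwards [enorm_ae_le_eLpNormEssSup f μ] with x hx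
  calc ‖f x‖ₑ ^ s.toReal = ‖f x‖ₑ ^ ((s.toReal - p.toReal) + p.toReal) := by ring_nf
    _ = ‖f x‖ₑ ^ (s.toReal - p.toReal) * ‖f x‖ₑ ^ p.toReal :=
        ENNReal.rpow_add_of_nonneg _ _ a1 ENNReal.toReal_nonneg
    _ ≤ _ := by gcongr

/-! ### The Cauchy kernel -/

theorem sub_ne_zero_of_im {z : ℂ} (hz : z.im ≠ 0) (x : ℝ) : (x : ℂ) - z ≠ 0 := fun h => by
  apply hz
  simpa using congrArg Complex.im h

theorem continuous_kernel {z : ℂ} (hz : z.im ≠ 0) : Continuous fun x : ℝ => ((x : ℂ) - z)⁻¹ :=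
  Continuous.inv₀ (by fun_prop) (sub_ne_zero_of_im hz)

theorem norm_kernel_le {z : ℂ} (hz : z.im ≠ 0) (x : ℝ) : ‖((x : ℂ) - z)⁻¹‖ ≤ |z.im|⁻¹ := by
  rw [norm_inv]
  refine inv_anti₀ (abs_pos.2 hz) ?_
  simpa using Complex.abs_im_le_norm ((x : ℂ) - z)

theorem memLp_kernel_top {z : ℂ} (hz : z.im ≠ 0) :
    MemLp (fun x : ℝ => ((x : ℂ) - z)⁻¹) ∞ volume :=
  memLp_top_of_bound (continuous_kernel hz).aestronglyMeasurable |z.im|⁻¹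
    (Eventually.of_forall (norm_kernel_le hz))

theorem norm_kernel_sq (z : ℂ) (x : ℝ) :
    ‖((x : ℂ) - z)⁻¹‖ ^ 2 = ((x - z.re) ^ 2 + z.im ^ 2)⁻¹ := by
  rw [norm_inv, inv_pow, ← Complex.normSq_eq_norm_sq, Complex.normSq_apply]
  congr 1
  simp
  ring

theorem memLp_kernel_two {z : ℂ} (hz : z.im ≠ 0) :
    MemLp (fun x : ℝ => ((x : ℂ) - z)⁻¹) 2 volume := by
  rw [memLp_two_iff_integrable_sq_norm (continuous_kernel hz).aestronglyMeasurable]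
  simp_rw [norm_kernel_sq]
  have h := ((integrable_inv_one_add_sq.comp_mul_left' (inv_ne_zero hz)).comp_sub_right
    z.re).const_mul ((z.im ^ 2)⁻¹)
  refine h.congr (Eventually.of_forall fun x => ?_)
  simp only
  rw [← mul_inv]
  congr 1
  field_simp
  ring

theorem memLp_kernel {z : ℂ} (hz : z.im ≠ 0) {q : ℝ≥0∞} (hq : 2 ≤ q) :
    MemLp (fun x : ℝ => ((x : ℂ) - z)⁻¹) q volume :=
  memLp_of_memLp_top two_ne_zero hq (memLp_kernel_two hz) (memLp_kernel_top hz)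

/-! ### Symmetric integrals of the Cauchy kernel and of products of kernels -/

/-- The path t - a stays in the open lower half-plane, so the principal logarithm is a primitive
along the whole line; its argument changes by π. -/
theorem tendsto_integral_kernel_of_im_pos {a : ℂ} (ha : 0 < a.im) :
    Tendsto (fun R : ℝ => ∫ t in (-R)..R, ((t : ℂ) - a)⁻¹) atTop (𝓝 (Real.pi * Complex.I)) := by
  have hne : a.im ≠ 0 := ha.ne'
  have hint : ∀ R : ℝ, ∫ t in (-R)..R, ((t : ℂ) - a)⁻¹ =
      Complex.log (R - a) - Complex.log (-R - a) := by
    intro R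
    have := intervalIntegral.integral_eq_sub_of_hasDerivAt (a := -R) (b := R)
      (f := fun t : ℝ => Complex.log ((t : ℂ) - a)) (f' := fun t : ℝ => ((t : ℂ) - a)⁻¹) ?_
      ((continuous_kernel hne).intervalIntegrable _ _)
    · simpa using this
    intro x _
    have h1 : HasDerivAt (fun t : ℝ => (t : ℂ) - a) 1 x := by
      simpa using (Complex.ofRealCLM.hasDerivAt (x := x)).sub_const a
    have h2 := h1.clog_real (Or.inr (by simpa using hne))
    simpa using h2
  have hlog : ∀ R : ℝ, 0 < R → Complex.log (R - a) - Complex.log (-R - a) =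
      Complex.log (1 - a / R) - Complex.log (1 + a / R) + Real.pi * Complex.I := by
    intro R hR
    have hR' : (R : ℂ) ≠ 0 := by exact_mod_cast hR.ne'
    have e1 : (R : ℂ) - a = R * (1 - a / R) := by field_simp
    have e2 : (R : ℂ) + a = R * (1 + a / R) := by field_simp
    have i1 : (1 - a / R : ℂ) ≠ 0 := fun h => sub_ne_zero_of_im hne R (by rw [e1, h, mul_zero])
    have i2 : (1 + a / R : ℂ) ≠ 0 := fun h => by
      apply sub_ne_zero_of_im hne (-R)
      push_cast
      rw [show (-(R : ℂ) - a) = -(R + a) by ring, e2, h, mul_zero, neg_zero]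
    -- Replacing R + a, which lies in the upper half-plane, by its negative lowers the principal
    -- argument by π. This is the only source of the limit; the two remaining logarithms tend to log
    -- 1.
    have e3 : Complex.log (-R - a) = Complex.log (R + a) - Real.pi * Complex.I := by
      have : (-(R : ℂ) - a) = -(R + a) := by ring
      rw [this, Complex.log, Complex.log, norm_neg,
        Complex.arg_neg_eq_arg_sub_pi_of_im_pos (by simpa using ha)]
      push_cast
      ring
    rw [e3, e1, e2, Complex.log_ofReal_mul hR i1, Complex.log_ofReal_mul hR i2]
    ring
  have h0 : Tendsto (fun R : ℝ => a / (R : ℂ)) atTop (𝓝 0) := by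
    have := (Complex.continuous_ofReal.tendsto 0).comp tendsto_inv_atTop_zero
    simpa [div_eq_mul_inv, Function.comp_def] using this.const_mul a
  have hs : (1 : ℂ) ∈ Complex.slitPlane := Complex.one_mem_slitPlane
  have h1 : Tendsto (fun R : ℝ => Complex.log (1 - a / R)) atTop (𝓝 0) := by
    have h := (h0.const_sub 1)
    rw [sub_zero] at h
    simpa using h.clog hs
  have h2 : Tendsto (fun R : ℝ => Complex.log (1 + a / R)) atTop (𝓝 0) := by
    have h := (h0.const_add 1)
    rw [add_zero] at h
    simpa using h.clog hs
  have h3 := (h1.sub h2).add_const ((Real.pi : ℂ) * Complex.I)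
  rw [sub_zero, zero_add] at h3
  refine h3.congr' ?_
  filter_upwards [eventually_gt_atTop 0] with R hR
  rw [hint, hlog R hR]

theorem tendsto_integral_kernel_of_im_neg {a : ℂ} (ha : a.im < 0) :
    Tendsto (fun R : ℝ => ∫ t in (-R)..R, ((t : ℂ) - a)⁻¹) atTop
      (𝓝 (-(Real.pi * Complex.I))) := by
  have h := (tendsto_integral_kernel_of_im_pos (a := -a) (by simpa using ha)).neg
  refine h.congr fun R => ?_
  rw [← intervalIntegral.integral_neg]
  have := intervalIntegral.integral_comp_neg (a := -R) (b := R)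
    (fun t : ℝ => ((t : ℂ) - a)⁻¹)
  rw [neg_neg] at this
  rw [← this]
  refine intervalIntegral.integral_congr fun x _ => ?_
  simp only [Complex.ofReal_neg]
  rw [← inv_neg]
  congr 1
  ring

theorem integrable_kernel_mul {a b : ℂ} (ha : a.im ≠ 0) (hb : b.im ≠ 0) :
    Integrable fun t : ℝ => ((t : ℂ) - a)⁻¹ * ((t : ℂ) - b)⁻¹ :=
  (memLp_kernel_two ha).integrable_mul (memLp_kernel_two hb)

theorem kernel_mul_eq {a b : ℂ} (ha : a.im ≠ 0) (hb : b.im ≠ 0) (hab : a ≠ b) (t : ℝ) :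
    ((t : ℂ) - a)⁻¹ * ((t : ℂ) - b)⁻¹ = (a - b)⁻¹ * (((t : ℂ) - a)⁻¹ - ((t : ℂ) - b)⁻¹) := by
  have h1 := sub_ne_zero_of_im ha t
  have h2 := sub_ne_zero_of_im hb t
  have h3 := sub_ne_zero.2 hab
  field_simp
  ring

theorem integral_kernel_mul_of_tendsto {a b : ℂ} (ha : a.im ≠ 0) (hb : b.im ≠ 0) (hab : a ≠ b)
    {u v : ℂ} (hu : Tendsto (fun R : ℝ => ∫ t in (-R)..R, ((t : ℂ) - a)⁻¹) atTop (𝓝 u))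
    (hv : Tendsto (fun R : ℝ => ∫ t in (-R)..R, ((t : ℂ) - b)⁻¹) atTop (𝓝 v)) :
    ∫ t : ℝ, ((t : ℂ) - a)⁻¹ * ((t : ℂ) - b)⁻¹ = (a - b)⁻¹ * (u - v) := by
  have h1 := intervalIntegral_tendsto_integral (integrable_kernel_mul ha hb)
    tendsto_neg_atTop_atBot tendsto_id
  refine tendsto_nhds_unique h1 (((hu.sub hv).const_mul (a - b)⁻¹).congr fun R => ?_)
  rw [← intervalIntegral.integral_sub ((continuous_kernel ha).intervalIntegrable _ _)
    ((continuous_kernel hb).intervalIntegrable _ _), ← intervalIntegral.integral_const_mul]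
  exact intervalIntegral.integral_congr fun t _ => (kernel_mul_eq ha hb hab t).symm

theorem integral_kernel_mul_of_im_pos {a b : ℂ} (ha : 0 < a.im) (hb : 0 < b.im) (hab : a ≠ b) :
    ∫ t : ℝ, ((t : ℂ) - a)⁻¹ * ((t : ℂ) - b)⁻¹ = 0 := by
  rw [integral_kernel_mul_of_tendsto ha.ne' hb.ne' hab (tendsto_integral_kernel_of_im_pos ha)
    (tendsto_integral_kernel_of_im_pos hb), sub_self, mul_zero]

theorem integral_kernel_mul_of_im_pos_of_im_neg {a b : ℂ} (ha : 0 < a.im) (hb : b.im < 0) :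
    ∫ t : ℝ, ((t : ℂ) - a)⁻¹ * ((t : ℂ) - b)⁻¹ = (a - b)⁻¹ * (2 * Real.pi * Complex.I) := by
  rw [integral_kernel_mul_of_tendsto ha.ne' hb.ne (fun h => by rw [h] at ha; linarith)
    (tendsto_integral_kernel_of_im_pos ha) (tendsto_integral_kernel_of_im_neg hb)]
  ring

/-! ### Functions that have a Cauchy transform -/

/-- The integral that defines the Cauchy transform converges at every nonreal point. -/
def Admissible (F : ℝ → ℂ) : Prop :=
  ∀ z : ℂ, z.im ≠ 0 → Integrable fun x : ℝ => F x / ((x : ℂ) - z)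

theorem MemLp.admissible {F : ℝ → ℂ} (p q : ℝ≥0∞) [ENNReal.HolderConjugate p q] (hq : 2 ≤ q)
    (hF : MemLp F p volume) : Admissible F := fun z hz => by
  have : ENNReal.HolderTriple p q 1 := inferInstance
  simp only [div_eq_mul_inv]
  exact hF.integrable_mul (memLp_kernel hz hq)

theorem admissible_of_memLp_two {F : ℝ → ℂ} (hF : MemLp F 2 volume) : Admissible F :=
  MemLp.admissible 2 2 le_rfl hF

theorem admissible_of_integrable {F : ℝ → ℂ} (hF : Integrable F) : Admissible F :=
  MemLp.admissible 1 ∞ le_top (memLp_one_iff_integrable.2 hF)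

theorem Admissible.const_mul {F : ℝ → ℂ} (hF : Admissible F) (c : ℂ) :
    Admissible fun x => c * F x := fun z hz => by
  simpa only [mul_div_assoc] using (hF z hz).const_mul c

theorem Admissible.sub {F G : ℝ → ℂ} (hF : Admissible F) (hG : Admissible G) :
    Admissible fun x => F x - G x := fun z hz => by
  simp only [sub_div]
  exact (hF z hz).sub (hG z hz)

theorem cauchy_add {F G : ℝ → ℂ} (hF : Admissible F) (hG : Admissible G) {z : ℂ}
    (hz : z.im ≠ 0) : cauchy (fun x => F x + G x) z = cauchy F z + cauchy G z := by
  simp only [cauchy, add_div]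
  exact integral_add (hF z hz) (hG z hz)

theorem cauchy_sub {F G : ℝ → ℂ} (hF : Admissible F) (hG : Admissible G) {z : ℂ}
    (hz : z.im ≠ 0) : cauchy (fun x => F x - G x) z = cauchy F z - cauchy G z := by
  simp only [cauchy, sub_div]
  exact integral_sub (hF z hz) (hG z hz)

theorem cauchy_const_mul (F : ℝ → ℂ) (c z : ℂ) :
    cauchy (fun x => c * F x) z = c * cauchy F z := by
  simp only [cauchy, mul_div_assoc]
  exact integral_const_mul _ _

theorem cauchy_congr {F G : ℝ → ℂ} (h : F =ᵐ[volume] G) (z : ℂ) : cauchy F z = cauchy G z := by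
  refine integral_congr_ae ?_
  filter_upwards [h] with x hx
  rw [hx]

theorem cauchy_conj (F : ℝ → ℂ) (z : ℂ) :
    cauchy (fun x => conj (F x)) z = conj (cauchy F (conj z)) := by
  rw [cauchy, cauchy, ← integral_conj]
  refine integral_congr_ae (Eventually.of_forall fun x => ?_)
  simp

/-- Multiplying the integrable function F/(x - i) by the continuous function x - i recovers F. -/
theorem Admissible.locallyIntegrable {F : ℝ → ℂ} (hF : Admissible F) : LocallyIntegrable F := by
  have h1 := (hF Complex.I (by simp)).locallyIntegrable
  have h2 := h1.mul_continuous (g := fun x : ℝ => (x : ℂ) - Complex.I) (by fun_prop)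
  convert h2 using 1
  ext x
  rw [div_mul_cancel₀ _ (sub_ne_zero_of_im (by simp) x)]

/-! ### Boundary values of Poisson integrals -/

/-- The Poisson kernel is dominated by a sum of dyadic box functions, which turns averages over
intervals into bounds for Poisson integrals. -/
theorem poisson_le_tsum {ε : ℝ} (hε : 0 < ε) (t : ℝ) :
    ENNReal.ofReal (ε / (t ^ 2 + ε ^ 2)) ≤
      ∑' j : ℕ, ENNReal.ofReal (4 / (4 ^ j * ε)) * {s : ℝ | |s| ≤ 2 ^ j * ε}.indicator 1 t := by
  have hex : ∃ j : ℕ, |t| ≤ 2 ^ j * ε := by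
    obtain ⟨j, hj⟩ := pow_unbounded_of_one_lt (|t| / ε) (one_lt_two)
    exact ⟨j, by rw [div_lt_iff₀ hε] at hj; exact hj.le⟩
  classical
  -- One term suffices: the least j with |t| ≤ 2^j ε. If j = i + 1, minimality gives |t| > 2^i ε, so
  -- the kernel is at most 1/(4^i ε) = 4/(4^j ε).
  refine le_trans ?_ (ENNReal.le_tsum (Nat.find hex))
  rw [indicator_of_mem (by exact Nat.find_spec hex), Pi.one_apply, mul_one]
  refine ENNReal.ofReal_le_ofReal ?_
  rcases hj : Nat.find hex with _ | i
  · rw [pow_zero, one_mul, div_le_div_iff₀ (by positivity) hε]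
    nlinarith [sq_nonneg t]
  · have h1 : 2 ^ i * ε < |t| := by
      have := Nat.find_min hex (m := i) (by omega)
      exact not_le.1 this
    have h2 : (2 ^ i * ε) ^ 2 < t ^ 2 := by
      rw [← sq_abs t]
      exact pow_lt_pow_left₀ h1 (by positivity) two_ne_zero
    have h4 : (2 ^ i : ℝ) ^ 2 = 4 ^ i := by rw [← pow_mul, mul_comm, pow_mul]; norm_num
    rw [mul_pow, h4] at h2
    rw [pow_succ (4 : ℝ), div_le_div_iff₀ (by positivity) (by positivity)]
    nlinarith [sq_nonneg t, sq_nonneg ε]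

/-- Layer j contributes at most 4/(4^j ε) · 2 · 2^j ε · η = 8η/2^j, and these sum to 16η. Layers
wider than δ are cut off at δ, where the hypothesis still applies. -/
theorem lintegral_poisson_near_le {G : ℝ → ℝ≥0∞} (hG : AEMeasurable G) {k δ η ε : ℝ}
    (hδ : 0 < δ) (hε : 0 < ε) (hη : 0 ≤ η)
    (h : ∀ r, 0 < r → r ≤ δ → ∫⁻ y in Metric.closedBall k r, G y ≤ ENNReal.ofReal (2 * r * η)) :
    ∫⁻ y in Metric.closedBall k δ, G y * ENNReal.ofReal (ε / ((y - k) ^ 2 + ε ^ 2)) ≤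
      ENNReal.ofReal (16 * η) := by
  have hball : ∀ r, {y : ℝ | y - k ∈ {s : ℝ | |s| ≤ r}} = Metric.closedBall k r := fun r => by
    ext y
    simp [Real.dist_eq]
  calc ∫⁻ y in Metric.closedBall k δ, G y * ENNReal.ofReal (ε / ((y - k) ^ 2 + ε ^ 2))
      ≤ ∫⁻ y in Metric.closedBall k δ, ∑' j : ℕ, ENNReal.ofReal (4 / (4 ^ j * ε)) *
          (Metric.closedBall k (2 ^ j * ε)).indicator G y := by
        refine lintegral_mono fun y => ?_
        refine (mul_le_mul_right (poisson_le_tsum hε (y - k)) _).trans ?_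
        rw [← ENNReal.tsum_mul_left]
        refine ENNReal.tsum_le_tsum fun j => ?_
        rw [mul_left_comm]
        refine mul_le_mul_right (le_of_eq ?_) _
        by_cases hy : y ∈ Metric.closedBall k (2 ^ j * ε)
        · rw [indicator_of_mem hy, indicator_of_mem (by rw [← hball] at hy; exact hy),
            Pi.one_apply, mul_one]
        · rw [indicator_of_notMem hy, indicator_of_notMem (by rw [← hball] at hy; exact hy),
            mul_zero]
    _ = ∑' j : ℕ, ENNReal.ofReal (4 / (4 ^ j * ε)) *
          ∫⁻ y in Metric.closedBall k δ, (Metric.closedBall k (2 ^ j * ε)).indicator G y := by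
        rw [lintegral_tsum fun j =>
          ((hG.indicator measurableSet_closedBall).const_mul _).restrict]
        congr 1 with j
        exact lintegral_const_mul' _ _ ENNReal.ofReal_ne_top
    _ ≤ ∑' j : ℕ, ENNReal.ofReal (8 * η) * (2⁻¹) ^ j := by
        refine ENNReal.tsum_le_tsum fun j => ?_
        have hle : ∫⁻ y in Metric.closedBall k δ,
            (Metric.closedBall k (2 ^ j * ε)).indicator G y ≤
            ENNReal.ofReal (2 * (2 ^ j * ε) * η) := by
          rw [setLIntegral_indicator measurableSet_closedBall]
          rcases le_total (2 ^ j * ε) δ with hj | hj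
          · exact (lintegral_mono_set inter_subset_left).trans (h _ (by positivity) hj)
          · refine (lintegral_mono_set inter_subset_right).trans ((h δ hδ le_rfl).trans ?_)
            exact ENNReal.ofReal_le_ofReal (by gcongr)
        refine (mul_le_mul_right hle _).trans (le_of_eq ?_)
        rw [← ENNReal.ofReal_mul (by positivity)]
        have h2 : (2⁻¹ : ℝ≥0∞) ^ j = ENNReal.ofReal ((2⁻¹ : ℝ) ^ j) := by
          rw [ENNReal.ofReal_pow (by norm_num), ENNReal.ofReal_inv_of_pos (by norm_num)]
          norm_num
        rw [h2, ← ENNReal.ofReal_mul (by positivity)]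
        congr 1
        have h4 : (4 : ℝ) ^ j = 2 ^ j * 2 ^ j := by rw [← mul_pow]; norm_num
        rw [h4, inv_pow]
        field_simp
        ring
    _ = ENNReal.ofReal (16 * η) := by
        rw [ENNReal.tsum_mul_left, ENNReal.tsum_geometric, ENNReal.one_sub_inv_two, inv_inv,
          show (2 : ℝ≥0∞) = ENNReal.ofReal 2 by norm_num, ← ENNReal.ofReal_mul (by positivity)]
        congr 1
        ring

theorem poisson_le_of_far {ε δ t : ℝ} (hε : 0 < ε) (hδ : 0 < δ) (ht : δ < |t|) :
    ε / (t ^ 2 + ε ^ 2) ≤ ε * (1 + (δ ^ 2)⁻¹) * (1 / (t ^ 2 + 1 ^ 2)) := by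
  have h1 : δ ^ 2 < t ^ 2 := by
    rw [← sq_abs t]
    exact pow_lt_pow_left₀ ht hδ.le two_ne_zero
  have h2 : 1 ≤ (δ ^ 2)⁻¹ * t ^ 2 := by
    rw [inv_mul_eq_div, one_le_div (by positivity)]
    exact h1.le
  have h3 : 0 < (δ ^ 2)⁻¹ := by positivity
  rw [mul_one_div, div_le_div_iff₀ (by positivity) (by positivity), mul_assoc]
  refine mul_le_mul_of_nonneg_left ?_ hε.le
  nlinarith [sq_nonneg ε, mul_nonneg h3.le (sq_nonneg ε)]

/-- Near k the small averages of G control the integral uniformly in ε; away from k the Poisson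
kernel is O(ε) times its value at ε = 1, whose integral is finite. -/
theorem tendsto_lintegral_poisson {G : ℝ → ℝ≥0∞} (hG : AEMeasurable G) {k : ℝ}
    (hfin : ∫⁻ y, G y * ENNReal.ofReal (1 / ((y - k) ^ 2 + 1 ^ 2)) ≠ ∞)
    (h : ∀ η > 0, ∃ δ > 0, ∀ r, 0 < r → r ≤ δ →
      ∫⁻ y in Metric.closedBall k r, G y ≤ ENNReal.ofReal (2 * r * η)) :
    Tendsto (fun ε : ℝ => ∫⁻ y, G y * ENNReal.ofReal (ε / ((y - k) ^ 2 + ε ^ 2)))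
      (𝓝[>] 0) (𝓝 0) := by
  refine ENNReal.tendsto_nhds_zero.2 fun e he => ?_
  obtain ⟨η, hη, hη'⟩ : ∃ η : ℝ, 0 < η ∧ ENNReal.ofReal (16 * η) ≤ e / 2 := by
    have : Tendsto (fun η : ℝ => ENNReal.ofReal (16 * η)) (𝓝[>] 0) (𝓝 0) := by
      have h1 : Continuous fun η : ℝ => ENNReal.ofReal (16 * η) :=
        ENNReal.continuous_ofReal.comp (by fun_prop)
      simpa using (h1.tendsto 0).mono_left nhdsWithin_le_nhds
    obtain ⟨η, h1, h2⟩ := ((ENNReal.tendsto_nhds_zero.1 this (e / 2)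
      (ENNReal.half_pos he.ne')).and self_mem_nhdsWithin).exists
    exact ⟨η, h2, h1⟩
  obtain ⟨δ, hδ, hr⟩ := h η hη
  set L := ∫⁻ y, G y * ENNReal.ofReal (1 / ((y - k) ^ 2 + 1 ^ 2))
  have hlim : Tendsto (fun ε : ℝ => ENNReal.ofReal (ε * (1 + (δ ^ 2)⁻¹)) * L)
      (𝓝[>] 0) (𝓝 0) := by
    have h1 : Continuous fun ε : ℝ => ENNReal.ofReal (ε * (1 + (δ ^ 2)⁻¹)) :=
      ENNReal.continuous_ofReal.comp (by fun_prop)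
    have h2 := ENNReal.Tendsto.mul_const ((h1.tendsto 0).mono_left (nhdsWithin_le_nhds (s := Ioi 0)))
      (b := L) (Or.inr hfin)
    simpa using h2
  filter_upwards [ENNReal.tendsto_nhds_zero.1 hlim (e / 2) (ENNReal.half_pos he.ne'),
    self_mem_nhdsWithin] with ε h1 hε
  rw [← lintegral_add_compl _ (measurableSet_closedBall (x := k) (ε := δ)), ← ENNReal.add_halves e]
  refine add_le_add ((lintegral_poisson_near_le hG hδ hε hη.le hr).trans hη')
    (le_trans ?_ h1)
  rw [← lintegral_const_mul' _ _ ENNReal.ofReal_ne_top]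
  refine le_trans ?_ (setLIntegral_le_lintegral (Metric.closedBall k δ)ᶜ _)
  refine setLIntegral_mono' measurableSet_closedBall.compl fun y hy => ?_
  rw [mul_left_comm, ← ENNReal.ofReal_mul (mul_nonneg (le_of_lt hε) (by positivity))]
  refine mul_le_mul_right (ENNReal.ofReal_le_ofReal (poisson_le_of_far hε hδ ?_)) _
  simpa [Real.dist_eq] using hy

theorem ne_of_pos_of_neg {k ε : ℝ} (hε : 0 < ε) :
    ((k : ℂ) + ε * Complex.I) - (k - ε * Complex.I) ≠ 0 := by
  intro h
  have := congrArg Complex.im h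
  simp at this
  linarith

theorem kernel_sub_kernel {k ε : ℝ} (hε : 0 < ε) (y : ℝ) :
    ((y : ℂ) - (k + ε * Complex.I))⁻¹ - ((y : ℂ) - (k - ε * Complex.I))⁻¹ =
      2 * Complex.I * ((ε / ((y - k) ^ 2 + ε ^ 2) : ℝ) : ℂ) := by
  have h1 : (y : ℂ) - (k + ε * Complex.I) ≠ 0 := sub_ne_zero_of_im (by simpa using hε.ne') y
  have h2 : (y : ℂ) - (k - ε * Complex.I) ≠ 0 := sub_ne_zero_of_im (by simpa using hε.ne') y
  have h3 : ((y : ℂ) - k) ^ 2 + (ε : ℂ) ^ 2 =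
      ((y : ℂ) - (k + ε * Complex.I)) * ((y : ℂ) - (k - ε * Complex.I)) := by
    ring_nf
    simp
  push_cast
  rw [h3]
  field_simp
  ring

theorem integral_kernel_sub_kernel {k ε : ℝ} (hε : 0 < ε) :
    ∫ y : ℝ, (((y : ℂ) - (k + ε * Complex.I))⁻¹ - ((y : ℂ) - (k - ε * Complex.I))⁻¹) =
      2 * Real.pi * Complex.I := by
  have h0 := ne_of_pos_of_neg (k := k) hε
  have ha : ((k : ℂ) + ε * Complex.I).im ≠ 0 := by simpa using hε.ne'
  have hb : ((k : ℂ) - ε * Complex.I).im ≠ 0 := by simpa using hε.ne'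
  have h1 := integral_kernel_mul_of_im_pos_of_im_neg (a := (k : ℂ) + ε * Complex.I)
    (b := k - ε * Complex.I) (by simpa using hε) (by simpa using hε)
  simp_rw [kernel_mul_eq ha hb (sub_ne_zero.1 h0)] at h1
  rw [integral_const_mul] at h1
  exact mul_left_cancel₀ (inv_ne_zero h0) h1

/-- The jump of the Cauchy transform across the real line. -/
theorem ae_tendsto_cauchy_sub {F : ℝ → ℂ} (hF : Admissible F) : ∀ᵐ k : ℝ,
    Tendsto (fun ε : ℝ => cauchy F (k + ε * Complex.I) - cauchy F (k - ε * Complex.I))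
      (𝓝[>] 0) (𝓝 (2 * Real.pi * Complex.I * F k)) := by
  have hloc := hF.locallyIntegrable
  filter_upwards [IsUnifLocDoublingMeasure.ae_tendsto_average_norm_sub volume hloc 1] with k hk
  have hk' := hk (fun _ : ℝ => k) id (l := 𝓝[>] (0 : ℝ)) tendsto_id
    (by filter_upwards [self_mem_nhdsWithin] with r hr; simpa using le_of_lt hr)
  -- At a Lebesgue point k the averages of G tend to 0. The difference of the kernels at k ± iε is
  -- 2i times the Poisson kernel and has integral 2πi, so the error in the jump is at most twice the
  -- Poisson integral of G.
  set G : ℝ → ℝ≥0∞ := fun y => ‖F y - F k‖ₑ with hGdef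
  have hGm : AEMeasurable G := (hloc.aestronglyMeasurable.sub
    aestronglyMeasurable_const).enorm
  have him : ∀ {ε : ℝ}, 0 < ε → ((k : ℂ) + ε * Complex.I).im ≠ 0 ∧
      ((k : ℂ) - ε * Complex.I).im ≠ 0 := fun hε => ⟨by simpa using hε.ne', by simpa using hε.ne'⟩
  have hint : ∀ {ε : ℝ}, 0 < ε → Integrable fun y : ℝ => F y *
      (((y : ℂ) - (k + ε * Complex.I))⁻¹ - ((y : ℂ) - (k - ε * Complex.I))⁻¹) := fun hε => by
    simp only [mul_sub, ← div_eq_mul_inv]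
    exact (hF _ (him hε).1).sub (hF _ (him hε).2)
  have hint2 : ∀ {ε : ℝ}, 0 < ε → Integrable fun y : ℝ =>
      (((y : ℂ) - (k + ε * Complex.I))⁻¹ - ((y : ℂ) - (k - ε * Complex.I))⁻¹) := fun hε => by
    simp_rw [← fun y => (inv_mul_eq_iff_eq_mul₀ (inv_ne_zero (ne_of_pos_of_neg (k := k) hε))).2
      (kernel_mul_eq (him hε).1 (him hε).2 (sub_ne_zero.1 (ne_of_pos_of_neg hε)) y)]
    exact (integrable_kernel_mul (him hε).1 (him hε).2).const_mul _
  have hint3 : ∀ {ε : ℝ}, 0 < ε → Integrable fun y : ℝ => (F y - F k) *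
      (((y : ℂ) - (k + ε * Complex.I))⁻¹ - ((y : ℂ) - (k - ε * Complex.I))⁻¹) := fun hε => by
    simp only [sub_mul (F _) (F k)]
    exact (hint hε).sub ((hint2 hε).const_mul (F k))
  have hen : ∀ {ε : ℝ}, 0 < ε → ∀ y : ℝ, ‖(F y - F k) *
      (((y : ℂ) - (k + ε * Complex.I))⁻¹ - ((y : ℂ) - (k - ε * Complex.I))⁻¹)‖ₑ =
      2 * (G y * ENNReal.ofReal (ε / ((y - k) ^ 2 + ε ^ 2))) := fun {ε} hε y => by
    rw [kernel_sub_kernel hε, enorm_mul, enorm_mul, enorm_mul, hGdef]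
    have e1 : ‖(2 : ℂ)‖ₑ = 2 := by
      rw [← ofReal_norm]; simp
    have e2 : ‖Complex.I‖ₑ = 1 := by
      rw [← ofReal_norm]; simp
    have e3 : ‖((ε / ((y - k) ^ 2 + ε ^ 2) : ℝ) : ℂ)‖ₑ =
        ENNReal.ofReal (ε / ((y - k) ^ 2 + ε ^ 2)) := by
      rw [← ofReal_norm, Complex.norm_real, Real.norm_of_nonneg (by positivity)]
    rw [e1, e2, e3]
    ring
  have hmain : Tendsto (fun ε : ℝ => ∫⁻ y, G y * ENNReal.ofReal (ε / ((y - k) ^ 2 + ε ^ 2)))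
      (𝓝[>] 0) (𝓝 0) := by
    refine tendsto_lintegral_poisson hGm ?_ fun η hη => ?_
    -- Finiteness at ε = 1 is admissibility of F at k ± i.
    · have h1 := (hint3 one_pos).2
      rw [HasFiniteIntegral] at h1
      simp_rw [hen one_pos] at h1
      rw [lintegral_const_mul' _ _ (by norm_num)] at h1
      intro htop
      rw [htop] at h1
      simp at h1
    · obtain ⟨δ, hδ, hb⟩ := (mem_nhdsGT_iff_exists_Ioc_subset).1
        ((tendsto_order.1 hk').2 η hη)
      refine ⟨δ, hδ, fun r hr hrδ => ?_⟩
      have h2 : (⨍ y in Metric.closedBall k r, ‖F y - F k‖) < η := hb ⟨hr, hrδ⟩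
      have h3 : IntegrableOn (fun y => F y - F k) (Metric.closedBall k r) :=
        (hloc.integrableOn_isCompact (isCompact_closedBall k r)).sub
          (integrableOn_const (isCompact_closedBall k r).measure_lt_top.ne)
      rw [hGdef, ← ofReal_integral_norm_eq_lintegral_enorm h3]
      refine ENNReal.ofReal_le_ofReal ?_
      have hv : volume.real (Metric.closedBall k r) = 2 * r := by
        rw [Measure.real, Real.volume_closedBall, ENNReal.toReal_ofReal (by positivity)]
      rw [setAverage_eq, hv, smul_eq_mul, inv_mul_lt_iff₀ (by positivity)] at h2
      exact h2.le
  rw [tendsto_iff_edist_tendsto_0]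
  have h2 := ENNReal.Tendsto.const_mul hmain (a := 2) (Or.inr (by norm_num))
  rw [mul_zero] at h2
  refine tendsto_of_tendsto_of_tendsto_of_le_of_le' tendsto_const_nhds h2
    (Eventually.of_forall fun _ => zero_le) ?_
  filter_upwards [self_mem_nhdsWithin] with ε hε
  have hd : cauchy F (k + ε * Complex.I) - cauchy F (k - ε * Complex.I) -
      2 * Real.pi * Complex.I * F k = ∫ y : ℝ, (F y - F k) *
      (((y : ℂ) - (k + ε * Complex.I))⁻¹ - ((y : ℂ) - (k - ε * Complex.I))⁻¹) := by
    simp_rw [sub_mul (F _) (F k)]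
    rw [integral_sub (hint hε) ((hint2 hε).const_mul (F k)), integral_const_mul,
      integral_kernel_sub_kernel hε, cauchy, cauchy,
      ← integral_sub (hF _ (him hε).1) (hF _ (him hε).2)]
    simp only [mul_sub, div_eq_mul_inv]
    ring
  rw [edist_eq_enorm_sub, hd]
  refine (enorm_integral_le_lintegral_enorm _).trans (le_of_eq ?_)
  simp_rw [hen hε]
  exact lintegral_const_mul' _ _ (by norm_num)

theorem two_pi_I_ne_zero : (2 * Real.pi * Complex.I : ℂ) ≠ 0 := Complex.two_pi_I_ne_zero

/-- A function is determined by its Cauchy transform. -/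
theorem ae_eq_zero_of_cauchy_eq_zero {F : ℝ → ℂ} (hF : Admissible F)
    (h : ∀ z : ℂ, z.im ≠ 0 → cauchy F z = 0) : F =ᵐ[volume] 0 := by
  filter_upwards [ae_tendsto_cauchy_sub hF] with k hk
  have h0 : Tendsto (fun ε : ℝ => cauchy F (k + ε * Complex.I) - cauchy F (k - ε * Complex.I))
      (𝓝[>] 0) (𝓝 0) := by
    refine tendsto_const_nhds.congr' ?_
    filter_upwards [self_mem_nhdsWithin] with ε hε
    have hε' : (ε : ℝ) ≠ 0 := ne_of_gt hε
    rw [h _ (by simpa using hε'), h _ (by simpa using hε'), sub_zero]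
  exact (mul_eq_zero.1 (tendsto_nhds_unique hk h0)).resolve_left two_pi_I_ne_zero

/-! ### Upper and lower functions -/

/-- Boundary values of functions that are analytic in the upper half-plane. -/
def IsUpper (A : ℝ → ℂ) : Prop := ∀ z : ℂ, z.im < 0 → cauchy A z = 0

/-- Boundary values of functions that are analytic in the lower half-plane. -/
def IsLower (A : ℝ → ℂ) : Prop := ∀ z : ℂ, 0 < z.im → cauchy A z = 0

theorem IsUpper.conj {A : ℝ → ℂ} (hA : IsUpper A) : IsLower fun x => conj (A x) := fun z hz => by
  rw [cauchy_conj, hA _ (by simpa using hz), map_zero]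

theorem IsLower.conj {A : ℝ → ℂ} (hA : IsLower A) : IsUpper fun x => conj (A x) := fun z hz => by
  rw [cauchy_conj, hA _ (by simpa using hz), map_zero]

/-- `u` is the sum of the upper function `A` and the lower function `B`. -/
structure Split (u A B : ℝ → ℂ) : Prop where
  eq : u =ᵐ[volume] fun x => A x + B x
  upper : IsUpper A
  lower : IsLower B
  adm_upper : Admissible A
  adm_lower : Admissible B

theorem Split.cauchy_of_im_pos {u A B : ℝ → ℂ} (h : Split u A B) {z : ℂ} (hz : 0 < z.im) :
    cauchy u z = cauchy A z := by
  rw [cauchy_congr h.eq, cauchy_add h.adm_upper h.adm_lower hz.ne', h.lower z hz, add_zero]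

theorem Split.cauchy_of_im_neg {u A B : ℝ → ℂ} (h : Split u A B) {z : ℂ} (hz : z.im < 0) :
    cauchy u z = cauchy B z := by
  rw [cauchy_congr h.eq, cauchy_add h.adm_upper h.adm_lower hz.ne, h.upper z hz, zero_add]

/-- Below the line K A vanishes and above it K B vanishes, so the jump of K A across the line is
itself the boundary value of K u. -/
theorem Split.hasUpperValue {u A B : ℝ → ℂ} (h : Split u A B) :
    ∀ᵐ k : ℝ, HasUpperValue u k (2 * Real.pi * Complex.I * A k) := by
  filter_upwards [ae_tendsto_cauchy_sub h.adm_upper] with k hk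
  refine hk.congr' ?_
  filter_upwards [self_mem_nhdsWithin] with ε hε
  have hε' : (0 : ℝ) < ε := hε
  rw [h.upper (k - ε * Complex.I) (by simpa using hε'), sub_zero, h.cauchy_of_im_pos (by simpa using hε')]

theorem Split.hasLowerValue {u A B : ℝ → ℂ} (h : Split u A B) :
    ∀ᵐ k : ℝ, HasLowerValue u k (-(2 * Real.pi * Complex.I * B k)) := by
  filter_upwards [ae_tendsto_cauchy_sub h.adm_lower] with k hk
  refine hk.neg.congr' ?_
  filter_upwards [self_mem_nhdsWithin] with ε hε
  have hε' : (0 : ℝ) < ε := hε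
  rw [h.lower _ (by simpa using hε'), zero_sub, neg_neg, h.cauchy_of_im_neg (by simpa using hε')]

theorem Split.upperValue_eq {u A B : ℝ → ℂ} (h : Split u A B) :
    ∀ᵐ k : ℝ, upperValue u k = 2 * Real.pi * Complex.I * A k := by
  filter_upwards [h.hasUpperValue] with k hk
  exact hk.limUnder_eq

theorem Split.lowerValue_eq {u A B : ℝ → ℂ} (h : Split u A B) :
    ∀ᵐ k : ℝ, lowerValue u k = -(2 * Real.pi * Complex.I * B k) := by
  filter_upwards [h.hasLowerValue] with k hk
  exact hk.limUnder_eq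

/-! ### The square integrable theory -/

theorem integrable_mul_of_memLp {f g : ℝ → ℂ} (p q : ℝ≥0∞) [ENNReal.HolderConjugate p q]
    (hf : MemLp f p volume) (hg : MemLp g q volume) : Integrable fun x => f x * g x := by
  have : ENNReal.HolderTriple p q 1 := inferInstance
  exact hf.integrable_mul hg

theorem integrable_mul_of_memLp_two {f g : ℝ → ℂ}
    (hf : MemLp f 2 volume) (hg : MemLp g 2 volume) : Integrable fun x => f x * g x :=
  integrable_mul_of_memLp 2 2 hf hg

theorem integral_kernel_sq {a : ℂ} (ha : a.im ≠ 0) :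
    ∫ t : ℝ, ((t : ℂ) - a)⁻¹ * ((t : ℂ) - a)⁻¹ = 0 := by
  have hd : ∀ x : ℝ, HasDerivAt (fun t : ℝ => -((t : ℂ) - a)⁻¹)
      (((x : ℂ) - a)⁻¹ * ((x : ℂ) - a)⁻¹) x := fun x => by
    have h1 : HasDerivAt (fun t : ℝ => (t : ℂ) - a) 1 x := by
      simpa using (Complex.ofRealCLM.hasDerivAt (x := x)).sub_const a
    have h2 := (h1.inv (sub_ne_zero_of_im ha x)).neg
    have e : -(-1 / ((x : ℂ) - a) ^ 2) = ((x : ℂ) - a)⁻¹ * ((x : ℂ) - a)⁻¹ := by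
      rw [neg_div, neg_neg, one_div, sq, mul_inv]
    rw [e] at h2
    exact h2
  have hb : ∀ x : ℝ, ‖-((x : ℂ) - a)⁻¹‖ ≤ |x - a.re|⁻¹ ∨ x = a.re := fun x => by
    by_cases hx : x = a.re
    · exact Or.inr hx
    · left
      rw [norm_neg, norm_inv]
      refine inv_anti₀ (abs_pos.2 (sub_ne_zero.2 hx)) ?_
      simpa using Complex.abs_re_le_norm ((x : ℂ) - a)
  have htop : Tendsto (fun t : ℝ => -((t : ℂ) - a)⁻¹) atTop (𝓝 0) := by
    refine squeeze_zero_norm' (a := fun x : ℝ => |x - a.re|⁻¹) ?_ ?_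
    · filter_upwards [eventually_gt_atTop a.re] with x hx
      exact (hb x).resolve_right hx.ne'
    · exact tendsto_inv_atTop_zero.comp
        (tendsto_abs_atTop_atTop.comp (tendsto_atTop_add_const_right _ (-a.re) tendsto_id))
  have hbot : Tendsto (fun t : ℝ => -((t : ℂ) - a)⁻¹) atBot (𝓝 0) := by
    refine squeeze_zero_norm' (a := fun x : ℝ => |x - a.re|⁻¹) ?_ ?_
    · filter_upwards [eventually_lt_atBot a.re] with x hx
      exact (hb x).resolve_right hx.ne
    · exact tendsto_inv_atTop_zero.comp
        (tendsto_abs_atBot_atTop.comp (tendsto_atBot_add_const_right _ (-a.re) tendsto_id))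
  rw [integral_of_hasDerivAt_of_tendsto hd (integrable_kernel_mul ha ha) hbot htop, sub_zero]

/-- The pole w lies in the upper half-plane. Partial fractions treat z ≠ w; for z = w the integrand
has a primitive that vanishes at both ends. -/
theorem isLower_kernel {w : ℂ} (hw : 0 < w.im) : IsLower fun x : ℝ => ((x : ℂ) - w)⁻¹ := by
  intro z hz
  simp only [cauchy, div_eq_mul_inv]
  by_cases h : w = z
  · rw [h, integral_kernel_sq hz.ne']
  · exact integral_kernel_mul_of_im_pos hw hz h

/-- The Cauchy kernel as an element of `L²`. -/
def kernelLp (w : ℂ) (hw : w.im ≠ 0) : L2 := (memLp_kernel_two hw).toLp _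

theorem inner_eq_integral (f g : L2) : inner ℂ f g = ∫ x : ℝ, g x * conj (f x) := by
  rw [L2.inner_def]
  refine integral_congr_ae (Eventually.of_forall fun x => ?_)
  simp

theorem inner_toLp_eq_integral {f g : ℝ → ℂ} (hf : MemLp f 2 volume) (hg : MemLp g 2 volume) :
    inner ℂ (hf.toLp f) (hg.toLp g) = ∫ x : ℝ, g x * conj (f x) := by
  rw [inner_eq_integral]
  refine integral_congr_ae ?_
  filter_upwards [hf.coeFn_toLp, hg.coeFn_toLp] with x h1 h2
  rw [h1, h2]

theorem inner_kernelLp (f : L2) {z : ℂ} (hz : z.im ≠ 0) :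
    inner ℂ (kernelLp (conj z) (by simpa using hz)) f = cauchy f z := by
  rw [inner_eq_integral, cauchy]
  refine integral_congr_ae ?_
  filter_upwards [(memLp_kernel_two (z := conj z) (by simpa using hz)).coeFn_toLp] with x hx
  rw [kernelLp, hx, div_eq_mul_inv]
  simp

/-- The square integrable boundary values of analytic functions in the lower half-plane. -/
def lowerSpace : Submodule ℂ L2 :=
  (Submodule.span ℂ {f : L2 | ∃ (w : ℂ) (hw : 0 < w.im), f = kernelLp w hw.ne'}).topologicalClosure

instance : CompleteSpace lowerSpace :=
  (Submodule.isClosed_topologicalClosure _).completeSpace_coe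

theorem isLower_of_mem_lowerSpace {f : L2} (hf : f ∈ lowerSpace) : IsLower f := by
  intro z hz
  have hz' : (conj z).im ≠ 0 := by simpa using hz.ne'
  have hle : lowerSpace ≤ (Submodule.span ℂ {kernelLp (conj z) hz'})ᗮ := by
    refine Submodule.topologicalClosure_minimal _ (Submodule.span_le.2 ?_)
      (Submodule.isClosed_orthogonal _)
    rintro _ ⟨w, hw, rfl⟩
    rw [SetLike.mem_coe, Submodule.mem_orthogonal_singleton_iff_inner_right, inner_kernelLp _ hz.ne',
      kernelLp, cauchy_congr (memLp_kernel_two hw.ne').coeFn_toLp]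
    exact isLower_kernel hw z hz
  have := hle hf
  rwa [Submodule.mem_orthogonal_singleton_iff_inner_right, inner_kernelLp _ hz.ne'] at this

/-- By `inner_kernelLp`, the Cauchy transform at a point z of the lower half-plane is the inner
product with the kernel at conj z, which is a generator of `lowerSpace`. -/
theorem isUpper_iff_mem_orthogonal (f : L2) : IsUpper f ↔ f ∈ lowerSpaceᗮ := by
  constructor
  · intro h
    rw [lowerSpace, Submodule.orthogonal_closure, Submodule.mem_orthogonal]
    intro u hu
    induction hu using Submodule.span_induction with
    | mem x hx =>
      obtain ⟨w, hw, rfl⟩ := hx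
      have h1 := inner_kernelLp f (z := conj w) (by simpa using hw.ne')
      rw [h _ (by simpa using hw)] at h1
      simpa using h1
    | zero => simp
    | add x y _ _ hx hy => rw [inner_add_left, hx, hy, add_zero]
    | smul a x _ hx => rw [inner_smul_left, hx, mul_zero]
  · intro h z hz
    rw [← inner_kernelLp f hz.ne]
    refine (Submodule.mem_orthogonal _ _).1 h _ ?_
    exact Submodule.le_topologicalClosure _ (Submodule.subset_span ⟨conj z, by simpa using hz, rfl⟩)

theorem IsUpper.congr {A B : ℝ → ℂ} (hA : IsUpper A) (h : A =ᵐ[volume] B) : IsUpper B :=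
  fun z hz => by rw [← cauchy_congr h, hA z hz]

theorem IsLower.congr {A B : ℝ → ℂ} (hA : IsLower A) (h : A =ᵐ[volume] B) : IsLower B :=
  fun z hz => by rw [← cauchy_congr h, hA z hz]

/-- The orthogonal projections onto `lowerSpace` and its complement give the two parts, whence the
norm bound with constant 1. -/
theorem exists_split {u : ℝ → ℂ} (hu : MemLp u 2 volume) :
    ∃ A B, MemLp A 2 volume ∧ MemLp B 2 volume ∧ Split u A B ∧
      eLpNorm A 2 volume ≤ eLpNorm u 2 volume := by
  set f : L2 := hu.toLp u
  set b : L2 := lowerSpace.starProjection f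
  set a : L2 := lowerSpaceᗮ.starProjection f
  have hab : b + a = f := Submodule.starProjection_add_starProjection_orthogonal f
  refine ⟨a, b, Lp.memLp a, Lp.memLp b, ⟨?_, ?_, ?_, admissible_of_memLp_two (Lp.memLp a),
    admissible_of_memLp_two (Lp.memLp b)⟩, ?_⟩
  · filter_upwards [hu.coeFn_toLp, Lp.coeFn_add b a] with x h1 h2
    rw [← h1]
    change f x = _
    rw [← hab, h2, Pi.add_apply, add_comm]
  · exact (isUpper_iff_mem_orthogonal a).2 (Submodule.starProjection_apply_mem _ _)
  · exact isLower_of_mem_lowerSpace (Submodule.starProjection_apply_mem _ _)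
  · have h1 : ‖a‖ ≤ ‖f‖ := Submodule.norm_starProjection_apply_le _ _
    have h2 := enorm_le_iff_norm_le.2 h1
    rw [Lp.enorm_def, Lp.enorm_def] at h2
    rwa [eLpNorm_congr_ae hu.coeFn_toLp] at h2

theorem IsUpper.ae_eq_zero {A : ℝ → ℂ} (hA : Admissible A) (h : IsUpper A) (h' : IsLower A) :
    A =ᵐ[volume] 0 :=
  ae_eq_zero_of_cauchy_eq_zero hA fun z hz =>
    (lt_or_gt_of_ne hz).elim (h z) (h' z)

theorem IsUpper.sub {A B : ℝ → ℂ} (hA : IsUpper A) (hB : IsUpper B) (h : Admissible A)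
    (h' : Admissible B) : IsUpper fun x => A x - B x := fun z hz => by
  rw [cauchy_sub h h' hz.ne, hA z hz, hB z hz, sub_zero]

theorem IsLower.sub {A B : ℝ → ℂ} (hA : IsLower A) (hB : IsLower B) (h : Admissible A)
    (h' : Admissible B) : IsLower fun x => A x - B x := fun z hz => by
  rw [cauchy_sub h h' hz.ne', hA z hz, hB z hz, sub_zero]

theorem IsLower.neg {A : ℝ → ℂ} (hA : IsLower A) : IsLower fun x => -A x := fun z hz => by
  have := cauchy_const_mul A (-1) z
  simp only [neg_one_mul] at this
  rw [this, hA z hz, neg_zero]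

/-- The difference of two upper parts equals a difference of lower parts, so its Cauchy transform
vanishes off the line. -/
theorem Split.unique {u A B A' B' : ℝ → ℂ} (h : Split u A B) (h' : Split u A' B') :
    A =ᵐ[volume] A' ∧ B =ᵐ[volume] B' := by
  have h1 : (fun x => A x - A' x) =ᵐ[volume] fun x => B' x - B x := by
    filter_upwards [h.eq, h'.eq] with x h1 h2
    rw [sub_eq_sub_iff_add_eq_add, ← h1, h2, add_comm]
  have h0 := IsUpper.ae_eq_zero (h.adm_upper.sub h'.adm_upper)
    (h.upper.sub h'.upper h.adm_upper h'.adm_upper)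
    ((h'.lower.sub h.lower h'.adm_lower h.adm_lower).congr h1.symm)
  constructor
  · filter_upwards [h0] with x hx
    exact sub_eq_zero.1 hx
  · filter_upwards [h0, h1] with x hx hx1
    rw [hx] at hx1
    exact (sub_eq_zero.1 hx1.symm).symm

/-- The projection of a lower function onto the orthogonal complement is both upper and lower, hence
zero. -/
theorem mem_lowerSpace_of_isLower {f : L2} (hf : IsLower f) : f ∈ lowerSpace := by
  set b : L2 := lowerSpace.starProjection f
  set a : L2 := lowerSpaceᗮ.starProjection f
  have hab : b + a = f := Submodule.starProjection_add_starProjection_orthogonal f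
  have hau : IsUpper a := (isUpper_iff_mem_orthogonal a).2 (Submodule.starProjection_apply_mem _ _)
  have hbm : b ∈ lowerSpace := Submodule.starProjection_apply_mem _ _
  have e : (fun x => f x - b x) =ᵐ[volume] a := by
    filter_upwards [Lp.coeFn_add b a] with x h2
    rw [← hab, h2, Pi.add_apply, add_sub_cancel_left]
  have hal : IsLower a := (hf.sub (isLower_of_mem_lowerSpace hbm)
    (admissible_of_memLp_two (Lp.memLp f)) (admissible_of_memLp_two (Lp.memLp b))).congr e
  have h0 : a = 0 := (Lp.eq_zero_iff_ae_eq_zero).2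
    (IsUpper.ae_eq_zero (admissible_of_memLp_two (Lp.memLp a)) hau hal)
  rw [← hab, h0, add_zero]
  exact hbm

theorem MemLp.conj {f : ℝ → ℂ} {p : ℝ≥0∞} (hf : MemLp f p volume) :
    MemLp (fun x => conj (f x)) p volume :=
  hf.star

/-- The integral is the inner product of conj A, a lower function, with B, and the two spaces are
orthogonal. -/
theorem IsUpper.integral_mul_eq_zero {A B : ℝ → ℂ} (hA : IsUpper A) (hB : IsUpper B)
    (hA2 : MemLp A 2 volume) (hB2 : MemLp B 2 volume) : ∫ x : ℝ, A x * B x = 0 := by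
  have h1 : (MemLp.conj hA2).toLp _ ∈ lowerSpace :=
    mem_lowerSpace_of_isLower (hA.conj.congr (MemLp.conj hA2).coeFn_toLp.symm)
  have h2 : hB2.toLp B ∈ lowerSpaceᗮ :=
    (isUpper_iff_mem_orthogonal _).1 (hB.congr hB2.coeFn_toLp.symm)
  have h3 := (Submodule.mem_orthogonal _ _).1 h2 _ h1
  rw [inner_toLp_eq_integral] at h3
  rw [← h3]
  refine integral_congr_ae (Eventually.of_forall fun x => ?_)
  simp [mul_comm]

theorem IsLower.integral_mul_eq_zero {A B : ℝ → ℂ} (hA : IsLower A) (hB : IsLower B)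
    (hA2 : MemLp A 2 volume) (hB2 : MemLp B 2 volume) : ∫ x : ℝ, A x * B x = 0 := by
  have h := hA.conj.integral_mul_eq_zero hB.conj (MemLp.conj hA2) (MemLp.conj hB2)
  simp only [← map_mul, integral_conj] at h
  simpa using h

/-! ### Products of upper functions and of lower functions -/

theorem continuousAt_cauchy {F : ℝ → ℂ} (hF : Admissible F) {z : ℂ} (hz : z.im ≠ 0) :
    ContinuousAt (cauchy F) z := by
  have him : 0 < |z.im| / 2 := by positivity
  have hball : ∀ w ∈ Metric.ball z (|z.im| / 2), ∀ x : ℝ, ‖(x : ℂ) - z‖ / 2 ≤ ‖(x : ℂ) - w‖ := by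
    intro w hw x
    rw [Metric.mem_ball, dist_eq_norm] at hw
    have h1 : |z.im| ≤ ‖(x : ℂ) - z‖ := by simpa using Complex.abs_im_le_norm ((x : ℂ) - z)
    have h2 : ‖(x : ℂ) - z‖ ≤ ‖(x : ℂ) - w‖ + ‖w - z‖ := by
      refine le_trans (le_of_eq ?_) (norm_add_le _ _)
      congr 1
      ring
    linarith
  refine continuousAt_of_dominated (bound := fun x => 2 * ‖F x / ((x : ℂ) - z)‖) ?_ ?_ ?_ ?_
  · filter_upwards [Metric.ball_mem_nhds z him] with w hw
    have hw' : w.im ≠ 0 := fun h => by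
      have := Complex.abs_im_le_norm (w - z)
      rw [Metric.mem_ball, dist_eq_norm] at hw
      rw [Complex.sub_im, h, zero_sub, abs_neg] at this
      linarith
    exact (hF w hw').1
  · filter_upwards [Metric.ball_mem_nhds z him] with w hw
    refine Eventually.of_forall fun x => ?_
    have h0 : 0 < ‖(x : ℂ) - z‖ := norm_pos_iff.2 (sub_ne_zero_of_im hz x)
    rw [norm_div, norm_div]
    calc ‖F x‖ / ‖(x : ℂ) - w‖ ≤ ‖F x‖ / (‖(x : ℂ) - z‖ / 2) := by
          gcongr
          exact hball w hw x
      _ = _ := by field_simp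
  · exact (hF z hz).norm.const_mul 2
  · refine Eventually.of_forall fun x => ?_
    exact continuousAt_const.div (by fun_prop) (sub_ne_zero_of_im hz x)

theorem cauchy_div {F : ℝ → ℂ} (hF : Admissible F) {z w : ℂ} (hz : z.im ≠ 0) (hw : w.im ≠ 0)
    (h : z ≠ w) :
    cauchy (fun x => F x / ((x : ℂ) - z)) w = (z - w)⁻¹ * (cauchy F z - cauchy F w) := by
  rw [cauchy, cauchy, cauchy, ← integral_sub (hF z hz) (hF w hw), ← integral_const_mul]
  refine integral_congr_ae (Eventually.of_forall fun x => ?_)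
  have := kernel_mul_eq hz hw h x
  simp only [div_eq_mul_inv]
  rw [mul_assoc, this]
  ring

theorem MemLp.div_sub {F : ℝ → ℂ} {p : ℝ≥0∞} (hF : MemLp F p volume) {z : ℂ} (hz : z.im ≠ 0) :
    MemLp (fun x : ℝ => F x / ((x : ℂ) - z)) p volume := by
  simp only [div_eq_mul_inv]
  have : ENNReal.HolderTriple p ∞ p := inferInstance
  exact (memLp_kernel_top hz).mul (r := p) hF

/-- A pole in the lower half-plane does not disturb analyticity in the upper one. Partial fractions
give the vanishing at w ≠ z, and continuity of the Cauchy transform fills in w = z. -/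
theorem IsUpper.div_sub {A : ℝ → ℂ} (hA : IsUpper A) (hA2 : MemLp A 2 volume) {z : ℂ}
    (hz : z.im < 0) : IsUpper fun x => A x / ((x : ℂ) - z) := by
  have hadm := admissible_of_memLp_two hA2
  have hne : ∀ w : ℂ, w.im < 0 → w ≠ z → cauchy (fun x => A x / ((x : ℂ) - z)) w = 0 :=
    fun w hw h => by
      rw [cauchy_div hadm hz.ne hw.ne h.symm, hA z hz, hA w hw, sub_zero, mul_zero]
  intro w hw
  by_cases h : w = z
  · subst h
    have hc := (continuousAt_cauchy (admissible_of_memLp_two (MemLp.div_sub hA2 hz.ne))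
      hz.ne).tendsto.mono_left (nhdsWithin_le_nhds (s := {w}ᶜ))
    refine tendsto_nhds_unique hc (tendsto_const_nhds.congr' ?_)
    have : ∀ᶠ v in 𝓝 w, v.im < 0 := Complex.continuous_im.continuousAt.eventually_lt
      continuousAt_const hz
    filter_upwards [nhdsWithin_le_nhds this, self_mem_nhdsWithin] with v h1 h2
    exact (hne v h1 h2).symm
  · exact hne w hw h

/-- The kernel is absorbed into A, which stays upper and square integrable; then two upper functions
integrate to zero. -/
theorem IsUpper.mul {A B : ℝ → ℂ} (hA : IsUpper A) (hB : IsUpper B)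
    (hA2 : MemLp A 2 volume) (hB2 : MemLp B 2 volume) : IsUpper fun x => A x * B x := by
  intro z hz
  rw [cauchy, ← (hA.div_sub hA2 hz).integral_mul_eq_zero hB (MemLp.div_sub hA2 hz.ne) hB2]
  refine integral_congr_ae (Eventually.of_forall fun x => ?_)
  simp only
  ring

theorem IsLower.mul {A B : ℝ → ℂ} (hA : IsLower A) (hB : IsLower B)
    (hA2 : MemLp A 2 volume) (hB2 : MemLp B 2 volume) : IsLower fun x => A x * B x := by
  have h := (hA.conj.mul hB.conj (MemLp.conj hA2) (MemLp.conj hB2)).conj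
  simpa using h

theorem IsUpper.cauchy_mul {A B : ℝ → ℂ} (hA : IsUpper A) (hB : IsUpper B)
    (hA2 : MemLp A 2 volume) (hB2 : MemLp B 2 volume) {z : ℂ} (hz : 0 < z.im) :
    2 * Real.pi * Complex.I * cauchy (fun x => A x * B x) z = cauchy A z * cauchy B z := by
  -- By Cauchy's formula α is the value at z of the analytic extension of A. Subtracting it removes
  -- the pole, so (A - α)/(x - z) is upper and its product with B integrates to zero.
  set α := (2 * Real.pi * Complex.I)⁻¹ * cauchy A z
  have hα : 2 * Real.pi * Complex.I * α = cauchy A z := mul_inv_cancel_left₀ two_pi_I_ne_zero _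
  have hk : MemLp (fun x : ℝ => α * ((x : ℂ) - z)⁻¹) 2 volume :=
    (memLp_kernel_two hz.ne').const_mul α
  have h1 : MemLp (fun x : ℝ => A x / ((x : ℂ) - z) - α * ((x : ℂ) - z)⁻¹) 2 volume :=
    (MemLp.div_sub hA2 hz.ne').sub hk
  have h2 : IsUpper fun x : ℝ => A x / ((x : ℂ) - z) - α * ((x : ℂ) - z)⁻¹ := by
    intro w hw
    have hzw : z ≠ w := fun h => by rw [h] at hz; linarith
    rw [cauchy_sub (admissible_of_memLp_two (MemLp.div_sub hA2 hz.ne'))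
      (admissible_of_memLp_two hk) hw.ne, cauchy_div (admissible_of_memLp_two hA2) hz.ne' hw.ne hzw,
      cauchy_const_mul, hA w hw, sub_zero]
    have := integral_kernel_mul_of_im_pos_of_im_neg hz hw
    have e : cauchy (fun x : ℝ => ((x : ℂ) - z)⁻¹) w = (z - w)⁻¹ * (2 * Real.pi * Complex.I) := by
      simpa only [cauchy, div_eq_mul_inv] using this
    rw [e, ← hα]
    ring
  have h3 := h2.integral_mul_eq_zero hB h1 hB2
  have i1 : Integrable fun x : ℝ => A x * B x / ((x : ℂ) - z) :=
    admissible_of_integrable (integrable_mul_of_memLp_two hA2 hB2) z hz.ne'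
  have i2 : Integrable fun x : ℝ => α * (B x / ((x : ℂ) - z)) :=
    (admissible_of_memLp_two hB2 z hz.ne').const_mul α
  have h4 : cauchy (fun x => A x * B x) z - α * cauchy B z = 0 := by
    rw [← h3, cauchy, cauchy, ← integral_const_mul, ← integral_sub i1 i2]
    refine integral_congr_ae (Eventually.of_forall fun x => ?_)
    simp only
    ring
  rw [sub_eq_zero.1 h4, ← hα]
  ring

theorem IsLower.cauchy_mul {A B : ℝ → ℂ} (hA : IsLower A) (hB : IsLower B)
    (hA2 : MemLp A 2 volume) (hB2 : MemLp B 2 volume) {z : ℂ} (hz : z.im < 0) :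
    -(2 * Real.pi * Complex.I * cauchy (fun x => A x * B x) z) = cauchy A z * cauchy B z := by
  have h := hA.conj.cauchy_mul hB.conj (MemLp.conj hA2) (MemLp.conj hB2) (z := conj z)
    (by simpa using hz)
  simp only [← map_mul, cauchy_conj, Complex.conj_conj] at h
  have h' := congrArg conj h
  have e2 : (starRingEnd ℂ) 2 = 2 := Complex.conj_ofNat 2
  simpa [e2] using h'

/-- The product of two Cauchy transforms is a Cauchy transform. -/
theorem Split.cauchy_mul_cauchy {u v A B C D : ℝ → ℂ} (hu : Split u A B) (hv : Split v C D)
    (hA : MemLp A 2 volume) (hB : MemLp B 2 volume) (hC : MemLp C 2 volume)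
    (hD : MemLp D 2 volume) {z : ℂ} (hz : z.im ≠ 0) :
    cauchy u z * cauchy v z = 2 * Real.pi * Complex.I * cauchy (fun x => u x * C x - B x * v x) z := by
  -- The cross terms BC cancel. The form uC - Bv keeps the supports of u and v visible, while AC -
  -- BD is a sum of an upper and a lower function.
  have e : (fun x => u x * C x - B x * v x) =ᵐ[volume] fun x => A x * C x - B x * D x := by
    filter_upwards [hu.eq, hv.eq] with x h1 h2
    rw [h1, h2]
    ring
  rw [cauchy_congr e, cauchy_sub (admissible_of_integrable (integrable_mul_of_memLp_two hA hC))
    (admissible_of_integrable (integrable_mul_of_memLp_two hB hD)) hz]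
  rcases lt_or_gt_of_ne hz with h | h
  · rw [hu.upper.mul hv.upper hA hC z h, hu.cauchy_of_im_neg h, hv.cauchy_of_im_neg h,
      ← hu.lower.cauchy_mul hv.lower hB hD h]
    ring
  · rw [hu.lower.mul hv.lower hB hD z h, hu.cauchy_of_im_pos h, hv.cauchy_of_im_pos h,
      ← hu.upper.cauchy_mul hv.upper hA hC h]
    ring

/-- Both sides equal ∫ AD, since AC and BD integrate to zero. This is the duality between the two
projections. -/
theorem Split.integral_mul {u v A B C D : ℝ → ℂ} (hu : Split u A B) (hv : Split v C D)
    (hA : MemLp A 2 volume) (hB : MemLp B 2 volume) (hC : MemLp C 2 volume)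
    (hD : MemLp D 2 volume) : ∫ x : ℝ, A x * v x = ∫ x : ℝ, u x * D x := by
  have h1 : ∫ x : ℝ, A x * v x = ∫ x : ℝ, (A x * C x + A x * D x) := by
    refine integral_congr_ae ?_
    filter_upwards [hv.eq] with x hx
    rw [hx]
    ring
  have h2 : ∫ x : ℝ, u x * D x = ∫ x : ℝ, (B x * D x + A x * D x) := by
    refine integral_congr_ae ?_
    filter_upwards [hu.eq] with x hx
    rw [hx]
    ring
  rw [h1, h2, integral_add (integrable_mul_of_memLp_two hA hC) (integrable_mul_of_memLp_two hA hD),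
    integral_add (integrable_mul_of_memLp_two hB hD) (integrable_mul_of_memLp_two hA hD),
    hu.upper.integral_mul_eq_zero hv.upper hA hC, hu.lower.integral_mul_eq_zero hv.lower hB hD]

/-! ### Averages over intervals -/

/-- The uniform probability measure on `[-δ, δ]`. -/
def ballMeasure (δ : ℝ) : Measure ℝ :=
  (volume (Metric.closedBall (0 : ℝ) δ))⁻¹ • volume.restrict (Metric.closedBall 0 δ)

theorem isProbabilityMeasure_ballMeasure {δ : ℝ} (hδ : 0 < δ) :
    IsProbabilityMeasure (ballMeasure δ) := by
  refine ⟨?_⟩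
  rw [ballMeasure, Measure.smul_apply, Measure.restrict_apply_univ, smul_eq_mul,
    ENNReal.inv_mul_cancel]
  · rw [Real.volume_closedBall]
    simpa using hδ
  · exact measure_closedBall_lt_top.ne

/-- The average of `u` over `[x - δ, x + δ]`. -/
def avg (δ : ℝ) (u : ℝ → ℂ) (x : ℝ) : ℂ := ∫ s, u (x + s) ∂ballMeasure δ

theorem avg_eq_average (δ : ℝ) (u : ℝ → ℂ) (x : ℝ) :
    avg δ u x = ⨍ y in Metric.closedBall x δ, u y := by
  have hv : volume (Metric.closedBall x δ) = volume (Metric.closedBall (0 : ℝ) δ) := by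
    rw [Real.volume_closedBall, Real.volume_closedBall]
  rw [avg, ballMeasure, integral_smul_measure, setAverage_eq, Measure.real, hv, ENNReal.toReal_inv]
  congr 1
  have h := (measurePreserving_add_left (volume : Measure ℝ) x).setIntegral_preimage_emb
    (measurableEmbedding_addLeft x) u (Metric.closedBall x δ)
  rw [← h]
  congr 2
  ext s
  simp

theorem stronglyMeasurable_avg {u : ℝ → ℂ} (hu : StronglyMeasurable u) {δ : ℝ} (hδ : 0 < δ) :
    StronglyMeasurable (avg δ u) := by
  have := isProbabilityMeasure_ballMeasure hδ
  have h : StronglyMeasurable (Function.uncurry fun x s : ℝ => u (x + s)) :=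
    hu.comp_measurable (measurable_fst.add measurable_snd)
  exact h.integral_prod_right

theorem enorm_integral_rpow_le {ν : Measure ℝ} [IsProbabilityMeasure ν] {f : ℝ → ℂ}
    (hf : AEStronglyMeasurable f ν) {p : ℝ≥0∞} (hp : 1 ≤ p) (hp' : p ≠ ∞) :
    ‖∫ s, f s ∂ν‖ₑ ^ p.toReal ≤ ∫⁻ s, ‖f s‖ₑ ^ p.toReal ∂ν := by
  have hp0 : p ≠ 0 := (lt_of_lt_of_le one_pos hp).ne'
  have hpos : 0 < p.toReal := ENNReal.toReal_pos hp0 hp'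
  have h1 : ‖∫ s, f s ∂ν‖ₑ ≤ eLpNorm f p ν := by
    refine (enorm_integral_le_lintegral_enorm f).trans ?_
    rw [← eLpNorm_one_eq_lintegral_enorm]
    exact eLpNorm_le_eLpNorm_of_exponent_le hp hf
  rw [eLpNorm_eq_lintegral_rpow_enorm_toReal hp0 hp'] at h1
  refine (ENNReal.rpow_le_rpow h1 hpos.le).trans (le_of_eq ?_)
  rw [← ENNReal.rpow_mul, one_div_mul_cancel hpos.ne', ENNReal.rpow_one]

/-- Jensen's inequality for the probability measure, followed by Tonelli and translation invariance.
-/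
theorem eLpNorm_avg_le {u : ℝ → ℂ} (hu : StronglyMeasurable u) {δ : ℝ} (hδ : 0 < δ) {p : ℝ≥0∞}
    (hp : 1 ≤ p) (hp' : p ≠ ∞) : eLpNorm (avg δ u) p volume ≤ eLpNorm u p volume := by
  have := isProbabilityMeasure_ballMeasure hδ
  have hp0 : p ≠ 0 := (lt_of_lt_of_le one_pos hp).ne'
  rw [eLpNorm_eq_lintegral_rpow_enorm_toReal hp0 hp', eLpNorm_eq_lintegral_rpow_enorm_toReal hp0 hp']
  refine ENNReal.rpow_le_rpow ?_ (by positivity)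
  calc ∫⁻ x, ‖avg δ u x‖ₑ ^ p.toReal
      ≤ ∫⁻ x, ∫⁻ s, ‖u (x + s)‖ₑ ^ p.toReal ∂ballMeasure δ :=
        lintegral_mono fun x => enorm_integral_rpow_le
          (hu.comp_measurable (measurable_const_add x)).aestronglyMeasurable hp hp'
    _ = ∫⁻ s, ∫⁻ x, ‖u (x + s)‖ₑ ^ p.toReal ∂volume ∂ballMeasure δ := by
        refine lintegral_lintegral_swap (Measurable.aemeasurable ?_)
        exact ((hu.measurable.comp (measurable_fst.add measurable_snd)).enorm).pow_const _
    _ = ∫⁻ x, ‖u x‖ₑ ^ p.toReal := by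
        simp_rw [lintegral_add_right_eq_self (fun x => ‖u x‖ₑ ^ p.toReal)]
        simp

theorem memLp_avg {u : ℝ → ℂ} (hu : StronglyMeasurable u) {δ : ℝ} (hδ : 0 < δ) {p : ℝ≥0∞}
    (hp : 1 ≤ p) (hp' : p ≠ ∞) (h : MemLp u p volume) : MemLp (avg δ u) p volume :=
  ⟨(stronglyMeasurable_avg hu hδ).aestronglyMeasurable, (eLpNorm_avg_le hu hδ hp hp').trans_lt h.2⟩

/-- Averaging turns an L² function into a bounded one, so that the squares formed later have all the
integrability they need. -/
theorem memLp_avg_top {u : ℝ → ℂ} (hu : StronglyMeasurable u) {δ : ℝ} (hδ : 0 < δ)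
    (h : MemLp u 2 volume) : MemLp (avg δ u) ∞ volume := by
  have := isProbabilityMeasure_ballMeasure hδ
  set M : ℝ≥0∞ := (volume (Metric.closedBall (0 : ℝ) δ))⁻¹ * ∫⁻ x, ‖u x‖ₑ ^ (2 : ℝ)
  have hM : M ≠ ∞ := by
    refine ENNReal.mul_ne_top ?_ ?_
    · rw [ENNReal.inv_ne_top, Real.volume_closedBall]
      simpa using hδ
    · have := (eLpNorm_lt_top_iff_lintegral_rpow_enorm_lt_top two_ne_zero (by norm_num)).1 h.2
      simpa using this.ne
  refine memLp_top_of_bound (stronglyMeasurable_avg hu hδ).aestronglyMeasurable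
    (M ^ (1 / 2 : ℝ)).toReal (Eventually.of_forall fun x => ?_)
  have h1 := enorm_integral_rpow_le (ν := ballMeasure δ) (p := 2) (f := fun s => u (x + s))
    (hu.comp_measurable (measurable_const_add x)).aestronglyMeasurable (by norm_num) (by norm_num)
  have h2 : ∫⁻ s, ‖u (x + s)‖ₑ ^ (2 : ℝ) ∂ballMeasure δ ≤ M := by
    rw [ballMeasure, lintegral_smul_measure, smul_eq_mul]
    refine mul_le_mul_right ((setLIntegral_le_lintegral _ _).trans (le_of_eq ?_)) _
    exact lintegral_add_left_eq_self (fun y => ‖u y‖ₑ ^ (2 : ℝ)) x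
  have h3 : ‖avg δ u x‖ₑ ^ (2 : ℝ) ≤ M := by
    rw [show (2 : ℝ≥0∞).toReal = 2 by norm_num] at h1
    exact h1.trans h2
  have h4 : ‖avg δ u x‖ₑ ≤ M ^ (1 / 2 : ℝ) := by
    have := ENNReal.rpow_le_rpow h3 (z := 1 / 2) (by norm_num)
    rwa [← ENNReal.rpow_mul, show (2 : ℝ) * (1 / 2) = 1 by norm_num, ENNReal.rpow_one] at this
  rw [← toReal_enorm]
  exact ENNReal.toReal_mono (ENNReal.rpow_ne_top_of_nonneg (by norm_num) hM) h4

theorem ae_mem_ballMeasure (δ : ℝ) : ∀ᵐ s ∂ballMeasure δ, |s| ≤ δ := by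
  refine Measure.ae_smul_measure ?_ _
  filter_upwards [ae_restrict_mem measurableSet_closedBall] with s hs
  simpa [Real.dist_eq] using hs

/-- Averaging commutes with the Cauchy transform by Fubini. Horizontal shifts preserve each
half-plane, so averages of upper functions are upper, and likewise for lower ones. -/
theorem cauchy_avg {u : ℝ → ℂ} (hu : StronglyMeasurable u) (ha : Admissible u) {δ : ℝ}
    (hδ : 0 < δ) {z : ℂ} (hz : z.im ≠ 0) :
    cauchy (avg δ u) z = ∫ s, cauchy u (z + s) ∂ballMeasure δ := by
  have := isProbabilityMeasure_ballMeasure hδ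
  have htr : ∀ s : ℝ, ∫ x : ℝ, u (x + s) / ((x : ℂ) - z) = cauchy u (z + s) := fun s => by
    rw [cauchy, ← integral_add_right_eq_self (fun y : ℝ => u y / ((y : ℂ) - (z + s))) s]
    refine integral_congr_ae (Eventually.of_forall fun x => ?_)
    simp only
    congr 1
    push_cast
    ring
  simp_rw [← htr]
  rw [← integral_integral_swap]
  · rw [cauchy]
    refine integral_congr_ae (Eventually.of_forall fun x => ?_)
    simp only [avg]
    rw [← integral_div]
  · have hm : Measurable (Function.uncurry fun (x s : ℝ) => u (x + s) / ((x : ℂ) - z)) :=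
      (hu.measurable.comp (measurable_fst.add measurable_snd)).div
        ((Complex.measurable_ofReal.comp measurable_fst).sub_const z)
    refine ⟨hm.aestronglyMeasurable, ?_⟩
    rw [HasFiniteIntegral, lintegral_prod_symm _ hm.enorm.aemeasurable]
    -- For |s| ≤ δ, |y - z| ≤ |y - z - s| + δ and |y - z - s| ≥ |Im z|. The shifted kernel is
    -- therefore at most C times the kernel at z, uniformly in s.
    set C : ℝ := 1 + δ / |z.im|
    have hC : 0 ≤ C := by positivity
    have hk : ∀ s y : ℝ, |s| ≤ δ → ‖((y : ℂ) - (z + s))⁻¹‖ ≤ C * ‖((y : ℂ) - z)⁻¹‖ := by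
      intro s y hs
      have him : (z + s).im ≠ 0 := by simpa using hz
      have h1 : 0 < ‖(y : ℂ) - (z + s)‖ := norm_pos_iff.2 (sub_ne_zero_of_im him y)
      have h2 : 0 < ‖(y : ℂ) - z‖ := norm_pos_iff.2 (sub_ne_zero_of_im hz y)
      have h3 : |z.im| ≤ ‖(y : ℂ) - (z + s)‖ := by
        simpa using Complex.abs_im_le_norm ((y : ℂ) - (z + s))
      have h4 : ‖(y : ℂ) - z‖ ≤ ‖(y : ℂ) - (z + s)‖ + |s| := by
        have h := norm_add_le ((y : ℂ) - (z + s)) s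
        rwa [sub_add_eq_sub_sub, sub_add_cancel, Complex.norm_real, Real.norm_eq_abs,
          ← sub_add_eq_sub_sub] at h
      have h5 : |s| ≤ δ / |z.im| * ‖(y : ℂ) - (z + s)‖ := by
        refine hs.trans ?_
        rw [div_mul_eq_mul_div, le_div_iff₀ (abs_pos.2 hz)]
        exact mul_le_mul_of_nonneg_left h3 hδ.le
      rw [norm_inv, norm_inv, ← div_eq_mul_inv, le_div_iff₀ h2, inv_mul_le_iff₀ h1]
      calc ‖(y : ℂ) - z‖ ≤ ‖(y : ℂ) - (z + s)‖ + |s| := h4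
        _ ≤ ‖(y : ℂ) - (z + s)‖ * C := by
          simp only [C]
          linarith
    set N : ℝ≥0∞ := ∫⁻ y : ℝ, ‖u y / ((y : ℂ) - z)‖ₑ
    have hN : N < ∞ := (ha z hz).2
    have hb : ∀ s : ℝ, |s| ≤ δ → ∫⁻ x : ℝ, ‖u (x + s) / ((x : ℂ) - z)‖ₑ ≤
        ENNReal.ofReal C * N := by
      intro s hs
      have e1 : ∫⁻ x : ℝ, ‖u (x + s) / ((x : ℂ) - z)‖ₑ =
          ∫⁻ y : ℝ, ‖u y / ((y : ℂ) - (z + s))‖ₑ := by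
        rw [← lintegral_add_right_eq_self (fun y : ℝ => ‖u y / ((y : ℂ) - (z + s))‖ₑ) s]
        refine lintegral_congr fun x => ?_
        congr 2
        push_cast
        ring
      rw [e1, ← lintegral_const_mul' _ _ ENNReal.ofReal_ne_top]
      refine lintegral_mono fun y => ?_
      rw [← ofReal_norm, ← ofReal_norm, ← ENNReal.ofReal_mul hC]
      refine ENNReal.ofReal_le_ofReal ?_
      rw [div_eq_mul_inv, div_eq_mul_inv, norm_mul, norm_mul, mul_left_comm]
      exact mul_le_mul_of_nonneg_left (hk s y hs) (norm_nonneg _)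
    calc _ ≤ ∫⁻ _, ENNReal.ofReal C * N ∂ballMeasure δ := by
          refine lintegral_mono_ae ?_
          filter_upwards [ae_mem_ballMeasure δ] with s hs
          exact hb s hs
      _ < ∞ := by
          rw [lintegral_const, measure_univ, mul_one]
          exact ENNReal.mul_lt_top ENNReal.ofReal_lt_top hN

theorem IsUpper.avg {A : ℝ → ℂ} (hA : IsUpper A) (hm : StronglyMeasurable A)
    (ha : Admissible A) {δ : ℝ} (hδ : 0 < δ) : IsUpper (avg δ A) := fun z hz => by
  rw [cauchy_avg hm ha hδ hz.ne]
  simp [hA _ (show (z + (_ : ℝ)).im < 0 by simpa using hz)]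

theorem IsLower.avg {A : ℝ → ℂ} (hA : IsLower A) (hm : StronglyMeasurable A)
    (ha : Admissible A) {δ : ℝ} (hδ : 0 < δ) : IsLower (avg δ A) := fun z hz => by
  rw [cauchy_avg hm ha hδ hz.ne']
  simp [hA _ (show 0 < (z + (_ : ℝ)).im by simpa using hz)]

theorem integrable_ballMeasure {A : ℝ → ℂ} (ha : LocallyIntegrable A) {δ : ℝ} (hδ : 0 < δ)
    (x : ℝ) : Integrable (fun s => A (x + s)) (ballMeasure δ) := by
  refine Integrable.smul_measure ?_ ?_
  · have h := (measurePreserving_add_left (volume : Measure ℝ) x).integrableOn_comp_preimage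
      (measurableEmbedding_addLeft x) (f := A) (s := Metric.closedBall x δ)
    have h2 := h.2 (ha.integrableOn_isCompact (isCompact_closedBall x δ))
    have e : (fun s => x + s) ⁻¹' Metric.closedBall x δ = Metric.closedBall 0 δ := by
      ext s
      simp
    rwa [e] at h2
  · rw [ENNReal.inv_ne_top, Real.volume_closedBall]
    simpa using hδ

theorem avg_add {A B : ℝ → ℂ} (ha : LocallyIntegrable A) (hb : LocallyIntegrable B) {δ : ℝ}
    (hδ : 0 < δ) (x : ℝ) : avg δ (fun y => A y + B y) x = avg δ A x + avg δ B x :=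
  integral_add (integrable_ballMeasure ha hδ x) (integrable_ballMeasure hb hδ x)

theorem ae_tendsto_avg {A : ℝ → ℂ} (ha : LocallyIntegrable A) :
    ∀ᵐ x : ℝ, Tendsto (fun n : ℕ => avg (1 / ((n : ℝ) + 1)) A x) atTop (𝓝 (A x)) := by
  filter_upwards [IsUnifLocDoublingMeasure.ae_tendsto_average volume ha 1] with x hx
  simp_rw [avg_eq_average]
  refine hx (fun _ => x) (fun n : ℕ => 1 / ((n : ℝ) + 1)) ?_ ?_
  · refine tendsto_nhdsWithin_iff.2 ⟨tendsto_one_div_add_atTop_nhds_zero_nat, ?_⟩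
    exact Eventually.of_forall fun n => by simp only [mem_Ioi]; positivity
  · refine Eventually.of_forall fun n => ?_
    rw [one_mul]
    exact Metric.mem_closedBall_self (by positivity)

/-! ### Boundedness of the projection on `L^q` -/

/-- The projection of `L²` onto the upper functions is bounded in the `L^q` norm. -/
def ProjectionBounded (q : ℝ≥0∞) : Prop :=
  ∃ C : ℝ≥0∞, C ≠ ∞ ∧ ∀ u A B : ℝ → ℂ, MemLp u q volume → MemLp A 2 volume → MemLp B 2 volume →
    Split u A B → eLpNorm A q volume ≤ C * eLpNorm u q volume

theorem projectionBounded_two : ProjectionBounded 2 := by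
  refine ⟨1, ENNReal.one_ne_top, fun u A B hu hA hB h => ?_⟩
  obtain ⟨A', B', _, _, h', hle⟩ := exists_split hu
  rwa [one_mul, eLpNorm_congr_ae (h.unique h').1]

/-- Either a ≤ w, or w ≤ a and the right side is at most 3Cwa. Finiteness of a is what permits
cancelling it. -/
theorem ENNReal.le_of_mul_self_le {a w C : ℝ≥0∞} (ha : a ≠ ∞)
    (h : a * a ≤ C * (w * (2 * a + w))) : a ≤ max 1 (3 * C) * w := by
  rcases le_total a w with haw | haw
  · calc a ≤ 1 * w := by rwa [one_mul]
      _ ≤ _ := by gcongr; exact le_max_left _ _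
  · rcases eq_or_ne a 0 with h0 | h0
    · rw [h0]; exact zero_le
    · have h1 : a * a ≤ (3 * C * w) * a := by
        calc a * a ≤ C * (w * (2 * a + w)) := h
          _ ≤ C * (w * (2 * a + a)) := by gcongr
          _ = (3 * C * w) * a := by ring
      calc a ≤ 3 * C * w := (ENNReal.mul_le_mul_iff_left h0 ha).1 h1
        _ ≤ _ := by gcongr; exact le_max_right _ _

theorem holderTriple_two_mul (q : ℝ≥0∞) : ENNReal.HolderTriple (2 * q) (2 * q) q := by
  refine ⟨?_⟩
  rw [ENNReal.mul_inv (Or.inl (by norm_num)) (Or.inl (by norm_num)), ← add_mul,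
    ENNReal.inv_two_add_inv_two, one_mul]

theorem eLpNorm_mul_self (a : ℝ → ℂ) (q : ℝ≥0∞) :
    eLpNorm (fun x => a x * a x) q volume =
      eLpNorm a (2 * q) volume * eLpNorm a (2 * q) volume := by
  have h := eLpNorm_norm_rpow (μ := volume) (p := q) a (q := 2) (by norm_num)
  rw [ENNReal.ofReal_ofNat, mul_comm q, ENNReal.rpow_two, sq] at h
  rw [← h]
  refine eLpNorm_congr_norm_ae (Eventually.of_forall fun x => ?_)
  simp [sq]

/-- Let a, b be the averaged parts and w = a + b. The function a² - b² has upper part a² and equals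
w(2a - w). The bound on L^q and Hölder's inequality give ‖a‖² ≤ C‖w‖(2‖a‖ + ‖w‖) in the norm of
L^{2q}, a quadratic inequality for ‖a‖. -/
theorem eLpNorm_avg_upper_le {q : ℝ≥0∞} (hq : 2 ≤ q) (hq' : q ≠ ∞) {C : ℝ≥0∞}
    (hC : ∀ u A B : ℝ → ℂ, MemLp u q volume → MemLp A 2 volume → MemLp B 2 volume →
      Split u A B → eLpNorm A q volume ≤ C * eLpNorm u q volume)
    {A B : ℝ → ℂ} (hAm : StronglyMeasurable A) (hBm : StronglyMeasurable B)
    (hA : MemLp A 2 volume) (hB : MemLp B 2 volume) (hAu : IsUpper A) (hBl : IsLower B)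
    {δ : ℝ} (hδ : 0 < δ) :
    eLpNorm (avg δ A) (2 * q) volume ≤
      max 1 (3 * C) * eLpNorm (fun x => A x + B x) (2 * q) volume := by
  have haA := admissible_of_memLp_two hA
  have haB := admissible_of_memLp_two hB
  have h2q : (2 : ℝ≥0∞) ≤ 2 * q := hq.trans (le_mul_of_one_le_left zero_le (by norm_num))
  have h2qt : 2 * q ≠ ∞ := ENNReal.mul_ne_top (by norm_num) hq'
  have key : ∀ {F : ℝ → ℂ}, StronglyMeasurable F → MemLp F 2 volume →
      ∀ {s : ℝ≥0∞}, 2 ≤ s → MemLp (avg δ F) s volume := fun hm hF s hs =>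
    memLp_of_memLp_top two_ne_zero hs (memLp_avg hm hδ (by norm_num) (by norm_num) hF)
      (memLp_avg_top hm hδ hF)
  have hsq : ∀ {F : ℝ → ℂ}, StronglyMeasurable F → MemLp F 2 volume →
      ∀ {s : ℝ≥0∞}, 2 ≤ s → MemLp (fun x => avg δ F x * avg δ F x) s volume := fun hm hF s hs => by
    have : ENNReal.HolderTriple s ∞ s := inferInstance
    exact (key hm hF le_top).mul (r := s) (key hm hF hs)
  set w : ℝ → ℂ := avg δ (fun x => A x + B x) with hw
  have hwab : ∀ x, w x = avg δ A x + avg δ B x :=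
    avg_add haA.locallyIntegrable haB.locallyIntegrable hδ
  have hsplit : Split (fun x => avg δ A x * avg δ A x - avg δ B x * avg δ B x)
      (fun x => avg δ A x * avg δ A x) (fun x => -(avg δ B x * avg δ B x)) := by
    have m1 := key hAm hA le_rfl
    have m2 := key hBm hB le_rfl
    refine ⟨Eventually.of_forall fun x => sub_eq_add_neg _ _, ?_, ?_, ?_, ?_⟩
    · exact (hAu.avg hAm haA hδ).mul (hAu.avg hAm haA hδ) m1 m1
    · exact ((hBl.avg hBm haB hδ).mul (hBl.avg hBm haB hδ) m2 m2).neg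
    · exact admissible_of_memLp_two (hsq hAm hA le_rfl)
    · exact admissible_of_memLp_two (hsq hBm hB le_rfl).neg
  have h1 := hC _ _ _ ((hsq hAm hA hq).sub (hsq hBm hB hq)) (hsq hAm hA le_rfl)
    (hsq hBm hB le_rfl).neg hsplit
  have hwm : StronglyMeasurable w := stronglyMeasurable_avg (hAm.add hBm) hδ
  have ham := stronglyMeasurable_avg hAm hδ
  have h2 : eLpNorm (fun x => avg δ A x * avg δ A x - avg δ B x * avg δ B x) q volume ≤
      eLpNorm w (2 * q) volume * (2 * eLpNorm (avg δ A) (2 * q) volume +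
        eLpNorm w (2 * q) volume) := by
    have hH := holderTriple_two_mul q
    have e : (fun x => avg δ A x * avg δ A x - avg δ B x * avg δ B x) =
        w • (fun x => ((avg δ A x + avg δ A x) - w x)) := by
      ext x
      simp only [Pi.smul_apply', smul_eq_mul, hwab]
      ring
    rw [e]
    refine (eLpNorm_smul_le_mul_eLpNorm (p := 2 * q) (q := 2 * q)
      ((ham.add ham).sub hwm).aestronglyMeasurable hwm.aestronglyMeasurable).trans ?_
    gcongr
    refine (eLpNorm_sub_le (ham.add ham).aestronglyMeasurable hwm.aestronglyMeasurable
      (le_trans (by norm_num) h2q)).trans ?_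
    gcongr
    refine (eLpNorm_add_le ham.aestronglyMeasurable ham.aestronglyMeasurable
      (le_trans (by norm_num) h2q)).trans_eq ?_
    exact (_root_.two_mul _).symm
  rw [eLpNorm_mul_self] at h1
  have h3 := ENNReal.le_of_mul_self_le (key hAm hA h2q).2.ne
    (h1.trans (mul_le_mul_right h2 C))
  refine h3.trans (mul_le_mul_right ?_ _)
  exact eLpNorm_avg_le (hAm.add hBm) hδ (le_trans (by norm_num) h2q) h2qt

/-- The bound for the averages has a constant independent of δ; as δ tends to 0 they converge almost
everywhere, and Fatou's lemma carries the bound to A itself. -/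
theorem ProjectionBounded.two_mul {q : ℝ≥0∞} (hq : 2 ≤ q) (hq' : q ≠ ∞)
    (h : ProjectionBounded q) : ProjectionBounded (2 * q) := by
  obtain ⟨C, hC0, hC⟩ := h
  refine ⟨max 1 (3 * C), max_ne_top ENNReal.one_ne_top
    (ENNReal.mul_ne_top (by norm_num) hC0), fun u A B _ hA hB hs => ?_⟩
  set A' := hA.1.mk A
  set B' := hB.1.mk B
  have eA : A =ᵐ[volume] A' := hA.1.ae_eq_mk
  have eB : B =ᵐ[volume] B' := hB.1.ae_eq_mk
  have hA' : MemLp A' 2 volume := hA.ae_eq eA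
  have hB' : MemLp B' 2 volume := hB.ae_eq eB
  have hAm : StronglyMeasurable A' := hA.1.stronglyMeasurable_mk
  have hBm : StronglyMeasurable B' := hB.1.stronglyMeasurable_mk
  have eu : u =ᵐ[volume] fun x => A' x + B' x := by
    filter_upwards [hs.eq, eA, eB] with x h1 h2 h3
    rw [h1, h2, h3]
  rw [eLpNorm_congr_ae eA, eLpNorm_congr_ae eu]
  have hpos : ∀ n : ℕ, 0 < 1 / ((n : ℝ) + 1) := fun n => by positivity
  refine (Lp.eLpNorm_lim_le_liminf_eLpNorm
    (fun n => (stronglyMeasurable_avg hAm (hpos n)).aestronglyMeasurable) A'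
    (ae_tendsto_avg (admissible_of_memLp_two hA').locallyIntegrable)).trans ?_
  refine liminf_le_of_le (by isBoundedDefault) fun b hb => ?_
  obtain ⟨n, hn⟩ := hb.exists
  exact hn.trans (eLpNorm_avg_upper_le hq hq' hC hAm hBm hA' hB' (hs.upper.congr eA)
    (hs.lower.congr eB) (hpos n))

theorem projectionBounded_two_pow (n : ℕ) : ProjectionBounded (2 ^ (n + 1)) := by
  induction n with
  | zero => simpa using projectionBounded_two
  | succ n ih =>
    rw [pow_succ']
    refine ih.two_mul ?_ (ENNReal.pow_ne_top (by norm_num))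
    exact le_self_pow₀ (by norm_num) (by omega)

/-! ### The dual exponents -/

theorem Split.conj {u A B : ℝ → ℂ} (h : Split u A B) :
    Split (fun x => conj (u x)) (fun x => conj (B x)) (fun x => conj (A x)) := by
  have hadm : ∀ {F : ℝ → ℂ}, Admissible F → Admissible fun x => conj (F x) := fun {F} hF z hz => by
    have h1 := hF (conj z) (by simpa using hz)
    have h2 := (Complex.conjLIE.toContinuousLinearEquiv : ℂ →L[ℝ] ℂ).integrable_comp h1
    refine h2.congr (Eventually.of_forall fun x => ?_)
    simp
  refine ⟨?_, h.lower.conj, h.upper.conj, hadm h.adm_lower, hadm h.adm_upper⟩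
  filter_upwards [h.eq] with x hx
  rw [hx, map_add, add_comm]

theorem eLpNorm_conj (f : ℝ → ℂ) (p : ℝ≥0∞) :
    eLpNorm (fun x => conj (f x)) p volume = eLpNorm f p volume :=
  eLpNorm_congr_norm_ae (Eventually.of_forall fun x => by simp)

theorem ProjectionBounded.exists_bound {q : ℝ≥0∞} (h : ProjectionBounded q) :
    ∃ C : ℝ≥0∞, C ≠ ∞ ∧ ∀ u A B : ℝ → ℂ, MemLp u q volume → MemLp A 2 volume → MemLp B 2 volume →
      Split u A B → eLpNorm A q volume ≤ C * eLpNorm u q volume ∧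
        eLpNorm B q volume ≤ C * eLpNorm u q volume := by
  obtain ⟨C, hC, hb⟩ := h
  refine ⟨C, hC, fun u A B hu hA hB hs => ⟨hb u A B hu hA hB hs, ?_⟩⟩
  have := hb _ _ _ (MemLp.conj hu) (MemLp.conj hB) (MemLp.conj hA) hs.conj
  rwa [eLpNorm_conj, eLpNorm_conj] at this

theorem ProjectionBounded.memLp {q : ℝ≥0∞} (h : ProjectionBounded q) {u A B : ℝ → ℂ}
    (hu : MemLp u q volume) (hA : MemLp A 2 volume) (hB : MemLp B 2 volume) (hs : Split u A B) :
    MemLp A q volume ∧ MemLp B q volume := by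
  obtain ⟨C, hC, hb⟩ := h.exists_bound
  have h1 := hb u A B hu hA hB hs
  exact ⟨⟨hA.1, h1.1.trans_lt (ENNReal.mul_lt_top hC.lt_top hu.2)⟩,
    ⟨hB.1, h1.2.trans_lt (ENNReal.mul_lt_top hC.lt_top hu.2)⟩⟩

theorem enorm_integral_mul_le {f g : ℝ → ℂ} (p q : ℝ≥0∞) [ENNReal.HolderConjugate p q]
    (hf : AEStronglyMeasurable f volume) (hg : AEStronglyMeasurable g volume) :
    ‖∫ x, f x * g x‖ₑ ≤ eLpNorm f p volume * eLpNorm g q volume := by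
  have : ENNReal.HolderTriple p q 1 := inferInstance
  refine (enorm_integral_le_lintegral_enorm _).trans ?_
  rw [← eLpNorm_one_eq_lintegral_enorm]
  have h := eLpNorm_smul_le_mul_eLpNorm (𝕜 := ℂ) (E := ℂ) (p := p) (q := q) (r := 1) hg hf
  exact h

/-- Divide by I^{1/Q}; this is legitimate only for finite I, which is why norming functions are
truncated. -/
theorem rpow_le_of_le_mul_rpow {I K : ℝ≥0∞} {P Q : ℝ} (hPQ : P.HolderConjugate Q) (hI : I ≠ ∞)
    (h : I ≤ K * I ^ (1 / Q)) : I ^ (1 / P) ≤ K := by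
  rcases eq_or_ne I 0 with h0 | h0
  · rw [h0, ENNReal.zero_rpow_of_pos (by have := hPQ.pos; positivity)]
    exact zero_le
  · have hne : I ^ (1 / Q) ≠ 0 := by
      exact (ENNReal.rpow_pos (pos_iff_ne_zero.2 h0) hI).ne'
    have hnt : I ^ (1 / Q) ≠ ∞ :=
      ENNReal.rpow_ne_top_of_nonneg (by have := hPQ.symm.pos; positivity) hI
    have hs : 1 / P + 1 / Q = 1 := by simpa using hPQ.inv_add_inv_eq_one
    rw [← ENNReal.mul_le_mul_iff_left hne hnt, ← ENNReal.rpow_add _ _ h0 hI, hs, ENNReal.rpow_one]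
    exact h

/-- Bounded truncations of the function that norms `h` in `L^p`. -/
theorem exists_norming {h : ℝ → ℂ} (hm : StronglyMeasurable h) (h2 : MemLp h 2 volume)
    {p q : ℝ≥0∞} (hPQ : p.toReal.HolderConjugate q.toReal) (hq2 : 2 ≤ q) (hq' : q ≠ ∞)
    {S : Set ℝ} (hS : MeasurableSet S) {a b : ℝ} (ha : 0 < a)
    (hSa : ∀ x ∈ S, a ≤ ‖h x‖) (hSb : ∀ x ∈ S, ‖h x‖ ≤ b) :
    ∃ w : ℝ → ℂ, MemLp w 2 volume ∧ MemLp w q volume ∧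
      ∫⁻ x in S, ‖h x‖ₑ ^ p.toReal ≠ ∞ ∧
      ‖∫ x, h x * w x‖ₑ = ∫⁻ x in S, ‖h x‖ₑ ^ p.toReal ∧
      eLpNorm w q volume = (∫⁻ x in S, ‖h x‖ₑ ^ p.toReal) ^ (1 / q.toReal) := by
  set P := p.toReal
  set Q := q.toReal
  have hP : 1 < P := hPQ.lt
  have hQ : 0 < Q := hPQ.symm.pos
  -- On S this choice gives hw = |h|^P and |w|^Q = |h|^P, the equality case of Hölder's inequality.
  -- The lower bound a makes S of finite measure and the upper bound b makes w bounded.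
  set w : ℝ → ℂ := S.indicator fun x => conj (h x) * ((‖h x‖ ^ (P - 2) : ℝ) : ℂ)
  have hSfin : volume S < ∞ := by
    have h3 := h2.meas_ge_lt_top two_ne_zero (by norm_num) (ε := ⟨a, ha.le⟩)
      (fun h => ha.ne' (congrArg NNReal.toReal h))
    exact lt_of_le_of_lt (measure_mono fun x hx => hSa x hx) h3
  have hpos : ∀ x ∈ S, 0 < ‖h x‖ := fun x hx => ha.trans_le (hSa x hx)
  have hwm : Measurable w := by
    refine Measurable.indicator ?_ hS
    exact (Complex.continuous_conj.measurable.comp hm.measurable).mul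
      (Complex.measurable_ofReal.comp (hm.measurable.norm.pow_const _))
  have hwn : ∀ x ∈ S, ‖w x‖ = ‖h x‖ ^ (P - 1) := fun x hx => by
    simp only [w, indicator_of_mem hx]
    rw [norm_mul, RCLike.norm_conj, Complex.norm_real, Real.norm_of_nonneg (by positivity),
      ← Real.rpow_one_add' (norm_nonneg _) (by linarith)]
    congr 1
    ring
  have hw0 : ∀ x ∉ S, w x = 0 := fun x hx => indicator_of_notMem hx _
  have hb : ∀ x, ‖w x‖ ≤ b ^ (P - 1) ∨ x ∉ S := fun x => by
    by_cases hx : x ∈ S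
    · left
      rw [hwn x hx]
      exact Real.rpow_le_rpow (norm_nonneg _) (hSb x hx) (by linarith)
    · exact Or.inr hx
  have hwtop : MemLp w ∞ volume := by
    refine memLp_top_of_bound hwm.aestronglyMeasurable (max 0 (b ^ (P - 1)))
      (Eventually.of_forall fun x => ?_)
    rcases hb x with h | h
    · exact h.trans (le_max_right _ _)
    · rw [hw0 x h, norm_zero]
      exact le_max_left _ _
  have hw1 : ∀ s : ℝ≥0∞, MemLp w s volume := by
    intro s
    have : IsFiniteMeasure (volume.restrict S) := ⟨by simpa using hSfin⟩
    have h3 : MemLp w s (volume.restrict S) := (hwtop.restrict S).mono_exponent le_top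
    have h4 := (memLp_indicator_iff_restrict (f := w) (p := s) (μ := volume) hS).2 h3
    have e : S.indicator w = w := by
      simp only [w, indicator_indicator, inter_self]
    rwa [e] at h4
  have hhw : ∀ x, h x * w x = ((S.indicator (fun x => ‖h x‖ ^ P) x : ℝ) : ℂ) := fun x => by
    by_cases hx : x ∈ S
    · simp only [w, indicator_of_mem hx]
      rw [← mul_assoc, Complex.mul_conj, Complex.normSq_eq_norm_sq, ← Complex.ofReal_mul,
        ← Real.rpow_natCast, ← Real.rpow_add (hpos x hx)]
      norm_num
    · rw [hw0 x hx, indicator_of_notMem hx]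
      simp
  have hint : Integrable fun x => h x * w x := integrable_mul_of_memLp_two h2 (hw1 2)
  have hen : ∀ x, ‖h x * w x‖ₑ = S.indicator (fun x => ‖h x‖ₑ ^ P) x := fun x => by
    rw [hhw x, ← ofReal_norm, Complex.norm_real]
    by_cases hx : x ∈ S
    · rw [indicator_of_mem hx, indicator_of_mem hx, Real.norm_of_nonneg (by positivity),
        ← ENNReal.ofReal_rpow_of_pos (hpos x hx), ofReal_norm]
    · simp [indicator_of_notMem hx]
  have hI : ∫⁻ x, ‖h x * w x‖ₑ = ∫⁻ x in S, ‖h x‖ₑ ^ P := by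
    simp_rw [hen]
    exact lintegral_indicator hS _
  refine ⟨w, hw1 2, hw1 q, ?_, ?_, ?_⟩
  · rw [← hI]
    exact hint.2.ne
  · rw [← hI]
    have hint' : Integrable fun x => S.indicator (fun x => ‖h x‖ ^ P) x := by
      refine hint.norm.congr (Eventually.of_forall fun x => ?_)
      simp only
      rw [hhw, Complex.norm_real, Real.norm_of_nonneg (indicator_nonneg (fun _ _ => by positivity) _)]
    have hnn : 0 ≤ fun x => S.indicator (fun x => ‖h x‖ ^ P) x :=
      fun x => indicator_nonneg (fun _ _ => by positivity) _
    simp_rw [hhw]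
    rw [integral_complex_ofReal, ← ofReal_norm, Complex.norm_real,
      Real.norm_of_nonneg (integral_nonneg hnn), ofReal_integral_eq_lintegral_ofReal hint'
        (Eventually.of_forall hnn)]
    refine lintegral_congr fun x => ?_
    rw [← ofReal_norm, Complex.norm_real, Real.norm_of_nonneg (hnn x)]
  · rw [eLpNorm_eq_lintegral_rpow_enorm_toReal (by rintro rfl; simp at hq2) hq']
    congr 1
    rw [← lintegral_indicator hS]
    refine lintegral_congr fun x => ?_
    by_cases hx : x ∈ S
    · rw [indicator_of_mem hx, ← ofReal_norm, hwn x hx,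
        ENNReal.ofReal_rpow_of_pos (Real.rpow_pos_of_pos (hpos x hx) _), ← Real.rpow_mul
        (norm_nonneg _), hPQ.sub_one_mul_conj, ← ofReal_norm, ENNReal.ofReal_rpow_of_pos (hpos x hx)]
    · rw [indicator_of_notMem hx, hw0 x hx, enorm_zero, ENNReal.zero_rpow_of_pos hQ]

/-- Pair C with a function w that norms it. By `Split.integral_mul` the pairing equals ∫ vF with F
the lower part of w, and the L^q norm of F is controlled by that of w. -/
theorem ProjectionBounded.dual {p q : ℝ≥0∞} [ENNReal.HolderConjugate p q] (hq : 2 ≤ q)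
    (hq' : q ≠ ∞) (hPQ : p.toReal.HolderConjugate q.toReal) (hb : ProjectionBounded q) :
    ∃ K : ℝ≥0∞, K ≠ ∞ ∧ ∀ v C D : ℝ → ℂ, MemLp v p volume → MemLp v 2 volume →
      MemLp C 2 volume → MemLp D 2 volume →
      Split v C D → eLpNorm C p volume ≤ K * eLpNorm v p volume := by
  obtain ⟨K, hK, hbd⟩ := hb.exists_bound
  refine ⟨K, hK, fun v C D hv hv2 hC hD hs => ?_⟩
  set h := hC.1.mk C
  have hm : StronglyMeasurable h := hC.1.stronglyMeasurable_mk
  have eC : C =ᵐ[volume] h := hC.1.ae_eq_mk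
  have h2 : MemLp h 2 volume := hC.ae_eq eC
  have hp0 : p ≠ 0 := fun h0 => by
    have := hPQ.lt
    rw [h0] at this
    simp at this
    linarith
  have hpt : p ≠ ∞ := fun h0 => by
    have := hPQ.lt
    rw [h0] at this
    simp at this
    linarith
  rw [eLpNorm_congr_ae eC]
  -- These sets increase to {h ≠ 0}, so a bound uniform in n passes to h by Fatou's lemma.
  set S : ℕ → Set ℝ := fun n => {x | 1 / ((n : ℝ) + 1) ≤ ‖h x‖ ∧ ‖h x‖ ≤ n}
  have hSm : ∀ n, MeasurableSet (S n) := fun n =>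
    (measurableSet_le measurable_const hm.measurable.norm).inter
      (measurableSet_le hm.measurable.norm measurable_const)
  have hbound : ∀ n, eLpNorm ((S n).indicator h) p volume ≤ K * eLpNorm v p volume := by
    intro n
    obtain ⟨w, hw2, hwq, hfin, h3, h4⟩ := exists_norming hm h2 hPQ hq hq' (hSm n)
      (show 0 < 1 / ((n : ℝ) + 1) by positivity) (fun x hx => hx.1) (fun x hx => hx.2)
    obtain ⟨E, F, hE, hF, hs', _⟩ := exists_split hw2
    have h5 : ∫ x, h x * w x = ∫ x, v x * F x := by
      rw [← hs.integral_mul hs' hC hD hE hF]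
      refine integral_congr_ae ?_
      filter_upwards [eC] with x hx
      rw [hx]
    have h6 : ‖∫ x, h x * w x‖ₑ ≤ K * eLpNorm v p volume * eLpNorm w q volume := by
      rw [h5]
      refine (enorm_integral_mul_le p q hv.1 hF.1).trans ?_
      rw [mul_comm K, mul_assoc]
      exact mul_le_mul_right (hbd w E F hwq hE hF hs').2 _
    rw [h3, h4] at h6
    have h7 := rpow_le_of_le_mul_rpow hPQ hfin h6
    rw [eLpNorm_indicator_eq_eLpNorm_restrict (hSm n),
      eLpNorm_eq_lintegral_rpow_enorm_toReal hp0 hpt]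
    exact h7
  refine (Lp.eLpNorm_lim_le_liminf_eLpNorm
    (fun n => (hm.indicator (hSm n)).aestronglyMeasurable) h (Eventually.of_forall fun x => ?_)).trans ?_
  · by_cases hx : h x = 0
    · refine tendsto_const_nhds.congr fun n => ?_
      by_cases hn : x ∈ S n
      · rw [indicator_of_mem hn]
      · rw [indicator_of_notMem hn, hx]
    · refine tendsto_const_nhds.congr' ?_
      have h1 := (tendsto_order.1 tendsto_one_div_add_atTop_nhds_zero_nat).2 _ (norm_pos_iff.2 hx)
      have h3 := tendsto_natCast_atTop_atTop.eventually_ge_atTop ‖h x‖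
      filter_upwards [h1, h3] with n h4 h5
      rw [indicator_of_mem (show x ∈ S n from ⟨h4.le, h5⟩)]
  · refine liminf_le_of_le (by isBoundedDefault) fun b hb => ?_
    obtain ⟨n, hn⟩ := hb.exists
    exact hn.trans (hbound n)

theorem tendsto_integral_mul {p q : ℝ≥0∞} [ENNReal.HolderConjugate p q] {F f : ℝ → ℂ}
    {g : ℕ → ℝ → ℂ} (hF : MemLp F q volume) (hf : MemLp f p volume) (hg : ∀ n, MemLp (g n) p volume)
    (h : Tendsto (fun n => eLpNorm (fun x => g n x - f x) p volume) atTop (𝓝 0)) :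
    Tendsto (fun n => ∫ x, g n x * F x) atTop (𝓝 (∫ x, f x * F x)) := by
  rw [tendsto_iff_edist_tendsto_0]
  have h2 := ENNReal.Tendsto.mul_const h (b := eLpNorm F q volume) (Or.inr hF.2.ne)
  rw [zero_mul] at h2
  refine tendsto_of_tendsto_of_tendsto_of_le_of_le tendsto_const_nhds h2
    (fun _ => zero_le) fun n => ?_
  have e : ∫ x, g n x * F x - f x * F x = ∫ x, (g n x - f x) * F x := by
    simp_rw [sub_mul]
  rw [edist_eq_enorm_sub, ← integral_sub (integrable_mul_of_memLp p q (hg n) hF)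
    (integrable_mul_of_memLp p q hf hF), e]
  exact enorm_integral_mul_le p q ((hg n).sub hf).1 hF.1

theorem MemLp.mul_kernel {F : ℝ → ℂ} {p : ℝ≥0∞} (hF : MemLp F p volume) {z : ℂ} (hz : z.im ≠ 0) :
    MemLp (fun x : ℝ => F x * ((x : ℂ) - z)⁻¹) p volume := by
  simpa only [div_eq_mul_inv] using MemLp.div_sub hF hz

/-- A function with exponent dual to `q` has a decomposition that is a limit of square integrable
ones. -/
theorem exists_split_dual {p q : ℝ≥0∞} [ENNReal.HolderConjugate p q] (hq : 2 ≤ q)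
    (hq' : q ≠ ∞) (hp : p ≤ 2) (hPQ : p.toReal.HolderConjugate q.toReal)
    (hb : ProjectionBounded q) {v : ℝ → ℂ} (hv : MemLp v p volume) :
    ∃ C D : ℝ → ℂ, MemLp C p volume ∧ MemLp D p volume ∧ Split v C D ∧
      ∀ u A B : ℝ → ℂ, MemLp u q volume → MemLp A 2 volume → MemLp B 2 volume → Split u A B →
        (∀ z : ℂ, z.im ≠ 0 → cauchy u z * cauchy v z =
          2 * Real.pi * Complex.I * cauchy (fun x => u x * C x - B x * v x) z) ∧
        ∫ x, v x * A x = ∫ x, D x * u x := by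
  obtain ⟨K, hK, hKb⟩ := hb.dual hq hq' hPQ
  have hp1 : 1 ≤ p := by
    rw [← ENNReal.ofReal_one]
    refine ENNReal.ofReal_le_of_le_toReal hPQ.lt.le
  have hpt : p ≠ ∞ := ne_top_of_le_ne_top (by norm_num) hp
  have hp0 : p ≠ 0 := (lt_of_lt_of_le one_pos hp1).ne'
  have hε : ∀ n : ℕ, (2⁻¹ : ℝ≥0∞) ^ n ≠ 0 := fun n => pow_ne_zero _ (by norm_num)
  -- Simple functions in L^p are bounded and p ≤ 2, so they lie in L² and can be split there. The
  -- dual bound makes their upper parts a Cauchy sequence in L^p.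
  choose s hs hsp using fun n : ℕ => hv.exists_simpleFunc_eLpNorm_sub_lt hpt (hε n)
  have hs2 : ∀ n, MemLp (s n) 2 volume := fun n =>
    memLp_of_memLp_top hp0 hp (hsp n) ((s n).memLp_top _)
  choose c d hc2 hd2 hcd _ using fun n => exists_split (hs2 n)
  have hsub : ∀ n m, eLpNorm (c n - c m) p volume ≤ K * eLpNorm (⇑(s n) - ⇑(s m)) p volume := by
    intro n m
    refine hKb _ _ (d n - d m) ((hsp n).sub (hsp m)) ((hs2 n).sub (hs2 m)) ((hc2 n).sub (hc2 m))
      ((hd2 n).sub (hd2 m)) ⟨?_, ?_, ?_, ?_, ?_⟩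
    · filter_upwards [(hcd n).eq, (hcd m).eq] with x h1 h2
      simp only [Pi.sub_apply]
      rw [h1, h2]
      ring
    · exact (hcd n).upper.sub (hcd m).upper (hcd n).adm_upper (hcd m).adm_upper
    · exact (hcd n).lower.sub (hcd m).lower (hcd n).adm_lower (hcd m).adm_lower
    · exact (hcd n).adm_upper.sub (hcd m).adm_upper
    · exact (hcd n).adm_lower.sub (hcd m).adm_lower
  have hcp : ∀ n, MemLp (c n) p volume := fun n => ⟨(hc2 n).1,
    (hKb _ _ _ (hsp n) (hs2 n) (hc2 n) (hd2 n) (hcd n)).trans_lt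
      (ENNReal.mul_lt_top hK.lt_top (hsp n).2)⟩
  have hdp : ∀ n, MemLp (d n) p volume := fun n => by
    refine ((hsp n).sub (hcp n)).ae_eq ?_
    filter_upwards [(hcd n).eq] with x hx
    simp only [Pi.sub_apply]
    rw [hx, add_sub_cancel_left]
  have hsv : Tendsto (fun n => eLpNorm (fun x => s n x - v x) p volume) atTop (𝓝 0) := by
    refine tendsto_of_tendsto_of_tendsto_of_le_of_le tendsto_const_nhds
      (ENNReal.tendsto_pow_atTop_nhds_zero_of_lt_one (r := 2⁻¹) (by norm_num))
      (fun _ => zero_le) fun n => ?_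
    refine le_trans (le_of_eq ?_) (hs n).le
    exact eLpNorm_sub_comm _ _ _ _
  have hcau : ∀ N n m : ℕ, N ≤ n → N ≤ m →
      eLpNorm (c n - c m) p volume < (K + 1) * 2 * 2⁻¹ ^ N := by
    intro N n m hn hm
    have hle : ∀ {i}, N ≤ i → eLpNorm (v - ⇑(s i)) p volume ≤ 2⁻¹ ^ N := fun hi =>
      (hs _).le.trans (pow_le_pow_right_of_le_one' (by norm_num) hi)
    have h1 : eLpNorm (⇑(s n) - ⇑(s m)) p volume ≤ 2 * 2⁻¹ ^ N := by
      have e : ⇑(s n) - ⇑(s m) = (v - ⇑(s m)) - (v - ⇑(s n)) := by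
        ext x
        simp
      rw [e, two_mul]
      exact (eLpNorm_sub_le (hv.sub (hsp m)).1 (hv.sub (hsp n)).1 hp1).trans
        (add_le_add (hle hm) (hle hn))
    refine ((hsub n m).trans (mul_le_mul_right h1 K)).trans_lt ?_
    have hne : (2 : ℝ≥0∞) * 2⁻¹ ^ N ≠ 0 := mul_ne_zero (by norm_num) (hε N)
    have hnt : (2 : ℝ≥0∞) * 2⁻¹ ^ N ≠ ∞ :=
      ENNReal.mul_ne_top (by norm_num) (ENNReal.pow_ne_top (by norm_num))
    rw [mul_assoc (K + 1)]
    -- The constant K + 1 in place of K supplies the strict inequality that the completeness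
    -- criterion asks for.
    exact ENNReal.mul_lt_mul_left hne hnt (ENNReal.lt_add_right hK one_ne_zero)
  have hsum : ∑' n : ℕ, (K + 1) * 2 * 2⁻¹ ^ n ≠ ∞ := by
    rw [ENNReal.tsum_mul_left, ENNReal.tsum_geometric, ENNReal.one_sub_inv_two, inv_inv]
    exact ENNReal.mul_ne_top (ENNReal.mul_ne_top (ENNReal.add_ne_top.2 ⟨hK, by norm_num⟩)
      (by norm_num)) (by norm_num)
  obtain ⟨C, hC, hCt⟩ := Lp.cauchy_complete_eLpNorm hp1 hcp hsum hcau
  have hD : MemLp (fun x => v x - C x) p volume := hv.sub hC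
  have hDt : Tendsto (fun n => eLpNorm (fun x => d n x - (v x - C x)) p volume) atTop (𝓝 0) := by
    have h1 := hsv.add hCt
    rw [add_zero] at h1
    refine tendsto_of_tendsto_of_tendsto_of_le_of_le tendsto_const_nhds h1
      (fun _ => zero_le) fun n => ?_
    refine le_trans (le_of_eq (eLpNorm_congr_ae ?_))
      (eLpNorm_sub_le ((hsp n).sub hv).1 ((hcp n).sub hC).1 hp1)
    filter_upwards [(hcd n).eq] with x hx
    simp only [Pi.sub_apply]
    rw [hx]
    ring
  have hcauchy : ∀ {f : ℝ → ℂ} {g : ℕ → ℝ → ℂ} {F : ℝ → ℂ} {z : ℂ}, z.im ≠ 0 → MemLp F q volume →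
      MemLp f p volume → (∀ n, MemLp (g n) p volume) →
      Tendsto (fun n => eLpNorm (fun x => g n x - f x) p volume) atTop (𝓝 0) →
      Tendsto (fun n => cauchy (fun x => F x * g n x) z) atTop (𝓝 (cauchy (fun x => F x * f x) z)) := by
    intro f g F z hz hF hf hg h
    have := tendsto_integral_mul (MemLp.mul_kernel hF hz) hf hg h
    simp only [cauchy, div_eq_mul_inv]
    convert this using 4 <;> ring
  have hcauchy' : ∀ {f : ℝ → ℂ} {g : ℕ → ℝ → ℂ} {z : ℂ}, z.im ≠ 0 →
      MemLp f p volume → (∀ n, MemLp (g n) p volume) →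
      Tendsto (fun n => eLpNorm (fun x => g n x - f x) p volume) atTop (𝓝 0) →
      Tendsto (fun n => cauchy (g n) z) atTop (𝓝 (cauchy f z)) := by
    intro f g z hz hf hg h
    have := tendsto_integral_mul (memLp_kernel hz hq) hf hg h
    simpa only [cauchy, div_eq_mul_inv] using this
  have hadm : ∀ {f : ℝ → ℂ}, MemLp f p volume → Admissible f := fun hf =>
    MemLp.admissible p q hq hf
  refine ⟨C, fun x => v x - C x, hC, hD, ⟨?_, ?_, ?_, hadm hC, hadm hD⟩, ?_⟩
  · exact Eventually.of_forall fun x => by ring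
  · intro z hz
    refine tendsto_nhds_unique (hcauchy' hz.ne hC hcp hCt) (tendsto_const_nhds.congr fun n => ?_)
    exact ((hcd n).upper z hz).symm
  · intro z hz
    refine tendsto_nhds_unique (hcauchy' hz.ne' hD hdp hDt) (tendsto_const_nhds.congr fun n => ?_)
    exact ((hcd n).lower z hz).symm
  · intro u A B hu hA hB hsu
    have hABq := hb.memLp hu hA hB hsu
    constructor
    · intro z hz
      have hprod : ∀ {f g : ℝ → ℂ}, MemLp f q volume → MemLp g p volume →
          Admissible fun x => f x * g x := fun hf hg =>
        admissible_of_integrable (by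
          simpa only [mul_comm] using integrable_mul_of_memLp p q hg hf)
      have h1 := (hcauchy' hz hv hsp hsv).const_mul (cauchy u z)
      have h2 := ((hcauchy hz hu hC hcp hCt).sub (hcauchy hz hABq.2 hv hsp hsv)).const_mul
        (2 * Real.pi * Complex.I)
      rw [← cauchy_sub (hprod hu hC) (hprod hABq.2 hv) hz] at h2
      refine tendsto_nhds_unique h1 (h2.congr fun n => ?_)
      rw [← cauchy_sub (hprod hu (hcp n)) (hprod hABq.2 (hsp n)) hz]
      exact (hsu.cauchy_mul_cauchy (hcd n) hA hB (hc2 n) (hd2 n) hz).symm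
    · refine tendsto_nhds_unique (tendsto_integral_mul hABq.1 hv hsp hsv)
        ((tendsto_integral_mul hu hD hdp hDt).congr fun n => ?_)
      have := hsu.integral_mul (hcd n) hA hB (hc2 n) (hd2 n)
      simp_rw [mul_comm (d n _), mul_comm (s n _)]
      exact this.symm

/-! ### The nonreal points of the resolvent sets -/

/-- Multiplication by the Cauchy kernel. -/
def mulKernel (z : ℂ) (hz : z.im ≠ 0) : L2 →L[ℂ] L2 :=
  LinearMap.mkContinuous
    { toFun := fun h => (MemLp.mul_kernel (Lp.memLp h) hz).toLp _
      map_add' := fun f g => by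
        rw [← MemLp.toLp_add]
        refine MemLp.toLp_congr _ _ ?_
        filter_upwards [Lp.coeFn_add f g] with x hx
        simp only [hx, Pi.add_apply]
        ring
      map_smul' := fun a f => by
        rw [RingHom.id_apply, ← MemLp.toLp_const_smul]
        refine MemLp.toLp_congr _ _ ?_
        filter_upwards [Lp.coeFn_smul a f] with x hx
        simp only [hx, Pi.smul_apply, smul_eq_mul]
        ring } |z.im|⁻¹ fun f => by
    refine Lp.norm_le_mul_norm_of_ae_le_mul ?_
    filter_upwards [(MemLp.mul_kernel (Lp.memLp f) hz).coeFn_toLp] with x hx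
    simp only [LinearMap.coe_mk, AddHom.coe_mk]
    rw [hx, norm_mul, mul_comm]
    exact mul_le_mul_of_nonneg_right (norm_kernel_le hz x) (norm_nonneg _)

theorem coeFn_mulKernel {z : ℂ} (hz : z.im ≠ 0) (h : L2) :
    mulKernel z hz h =ᵐ[volume] fun x => h x * ((x : ℂ) - z)⁻¹ :=
  (MemLp.mul_kernel (Lp.memLp h) hz).coeFn_toLp

theorem coeFn_kernelLp {z : ℂ} (hz : z.im ≠ 0) :
    kernelLp z hz =ᵐ[volume] fun x : ℝ => ((x : ℂ) - z)⁻¹ :=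
  (memLp_kernel_two hz).coeFn_toLp

theorem gammaTwo_eq {f : maxDomain} {c : ℂ}
    (h : MemLp (fun x : ℝ => (x : ℂ) * (f : L2) x - c) 2 volume) : gammaTwo f = c :=
  const_unique (gammaTwo_spec f) h

/-- The maximal operator as a linear map on its domain. -/
def maxMap (φ ψ : L2) : maxDomain →ₗ[ℂ] L2 := (maxOp φ ψ).toFun

theorem coeFn_maxMap (φ ψ : L2) (f : maxDomain) : maxMap φ ψ f =ᵐ[volume] fun x : ℝ =>
    (x : ℂ) * (f : L2) x - gammaTwo f + inner ℂ φ (f : L2) * ψ x := by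
  have e : maxMap φ ψ f = (gammaTwo_spec f).toLp _ + inner ℂ φ (f : L2) • ψ := rfl
  rw [e]
  filter_upwards [Lp.coeFn_add ((gammaTwo_spec f).toLp _) (inner ℂ φ (f : L2) • ψ),
    (gammaTwo_spec f).coeFn_toLp, Lp.coeFn_smul (inner ℂ φ (f : L2)) ψ] with x h1 h2 h3
  rw [h1, Pi.add_apply, h2, h3, Pi.smul_apply, smul_eq_mul]

/-- Solve (x - z)f = h - dψ + c for f, treating the numbers d = ⟨f, φ⟩ and c = Γ₂ f as known; x - z
never vanishes. -/
theorem maxMap_sub_eq_iff (φ ψ : L2) {z : ℂ} (hz : z.im ≠ 0) (f : maxDomain) (h : L2) :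
    maxMap φ ψ f - z • (f : L2) = h ↔
      (f : L2) = mulKernel z hz (h - inner ℂ φ (f : L2) • ψ) + gammaTwo f • kernelLp z hz := by
  set d := inner ℂ φ (f : L2)
  set c := gammaTwo f
  have e1 : ∀ᵐ x : ℝ, (maxMap φ ψ f - z • (f : L2) : L2) x =
      (x : ℂ) * (f : L2) x - c + d * ψ x - z * (f : L2) x := by
    filter_upwards [Lp.coeFn_sub (maxMap φ ψ f) (z • (f : L2)), coeFn_maxMap φ ψ f,
      Lp.coeFn_smul z (f : L2)] with x h1 h2 h3
    rw [h1, Pi.sub_apply, h2, h3, Pi.smul_apply, smul_eq_mul]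
  have e2 : ∀ᵐ x : ℝ, (mulKernel z hz (h - d • ψ) + c • kernelLp z hz : L2) x =
      (h x - d * ψ x + c) * ((x : ℂ) - z)⁻¹ := by
    filter_upwards [Lp.coeFn_add (mulKernel z hz (h - d • ψ)) (c • kernelLp z hz),
      coeFn_mulKernel hz (h - d • ψ), Lp.coeFn_smul c (kernelLp z hz), coeFn_kernelLp hz,
      Lp.coeFn_sub h (d • ψ), Lp.coeFn_smul d ψ] with x h1 h2 h3 h4 h5 h6
    rw [h1, Pi.add_apply, h2, h3, Pi.smul_apply, h4, h5, Pi.sub_apply, h6, Pi.smul_apply,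
      smul_eq_mul, smul_eq_mul]
    ring
  have key : ∀ x : ℝ, (x : ℂ) * (f : L2) x - c + d * ψ x - z * (f : L2) x = h x ↔
      (f : L2) x = (h x - d * ψ x + c) * ((x : ℂ) - z)⁻¹ := fun x => by
    rw [eq_mul_inv_iff_mul_eq₀ (sub_ne_zero_of_im hz x)]
    constructor
    · intro h
      rw [← h]
      ring
    · intro h'
      linear_combination h'
  constructor
  · intro heq
    refine Lp.ext ?_
    filter_upwards [e1, e2] with x h1 h2
    rw [h2, ← key, ← h1, heq]
  · intro heq
    refine Lp.ext ?_
    rw [← heq] at e2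
    filter_upwards [e1, e2] with x h1 h2
    rw [h1, key, h2]

/-- For f = (h + c)/(x - z), the function xf - c equals h + zf, which is square integrable. -/
theorem memLp_resolvent_form {z : ℂ} (hz : z.im ≠ 0) (h : L2) (c : ℂ) :
    MemLp (fun x : ℝ => (x : ℂ) * (mulKernel z hz h + c • kernelLp z hz : L2) x - c) 2 volume := by
  set f : L2 := mulKernel z hz h + c • kernelLp z hz
  refine ((Lp.memLp h).add ((Lp.memLp f).const_mul z)).ae_eq ?_
  filter_upwards [Lp.coeFn_add (mulKernel z hz h) (c • kernelLp z hz),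
    coeFn_mulKernel hz h, Lp.coeFn_smul c (kernelLp z hz), coeFn_kernelLp hz] with x h1 h2 h3 h4
  have hf : f x = (h x + c) * ((x : ℂ) - z)⁻¹ := by
    rw [h1, Pi.add_apply, h2, h3, Pi.smul_apply, h4, smul_eq_mul]
    ring
  have h0 := sub_ne_zero_of_im hz x
  simp only [Pi.add_apply]
  rw [hf]
  field_simp
  ring

theorem mem_maxDomain_resolvent_form {z : ℂ} (hz : z.im ≠ 0) (h : L2) (c : ℂ) :
    mulKernel z hz h + c • kernelLp z hz ∈ maxDomain :=
  ⟨c, memLp_resolvent_form hz h c⟩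

theorem inner_mulKernel (φ h : L2) {z : ℂ} (hz : z.im ≠ 0) :
    inner ℂ φ (mulKernel z hz h) = cauchy (fun x => h x * conj (φ x)) z := by
  rw [inner_eq_integral, cauchy]
  refine integral_congr_ae ?_
  filter_upwards [coeFn_mulKernel hz h] with x hx
  rw [hx, div_eq_mul_inv]
  ring

theorem inner_kernelLp_right (φ : L2) {z : ℂ} (hz : z.im ≠ 0) :
    inner ℂ φ (kernelLp z hz) = cauchy (fun x => conj (φ x)) z := by
  rw [inner_eq_integral, cauchy]
  refine integral_congr_ae ?_
  filter_upwards [coeFn_kernelLp hz] with x hx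
  rw [hx, div_eq_mul_inv]
  ring

/-- The integrand contains ψ conj φ. This is where disjointness of the supports makes the rank-one
perturbation explicitly solvable. -/
theorem inner_mulKernel_eq_zero {φ ψ : L2} (hdisj : ∀ᵐ x : ℝ, φ x * ψ x = 0) {z : ℂ}
    (hz : z.im ≠ 0) : inner ℂ φ (mulKernel z hz ψ) = 0 := by
  rw [inner_mulKernel, cauchy]
  refine integral_eq_zero_of_ae ?_
  filter_upwards [hdisj] with x hx
  rcases mul_eq_zero.1 hx with h | h <;> simp [h]

/-- The solution of `maxMap φ ψ f = z f` with `Γ₂ f = 1`. -/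
def eigenvector (φ ψ : L2) (z : ℂ) (hz : z.im ≠ 0) : L2 :=
  mulKernel z hz (-(cauchy (fun x => conj (φ x)) z • ψ)) + (1 : ℂ) • kernelLp z hz

theorem eigenvector_mem (φ ψ : L2) {z : ℂ} (hz : z.im ≠ 0) :
    eigenvector φ ψ z hz ∈ maxDomain :=
  mem_maxDomain_resolvent_form hz _ _

theorem gammaTwo_eigenvector (φ ψ : L2) {z : ℂ} (hz : z.im ≠ 0) :
    gammaTwo ⟨eigenvector φ ψ z hz, eigenvector_mem φ ψ hz⟩ = 1 :=
  gammaTwo_eq (memLp_resolvent_form hz _ _)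

theorem inner_eigenvector {φ ψ : L2} (hdisj : ∀ᵐ x : ℝ, φ x * ψ x = 0) {z : ℂ} (hz : z.im ≠ 0) :
    inner ℂ φ (eigenvector φ ψ z hz) = cauchy (fun x => conj (φ x)) z := by
  rw [eigenvector, map_neg, map_smul, inner_add_right, inner_neg_right, inner_smul_right,
    inner_mulKernel_eq_zero hdisj, one_smul, inner_kernelLp_right]
  ring

theorem maxMap_eigenvector {φ ψ : L2} (hdisj : ∀ᵐ x : ℝ, φ x * ψ x = 0) {z : ℂ} (hz : z.im ≠ 0) :
    maxMap φ ψ ⟨eigenvector φ ψ z hz, eigenvector_mem φ ψ hz⟩ = z • eigenvector φ ψ z hz := by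
  rw [← sub_eq_zero]
  refine (maxMap_sub_eq_iff φ ψ hz ⟨_, eigenvector_mem φ ψ hz⟩ 0).2 ?_
  rw [gammaTwo_eigenvector, inner_eigenvector hdisj, zero_sub]
  rfl

theorem eq_smul_eigenvector {φ ψ : L2} (hdisj : ∀ᵐ x : ℝ, φ x * ψ x = 0) {z : ℂ} (hz : z.im ≠ 0)
    (f : maxDomain) (hf : maxMap φ ψ f = z • (f : L2)) :
    (f : L2) = gammaTwo f • eigenvector φ ψ z hz := by
  have h := (maxMap_sub_eq_iff φ ψ hz f 0).1 (sub_eq_zero.2 hf)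
  set d := inner ℂ φ (f : L2) with hd
  set c := gammaTwo f
  have hd' : d = c * cauchy (fun x => conj (φ x)) z := by
    rw [hd, h, zero_sub, map_neg, map_smul, inner_add_right, inner_neg_right, inner_smul_right,
      inner_mulKernel_eq_zero hdisj, inner_smul_right, inner_kernelLp_right]
    ring
  rw [h, hd', eigenvector, zero_sub, map_neg, map_neg, map_smul, map_smul]
  module

theorem mulKernel_mem_maxDomain {z : ℂ} (hz : z.im ≠ 0) (h : L2) : mulKernel z hz h ∈ maxDomain := by
  simpa using mem_maxDomain_resolvent_form hz h 0

theorem gammaOne_eq_of_integrable (f : maxDomain) (hf : Integrable (f : L2)) :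
    gammaOne f = ∫ x : ℝ, (f : L2) x :=
  (intervalIntegral_tendsto_integral hf tendsto_neg_atTop_atBot tendsto_id).limUnder_eq

theorem gammaOne_mulKernel {z : ℂ} (hz : z.im ≠ 0) (h : L2) :
    gammaOne ⟨mulKernel z hz h, mulKernel_mem_maxDomain hz h⟩ = cauchy h z := by
  have hi : Integrable fun x : ℝ => h x * ((x : ℂ) - z)⁻¹ :=
    integrable_mul_of_memLp_two (Lp.memLp h) (memLp_kernel_two hz)
  rw [gammaOne_eq_of_integrable _ (hi.congr (coeFn_mulKernel hz h).symm), cauchy]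
  simp only [div_eq_mul_inv]
  exact integral_congr_ae (coeFn_mulKernel hz h)

theorem mem_domain_opB_iff (φ ψ : L2) (B : ℂ) (f : L2) : f ∈ (opB φ ψ B).domain ↔
    ∃ hf : f ∈ maxDomain, gammaOne ⟨f, hf⟩ = B * gammaTwo ⟨f, hf⟩ := by
  rw [opB, LinearPMap.domRestrict_domain, Submodule.mem_inf, Submodule.mem_map]
  constructor
  · rintro ⟨⟨g, hg, rfl⟩, _⟩
    refine ⟨g.2, ?_⟩
    rw [LinearMap.mem_ker, LinearMap.sub_apply, sub_eq_zero] at hg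
    exact hg
  · rintro ⟨hf, h⟩
    refine ⟨⟨⟨f, hf⟩, ?_, rfl⟩, hf⟩
    rw [LinearMap.mem_ker, LinearMap.sub_apply, sub_eq_zero]
    exact h

theorem opB_apply (φ ψ : L2) (B : ℂ) {f : L2} (hf : f ∈ (opB φ ψ B).domain) (hf' : f ∈ maxDomain) :
    opB φ ψ B ⟨f, hf⟩ = maxMap φ ψ ⟨f, hf'⟩ := rfl

/-- A solution with Γ₂ = 0 is corrected by a multiple of the eigenvector, as in Krein's formula. The
boundary condition determines the multiple when B ≠ M, and it also excludes an eigenvector from the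
domain, which gives uniqueness. -/
theorem mem_resolventSet_opB {φ ψ : L2} (hdisj : ∀ᵐ x : ℝ, φ x * ψ x = 0) {z : ℂ} (hz : z.im ≠ 0)
    {B : ℂ} (hB : gammaOne ⟨eigenvector φ ψ z hz, eigenvector_mem φ ψ hz⟩ ≠ B) :
    z ∈ resolventSet (opB φ ψ B) := by
  set M := gammaOne ⟨eigenvector φ ψ z hz, eigenvector_mem φ ψ hz⟩ with hM
  have hBM : B - M ≠ 0 := sub_ne_zero.2 hB.symm
  -- `mulKernel z hz (P h)` solves the equation with Γ₂ = 0. Adding γ times the eigenvector makes Γ₂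
  -- = γ and Γ₁ = K(P h)(z) + γM, so Γ₁ = BΓ₂ forces (B - M)γ = K(P h)(z).
  set β : L2 →L[ℂ] ℂ := (innerSL ℂ φ).comp (mulKernel z hz) with hβ
  set P : L2 →L[ℂ] L2 := ContinuousLinearMap.id ℂ L2 - β.smulRight ψ with hP
  set γ : L2 →L[ℂ] ℂ := (B - M)⁻¹ • (innerSL ℂ (kernelLp (conj z) (by simpa using hz))).comp P
    with hγ
  set R : L2 →L[ℂ] L2 := (mulKernel z hz).comp P + γ.smulRight (eigenvector φ ψ z hz) with hR
  have hRh : ∀ h, R h = mulKernel z hz (P h) + γ h • eigenvector φ ψ z hz := fun h => rfl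
  have hPh : ∀ h, P h = h - β h • ψ := fun h => rfl
  have hγh : ∀ h, (B - M) * γ h = cauchy (P h) z := fun h => by
    have : γ h = (B - M)⁻¹ * inner ℂ (kernelLp (conj z) (by simpa using hz)) (P h) := rfl
    rw [this, mul_inv_cancel_left₀ hBM, inner_kernelLp _ hz]
  set α := cauchy (fun x => conj (φ x)) z with hα
  have hform : ∀ h, R h = mulKernel z hz (h - (β h + γ h * α) • ψ) + γ h • kernelLp z hz := by
    intro h
    rw [hRh, hPh, eigenvector, map_sub, map_sub, map_smul, map_smul, map_neg, map_smul]
    module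
  have hdom : ∀ h, R h ∈ maxDomain := fun h => by
    rw [hform]
    exact mem_maxDomain_resolvent_form hz _ _
  have hg2 : ∀ h, gammaTwo ⟨R h, hdom h⟩ = γ h := fun h => by
    refine gammaTwo_eq ?_
    simp only [hform]
    exact memLp_resolvent_form hz _ _
  have hin : ∀ h, inner ℂ φ (R h) = β h + γ h * α := fun h => by
    have : β h = inner ℂ φ (mulKernel z hz h) := rfl
    rw [hRh, hPh, inner_add_right, inner_smul_right, inner_eigenvector hdisj, map_sub, map_smul,
      inner_sub_right, inner_smul_right, inner_mulKernel_eq_zero hdisj, mul_zero, sub_zero, this]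
  have hmax : ∀ h, maxMap φ ψ ⟨R h, hdom h⟩ - z • R h = h := fun h => by
    refine (maxMap_sub_eq_iff φ ψ hz ⟨R h, hdom h⟩ h).2 ?_
    rw [hg2]
    simp only
    rw [hin, ← hform]
  have hg1 : ∀ h, gammaOne ⟨R h, hdom h⟩ = B * γ h := fun h => by
    have e : (⟨R h, hdom h⟩ : maxDomain) = ⟨mulKernel z hz (P h), mulKernel_mem_maxDomain hz _⟩ +
        γ h • ⟨eigenvector φ ψ z hz, eigenvector_mem φ ψ hz⟩ := Subtype.ext (hRh h)
    rw [e, map_add, map_smul, gammaOne_mulKernel, ← hγh, ← hM, smul_eq_mul]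
    ring
  have hopB : ∀ h, R h ∈ (opB φ ψ B).domain := fun h =>
    (mem_domain_opB_iff φ ψ B _).2 ⟨hdom h, by rw [hg1, hg2]⟩
  refine ⟨R, fun h => ⟨hopB h, ?_⟩, ?_⟩
  · rw [opB_apply φ ψ B (hopB h) (hdom h)]
    exact hmax h
  · rintro ⟨f, hf⟩
    obtain ⟨hfm, hfB⟩ := (mem_domain_opB_iff φ ψ B f).1 hf
    rw [opB_apply φ ψ B hf hfm]
    set h := maxMap φ ψ ⟨f, hfm⟩ - z • f with hh
    set e : maxDomain := ⟨R h, hdom h⟩ - ⟨f, hfm⟩ with he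
    have h1 : maxMap φ ψ e = z • (e : L2) := by
      rw [he]
      have e1 : maxMap φ ψ (⟨R h, hdom h⟩ - ⟨f, hfm⟩) = maxMap φ ψ ⟨R h, hdom h⟩ -
        maxMap φ ψ ⟨f, hfm⟩ := map_sub _ _ _
      rw [e1, Submodule.coe_sub, smul_sub, ← sub_eq_zero]
      have h2 := hmax h
      rw [sub_eq_iff_eq_add] at h2
      rw [h2, hh]
      simp only
      abel
    have h2 := eq_smul_eigenvector hdisj hz e h1
    have h3 : gammaOne e = B * gammaTwo e := by
      rw [he, map_sub gammaOne, map_sub gammaTwo, hg1, hg2, hfB]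
      ring
    have h4 : e = gammaTwo e • (⟨eigenvector φ ψ z hz, eigenvector_mem φ ψ hz⟩ : maxDomain) :=
      Subtype.ext h2
    have h5 : gammaOne e = gammaTwo e * M := by
      conv_lhs => rw [h4]
      rw [map_smul, smul_eq_mul]
    have h6 : (B - M) * gammaTwo e = 0 := by
      rw [sub_mul, ← h3, h5]
      ring
    have h7 := (mul_eq_zero.1 h6).resolve_left hBM
    rw [h7, zero_smul] at h2
    exact sub_eq_zero.1 h2

/-! ### The real points -/

theorem exists_step_function (φ : L2) (t : ℝ) {δ : ℝ} (hδ : 0 < δ) :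
    ∃ F : ℝ → ℂ, MemLp F 2 volume ∧ Integrable F ∧ (∀ x ∉ Icc t (t + δ), F x = 0) ∧
      ¬ F =ᵐ[volume] 0 ∧ ∫ x, F x = 0 ∧ ∫ x, F x * conj (φ x) = 0 := by
  set I : Fin 3 → Set ℝ := fun i => Ioc (t + i * (δ / 3)) (t + (i + 1) * (δ / 3)) with hI
  have hIm : ∀ i, MeasurableSet (I i) := fun i => measurableSet_Ioc
  have hIv : ∀ i, volume (I i) = ENNReal.ofReal (δ / 3) := fun i => by
    rw [hI, Real.volume_Ioc]
    congr 1
    ring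
  have hIf : ∀ i, volume (I i) ≠ ∞ := fun i => by rw [hIv]; exact ENNReal.ofReal_ne_top
  have hsub : ∀ i, I i ⊆ Icc t (t + δ) := fun i x hx => by
    have h1 : (0 : ℝ) ≤ (i : ℕ) := Nat.cast_nonneg _
    have h2 : ((i : ℕ) : ℝ) + 1 ≤ 3 := by exact_mod_cast i.2
    have h3 : 0 < δ / 3 := by positivity
    have h4 := mul_le_mul_of_nonneg_right h2 h3.le
    constructor
    · exact le_trans (by nlinarith) hx.1.le
    · refine hx.2.trans ?_
      linarith
  have hdis : ∀ i j, i ≠ j → ∀ x ∈ I i, x ∉ I j := by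
    intro i j hij x hi hj
    have h3 : 0 < δ / 3 := by positivity
    rcases lt_or_gt_of_ne hij with h | h
    · have h2 : ((i : ℕ) : ℝ) + 1 ≤ (j : ℕ) := by exact_mod_cast h
      have := mul_le_mul_of_nonneg_right h2 h3.le
      have a1 := hi.2
      have a2 := hj.1
      linarith
    · have h2 : ((j : ℕ) : ℝ) + 1 ≤ (i : ℕ) := by exact_mod_cast h
      have := mul_le_mul_of_nonneg_right h2 h3.le
      have a1 := hj.2
      have a2 := hi.1
      linarith
  have hφc : MemLp (fun x => conj (φ x)) 2 volume := MemLp.conj (Lp.memLp φ)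
  have hind : ∀ i (s : ℝ≥0∞) (a : ℂ), MemLp ((I i).indicator fun _ => a) s volume := fun i s a =>
    memLp_indicator_const s (hIm i) a (Or.inr (hIf i))
  set p : Fin 3 → ℂ × ℂ := fun i => (∫ x, (I i).indicator (fun _ => (1 : ℂ)) x,
    ∫ x, (I i).indicator (fun _ => (1 : ℂ)) x * conj (φ x)) with hp
  -- Three coefficients are subject to two linear conditions, so a nonzero choice exists.
  have hker : LinearMap.ker (Fintype.linearCombination ℂ p) ≠ ⊥ :=
    LinearMap.ker_ne_bot_of_finrank_lt (by simp)
  obtain ⟨a, ha, ha0⟩ := Submodule.exists_mem_ne_zero_of_ne_bot hker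
  rw [LinearMap.mem_ker, Fintype.linearCombination_apply] at ha
  have hmul : ∀ i x, (I i).indicator (fun _ => a i) x =
      a i * (I i).indicator (fun _ => (1 : ℂ)) x := fun i x => by
    by_cases hx : x ∈ I i <;> simp [hx]
  refine ⟨fun x => ∑ i, (I i).indicator (fun _ => a i) x, ?_, ?_, ?_, ?_, ?_, ?_⟩
  · exact memLp_finsetSum _ fun i _ => hind i 2 (a i)
  · exact integrable_finsetSum _ fun i _ => memLp_one_iff_integrable.1 (hind i 1 (a i))
  · intro x hx
    exact Finset.sum_eq_zero fun i _ => indicator_of_notMem (fun h => hx (hsub i h)) _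
  · intro h
    apply ha0
    ext i
    by_contra hai
    have hnull : volume (I i) = 0 := by
      refine measure_mono_null (fun x hx => ?_) h
      simp only [mem_compl_iff, mem_ofPred_eq, Pi.zero_apply]
      intro h0
      apply hai
      rw [Finset.sum_eq_single i (fun j _ hj => indicator_of_notMem (hdis i j hj.symm x hx) _)
        (by simp), indicator_of_mem hx] at h0
      exact h0
    rw [hIv, ENNReal.ofReal_eq_zero] at hnull
    linarith
  · rw [integral_finsetSum _ fun i _ => memLp_one_iff_integrable.1 (hind i 1 (a i))]
    simp_rw [hmul, integral_const_mul]
    simpa [hp, Prod.fst_sum] using congrArg Prod.fst ha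
  · simp_rw [Finset.sum_mul]
    rw [integral_finsetSum _ fun i _ => integrable_mul_of_memLp_two (hind i 2 (a i)) hφc]
    simp_rw [hmul, mul_assoc, integral_const_mul]
    simpa [hp, Prod.snd_sum] using congrArg Prod.snd ha

/-- Every real t is an approximate eigenvalue. A nonzero function supported in [t, t + δ] with zero
integral and orthogonal to φ lies in the domain of every A_B; there A_B - t acts as multiplication
by x - t, of size at most δ. -/
theorem im_ne_zero_of_mem_resolventSet {φ ψ : L2} {B z : ℂ} (h : z ∈ resolventSet (opB φ ψ B)) :
    z.im ≠ 0 := by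
  intro hz
  obtain ⟨R, -, hR⟩ := h
  obtain ⟨t, rfl⟩ : ∃ t : ℝ, z = t := ⟨z.re, by
    refine Complex.ext ?_ ?_ <;> simp [hz]⟩
  -- Chosen so that ‖R‖δ < 1, which contradicts ‖f‖ ≤ ‖R‖δ‖f‖.
  set δ : ℝ := (‖R‖ + 1)⁻¹ with hδ'
  have hδ : 0 < δ := by positivity
  obtain ⟨F, hF2, hF1, hFs, hF0, hFi, hFφ⟩ := exists_step_function φ t hδ
  set f : L2 := hF2.toLp F
  have hfF : f =ᵐ[volume] F := hF2.coeFn_toLp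
  have hxF : MemLp (fun x : ℝ => ((x : ℂ) - t) * F x) 2 volume := by
    refine MemLp.of_le_mul (c := δ) hF2 ?_ (Eventually.of_forall fun x => ?_)
    · exact (Continuous.aestronglyMeasurable (by fun_prop)).mul hF2.1
    · rw [norm_mul]
      by_cases hx : x ∈ Icc t (t + δ)
      · refine mul_le_mul_of_nonneg_right ?_ (norm_nonneg _)
        rw [← Complex.ofReal_sub, Complex.norm_real, Real.norm_eq_abs, abs_le]
        constructor <;> linarith [hx.1, hx.2]
      · rw [hFs x hx]
        simp
  have hc : MemLp (fun x : ℝ => (x : ℂ) * f x - 0) 2 volume := by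
    refine (hxF.add (hF2.const_mul (t : ℂ))).ae_eq ?_
    filter_upwards [hfF] with x hx
    rw [Pi.add_apply, hx]
    ring
  have hfm : f ∈ maxDomain := ⟨0, hc⟩
  have hg2 : gammaTwo ⟨f, hfm⟩ = 0 := gammaTwo_eq hc
  have hg1 : gammaOne ⟨f, hfm⟩ = 0 := by
    rw [gammaOne_eq_of_integrable _ (hF1.congr hfF.symm), integral_congr_ae hfF, hFi]
  have hdom : f ∈ (opB φ ψ B).domain := (mem_domain_opB_iff φ ψ B f).2
    ⟨hfm, by rw [hg1, hg2, mul_zero]⟩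
  have hin : inner ℂ φ f = 0 := by
    rw [inner_eq_integral, ← hFφ]
    refine integral_congr_ae ?_
    filter_upwards [hfF] with x hx
    rw [hx]
  have hle : ‖opB φ ψ B ⟨f, hdom⟩ - (t : ℂ) • f‖ ≤ δ * ‖f‖ := by
    refine Lp.norm_le_mul_norm_of_ae_le_mul ?_
    rw [opB_apply φ ψ B hdom hfm]
    filter_upwards [Lp.coeFn_sub (maxMap φ ψ ⟨f, hfm⟩) ((t : ℂ) • f), coeFn_maxMap φ ψ ⟨f, hfm⟩,
      Lp.coeFn_smul (t : ℂ) f, hfF] with x h1 h2 h3 h4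
    rw [h1, Pi.sub_apply, h2, h3, Pi.smul_apply, hg2]
    rw [hin, h4, smul_eq_mul, zero_mul, add_zero, sub_zero, ← sub_mul, norm_mul]
    by_cases hx : x ∈ Icc t (t + δ)
    · refine mul_le_mul_of_nonneg_right ?_ (norm_nonneg _)
      rw [← Complex.ofReal_sub, Complex.norm_real, Real.norm_eq_abs, abs_le]
      constructor <;> linarith [hx.1, hx.2]
    · rw [hFs x hx]
      simp
  have hRf := hR ⟨f, hdom⟩
  have hfpos : 0 < ‖f‖ := by
    rw [norm_pos_iff]
    intro h0
    exact hF0 (hfF.symm.trans ((Lp.eq_zero_iff_ae_eq_zero).1 h0))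
  have h1 : ‖f‖ ≤ ‖R‖ * (δ * ‖f‖) := by
    calc ‖f‖ = ‖R (opB φ ψ B ⟨f, hdom⟩ - (t : ℂ) • f)‖ := congrArg norm hRf.symm
      _ ≤ ‖R‖ * ‖opB φ ψ B ⟨f, hdom⟩ - (t : ℂ) • f‖ := R.le_opNorm _
      _ ≤ _ := mul_le_mul_of_nonneg_left hle (norm_nonneg _)
  have h2 : ‖R‖ * δ < 1 := by
    rw [hδ', mul_inv_lt_iff₀ (by positivity)]
    linarith
  nlinarith

theorem iUnion_resolventSet_opB {φ ψ : L2} (hdisj : ∀ᵐ x : ℝ, φ x * ψ x = 0) :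
    ⋃ B : ℂ, resolventSet (opB φ ψ B) = {z : ℂ | z.im ≠ 0} := by
  ext z
  rw [mem_iUnion]
  constructor
  · rintro ⟨B, hB⟩
    exact im_ne_zero_of_mem_resolventSet hB
  · intro hz
    obtain ⟨B, hB⟩ := exists_ne (gammaOne ⟨eigenvector φ ψ z hz, eigenvector_mem φ ψ hz⟩)
    exact ⟨B, mem_resolventSet_opB hdisj hz hB.symm⟩

/-! ### Orthogonality to the eigenvectors -/

theorem inner_eigenvector_right (φ ψ g : L2) {z : ℂ} (hz : z.im ≠ 0) :
    inner ℂ g (eigenvector φ ψ z hz) = cauchy (fun x => conj (g x)) z -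
      cauchy (fun x => conj (φ x)) z * cauchy (fun x => ψ x * conj (g x)) z := by
  rw [eigenvector, map_neg, map_smul, inner_add_right, inner_neg_right, inner_smul_right,
    inner_mulKernel, one_smul, inner_kernelLp_right]
  ring

theorem mem_orthogonal_detectable_iff {φ ψ : L2} (hdisj : ∀ᵐ x : ℝ, φ x * ψ x = 0) (g : L2) :
    g ∈ (detectable φ ψ)ᗮ ↔ ∀ z : ℂ, z.im ≠ 0 → cauchy (fun x => conj (g x)) z =
      cauchy (fun x => conj (φ x)) z * cauchy (fun x => ψ x * conj (g x)) z := by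
  rw [detectable, Submodule.orthogonal_closure, iUnion_resolventSet_opB hdisj]
  constructor
  · intro h z hz
    rw [← sub_eq_zero, ← inner_eigenvector_right φ ψ g hz]
    refine (Submodule.mem_orthogonal' _ _).1 h _ (Submodule.subset_span ?_)
    exact ⟨z, hz, eigenvector_mem φ ψ hz, maxMap_eigenvector hdisj hz⟩
  · intro h
    rw [Submodule.mem_orthogonal']
    intro u hu
    induction hu using Submodule.span_induction with
    | mem x hx =>
      obtain ⟨z, hz, hx1, hx2⟩ := hx
      rw [show x = gammaTwo ⟨x, hx1⟩ • eigenvector φ ψ z hz from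
        eq_smul_eigenvector hdisj hz ⟨x, hx1⟩ hx2, inner_smul_right,
        inner_eigenvector_right φ ψ g hz, h z hz, sub_self, mul_zero]
    | zero => simp
    | add x y _ _ hx hy => rw [inner_add_right, hx, hy, add_zero]
    | smul a x _ hx => rw [inner_smul_right, hx, mul_zero]

/-! ### The orthogonal complement of the detectable subspace -/

/-- Exponents for which the product formula for Cauchy transforms holds. -/
structure Exponents (p q r : ℝ≥0∞) : Prop where
  holderConjugate : ENNReal.HolderConjugate p q
  holderTriple_two : ENNReal.HolderTriple r q 2
  holderTriple : ENNReal.HolderTriple r 2 p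
  two_le : 2 ≤ q
  ne_top : q ≠ ∞
  le_two : p ≤ 2
  toReal_holderConjugate : p.toReal.HolderConjugate q.toReal
  projectionBounded : ProjectionBounded q

/-- The relations are 1/p = 1 - 1/q and 1/r = 1/2 - 1/q with q = 2^(n+1). For n = 0 this means p = q
= 2 and r = ∞; for n = 1 it means p = 4/3 and q = r = 4. -/
theorem exponents_two_pow (n : ℕ) : Exponents ((1 - (2 ^ (n + 1))⁻¹)⁻¹) (2 ^ (n + 1))
    ((2⁻¹ - (2 ^ (n + 1))⁻¹)⁻¹) := by
  have h2q : (2 : ℝ≥0∞) ≤ 2 ^ (n + 1) := le_self_pow₀ (by norm_num) (by omega)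
  have hqt : (2 : ℝ≥0∞) ^ (n + 1) ≠ ∞ := ENNReal.pow_ne_top (by norm_num)
  set q : ℝ≥0∞ := 2 ^ (n + 1)
  have hq2 : q⁻¹ ≤ 2⁻¹ := ENNReal.inv_le_inv.2 h2q
  have h21 : (2 : ℝ≥0∞)⁻¹ ≤ 1 := by norm_num
  have hconj : ENNReal.HolderConjugate ((1 - q⁻¹)⁻¹) q :=
    ⟨by rw [inv_inv, inv_one, tsub_add_cancel_of_le (hq2.trans h21)]⟩
  have hlow : (2 : ℝ≥0∞)⁻¹ ≤ 1 - q⁻¹ := by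
    rw [← ENNReal.one_sub_inv_two]
    exact tsub_le_tsub_left hq2 _
  have hp2 : (1 - q⁻¹)⁻¹ ≤ 2 := by
    rw [← inv_inv (2 : ℝ≥0∞)]
    exact ENNReal.inv_le_inv.2 hlow
  refine ⟨hconj, ⟨?_⟩, ⟨?_⟩, h2q, hqt, hp2, ?_, projectionBounded_two_pow n⟩
  · rw [inv_inv, tsub_add_cancel_of_le hq2]
  · rw [inv_inv, inv_inv, ← ENNReal.inv_two_add_inv_two, ENNReal.sub_add_eq_add_sub hq2
      (ENNReal.inv_ne_top.2 (lt_of_lt_of_le (by norm_num) h2q).ne')]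
  · exact ENNReal.HolderConjugate.toReal_of_ne_top (ne_top_of_le_ne_top (by norm_num) hp2) hqt

theorem cutProduct_eq (ψ g : L2) : cutProduct ψ g = fun x => ψ x * conj (g x) := by
  ext x
  by_cases hx : ψ x = 0
  · simp [cutProduct, hx]
  · rw [cutProduct, indicator_of_mem (show x ∈ nonzeroSet ψ from hx)]

theorem upperValue_congr {F G : ℝ → ℂ} (h : F =ᵐ[volume] G) : upperValue F = upperValue G := by
  ext k
  simp only [upperValue, cauchy_congr h]

theorem Exponents.memLp_mul_conj {p q r : ℝ≥0∞} (E : Exponents p q r) {ψ : L2}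
    (hψ : MemLp ψ r volume) (g : L2) : MemLp (fun x => ψ x * conj (g x)) p volume := by
  have := E.holderTriple
  exact (MemLp.conj (Lp.memLp g)).mul (p := r) (q := 2) (r := p) hψ

theorem Exponents.exists_split {p q r : ℝ≥0∞} (E : Exponents p q r) {v : ℝ → ℂ}
    (hv : MemLp v p volume) :
    ∃ C D : ℝ → ℂ, MemLp C p volume ∧ MemLp D p volume ∧ Split v C D ∧
      ∀ u A B : ℝ → ℂ, MemLp u q volume → MemLp A 2 volume → MemLp B 2 volume → Split u A B →
        (∀ z : ℂ, z.im ≠ 0 → cauchy u z * cauchy v z =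
          2 * Real.pi * Complex.I * cauchy (fun x => u x * C x - B x * v x) z) ∧
        ∫ x, v x * A x = ∫ x, D x * u x := by
  have := E.holderConjugate
  exact exists_split_dual E.two_le E.ne_top E.le_two E.toReal_holderConjugate E.projectionBounded hv

/-- The product of Cauchy transforms is itself the Cauchy transform of w, so injectivity turns the
identity off the line into conj g = w almost everywhere; the split parts in w are then read as
boundary values. -/
theorem Exponents.mem_orthogonal_iff {p q r : ℝ≥0∞} (E : Exponents p q r) {φ ψ : L2}
    (hdisj : ∀ᵐ x : ℝ, φ x * ψ x = 0) (hφ : MemLp φ q volume) (hψ : MemLp ψ r volume) (g : L2) :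
    g ∈ (detectable φ ψ)ᗮ ↔ ∀ᵐ k : ℝ, conj (g k) =
      conj (φ k) * upperValue (cutProduct ψ g) k +
        lowerValue (fun x => conj (φ x)) k * (ψ k * conj (g k)) := by
  have := E.holderConjugate
  have hv := E.memLp_mul_conj hψ g
  obtain ⟨C, D, hC, hD, hs, hmul⟩ := E.exists_split hv
  obtain ⟨A, B, hA, hB, hs', _⟩ := Friedrichs.exists_split (MemLp.conj (Lp.memLp φ))
  have hm := (hmul _ A B (MemLp.conj hφ) hA hB hs').1
  have hBq := (E.projectionBounded.memLp (MemLp.conj hφ) hA hB hs').2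
  set w : ℝ → ℂ := fun x => 2 * Real.pi * Complex.I *
    (conj (φ x) * C x - B x * (ψ x * conj (g x))) with hw
  have hwa : Admissible w := by
    refine Admissible.const_mul (Admissible.sub ?_ ?_) _
    · exact admissible_of_integrable (by
        simpa only [mul_comm] using integrable_mul_of_memLp p q hC (MemLp.conj hφ))
    · exact admissible_of_integrable (by
        simpa only [mul_comm] using integrable_mul_of_memLp p q hv hBq)
  have hga : Admissible fun x => conj (g x) := admissible_of_memLp_two (MemLp.conj (Lp.memLp g))
  have hwae : ∀ᵐ k : ℝ, w k = conj (φ k) * upperValue (cutProduct ψ g) k +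
      lowerValue (fun x => conj (φ x)) k * (ψ k * conj (g k)) := by
    rw [cutProduct_eq]
    filter_upwards [hs.upperValue_eq, hs'.lowerValue_eq] with k h1 h2
    rw [h1, h2, hw]
    ring
  have key : g ∈ (detectable φ ψ)ᗮ ↔ ∀ᵐ k : ℝ, conj (g k) = w k := by
    rw [mem_orthogonal_detectable_iff hdisj]
    have hcw : ∀ z : ℂ, z.im ≠ 0 → cauchy (fun x => conj (φ x)) z *
        cauchy (fun x => ψ x * conj (g x)) z = cauchy w z := fun z hz => by
      rw [hm z hz, hw, cauchy_const_mul]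
    constructor
    · intro h
      have h0 := ae_eq_zero_of_cauchy_eq_zero (hga.sub hwa) fun z hz => by
        rw [cauchy_sub hga hwa hz, h z hz, hcw z hz, sub_self]
      filter_upwards [h0] with k hk
      exact sub_eq_zero.1 hk
    · intro h z hz
      rw [hcw z hz]
      exact cauchy_congr h z
  rw [key]
  constructor
  · intro h
    filter_upwards [h, hwae] with k h1 h2
    exact h1.trans h2
  · intro h
    filter_upwards [h, hwae] with k h1 h2
    exact h1.trans h2.symm

/-- Almost every k has φ(k) = 0 or ψ(k) = 0. The single equation becomes the first condition where φ
≠ 0, the second where ψ ≠ 0 and the third elsewhere. -/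
theorem conditions_iff {φ ψ : L2} (hdisj : ∀ᵐ x : ℝ, φ x * ψ x = 0) (g : L2) (U L : ℝ → ℂ) :
    (∀ᵐ k : ℝ, conj (g k) = conj (φ k) * U k + L k * (ψ k * conj (g k))) ↔
      (∀ᵐ k : ℝ, (nonzeroSet φ).indicator (fun x => conj (g x)) k = conj (φ k) * U k) ∧
      (∀ᵐ k : ℝ, (nonzeroSet ψ).indicator (fun x => conj (g x)) k * (1 - L k * ψ k) = 0) ∧
      (∀ᵐ k : ℝ, k ∈ (nonzeroSet ψ ∪ nonzeroSet φ)ᶜ → g k = 0) := by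
  rw [← eventually_and, ← eventually_and]
  refine eventually_congr ?_
  filter_upwards [hdisj] with k hk
  have hmem : ∀ u : L2, k ∈ nonzeroSet u ↔ u k ≠ 0 := fun u => Iff.rfl
  by_cases h1 : φ k = 0
  · have i1 : k ∉ nonzeroSet φ := fun h => h h1
    by_cases h2 : ψ k = 0
    · have i2 : k ∉ nonzeroSet ψ := fun h => h h2
      simp [i1, i2, h1, h2]
    · have i2 : k ∈ nonzeroSet ψ := h2
      simp only [indicator_of_notMem i1, indicator_of_mem i2, h1, map_zero, zero_mul, zero_add,
        mem_compl_iff, mem_union, i2, true_or, not_true_eq_false, false_imp_iff, and_true, true_and]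
      constructor
      · intro h
        linear_combination h
      · intro h
        linear_combination h
  · have h2 : ψ k = 0 := (mul_eq_zero.1 hk).resolve_left h1
    have i1 : k ∈ nonzeroSet φ := h1
    have i2 : k ∉ nonzeroSet ψ := fun h => h h2
    simp [i1, i2, h2]

instance (φ ψ : L2) : CompleteSpace (detectable φ ψ) :=
  (Submodule.isClosed_topologicalClosure _).completeSpace_coe

/-- Off the unit set the second condition forces ψ conj g = 0; then its Cauchy transform vanishes
too, and the equation for g leaves nothing. -/
theorem Exponents.detectable_eq_top {p q r : ℝ≥0∞} (E : Exponents p q r) {φ ψ : L2}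
    (hdisj : ∀ᵐ x : ℝ, φ x * ψ x = 0) (hφ : MemLp φ q volume) (hψ : MemLp ψ r volume)
    (h0 : volume (unitSet φ ψ) = 0) : detectable φ ψ = ⊤ := by
  rw [← Submodule.orthogonal_eq_bot_iff, Submodule.eq_bot_iff]
  intro g hg
  have h := (E.mem_orthogonal_iff hdisj hφ hψ g).1 hg
  have hc := (conditions_iff hdisj g _ _).1 h
  have hz : cutProduct ψ g =ᵐ[volume] fun _ => 0 := by
    rw [cutProduct_eq]
    filter_upwards [hc.2.1, measure_eq_zero_iff_ae_notMem.1 h0] with k h1 h2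
    by_cases hk : ψ k = 0
    · rw [hk, zero_mul]
    · rw [indicator_of_mem (show k ∈ nonzeroSet ψ from hk)] at h1
      have h3 : 1 - lowerValue (fun x => conj (φ x)) k * ψ k ≠ 0 := fun h =>
        h2 (sub_eq_zero.1 h).symm
      rw [(mul_eq_zero.1 h1).resolve_right h3, mul_zero]
  have hU : ∀ k, upperValue (cutProduct ψ g) k = 0 := fun k => by
    rw [upperValue_congr hz, upperValue]
    have : ∀ z, cauchy (fun _ => (0 : ℂ)) z = 0 := fun z => by simp [cauchy]
    simp_rw [this]
    exact tendsto_const_nhds.limUnder_eq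
  rw [Lp.eq_zero_iff_ae_eq_zero]
  rw [cutProduct_eq] at hz
  filter_upwards [h, hz] with k h1 h2
  rw [hU, h2, mul_zero, mul_zero, add_zero] at h1
  simpa using h1

/-! ### Elements of the orthogonal complement -/

/-- The unit set is defined through limits; replacing the boundary value by the lower part of conj φ
gives a measurable set that agrees with it almost everywhere. -/
theorem exists_measurable_unitSet {φ ψ : L2} :
    ∃ T : Set ℝ, MeasurableSet T ∧ ∀ᵐ k : ℝ, k ∈ unitSet φ ψ ↔ k ∈ T := by
  obtain ⟨A, B, hA, hB, hs, _⟩ := Friedrichs.exists_split (MemLp.conj (Lp.memLp φ))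
  have hm := hB.1.stronglyMeasurable_mk.measurable
  refine ⟨{k | -(2 * Real.pi * Complex.I * hB.1.mk B k) * ψ k = 1}, ?_, ?_⟩
  · exact measurableSet_eq_fun
      (((hm.const_mul _).neg).mul (Lp.stronglyMeasurable ψ).measurable) measurable_const
  · filter_upwards [hs.lowerValue_eq, hB.1.ae_eq_mk] with k h1 h2
    change lowerValue (fun x => conj (φ x)) k * ψ k = 1 ↔
      -(2 * Real.pi * Complex.I * hB.1.mk B k) * ψ k = 1
    rw [h1, h2]

/-- The element of the orthogonal complement that a subset `s` of the unit set determines. -/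
theorem Exponents.exists_orthogonal {p q r p' q' r' : ℝ≥0∞} (E : Exponents p q r)
    (E' : Exponents p' q' r') {φ ψ : L2}
    (hdisj : ∀ᵐ x : ℝ, φ x * ψ x = 0) (hφ : MemLp φ q volume) (hψ : MemLp ψ r volume)
    (hφ' : MemLp φ r' volume) {s : Set ℝ} (hs : MeasurableSet s) (hfin : volume s ≠ ∞)
    (hunit : ∀ᵐ k : ℝ, k ∈ s → k ∈ unitSet φ ψ) {M : ℝ} (hM : ∀ x ∈ s, ‖ψ x‖ ≤ M) :
    ∃ (g : L2) (A B : ℝ → ℂ), g ∈ (detectable φ ψ)ᗮ ∧ MemLp A 2 volume ∧ MemLp B 2 volume ∧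
      MemLp A q' volume ∧ MemLp (s.indicator ψ) q' volume ∧
      Split (s.indicator ψ) A B ∧ ∀ᵐ k : ℝ, conj (g k) =
        s.indicator (fun _ => 1) k + conj (φ k) * (2 * Real.pi * Complex.I * A k) := by
  have hψm : Measurable ψ := (Lp.stronglyMeasurable ψ).measurable
  have hv : ∀ t, MemLp (s.indicator ψ) t volume := fun t => by
    rw [memLp_indicator_iff_restrict hs]
    have : IsFiniteMeasure (volume.restrict s) := ⟨by simpa using hfin.lt_top⟩
    refine MemLp.mono_exponent (q := ∞) (memLp_top_of_bound hψm.aestronglyMeasurable M ?_) le_top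
    filter_upwards [ae_restrict_mem hs] with x hx
    exact hM x hx
  obtain ⟨A, B, hA, hB, hsp, _⟩ := Friedrichs.exists_split (hv 2)
  have hAq := (E'.projectionBounded.memLp (hv q') hA hB hsp).1
  have htr := E'.holderTriple_two
  have hprod : MemLp (fun x => conj (φ x) * (2 * Real.pi * Complex.I * A x)) 2 volume :=
    (hAq.const_mul (2 * Real.pi * Complex.I)).mul (p := r') (q := q') (r := 2) (MemLp.conj hφ')
  have hone : MemLp (s.indicator fun _ => (1 : ℂ)) 2 volume :=
    memLp_indicator_const 2 hs 1 (Or.inr hfin)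
  have hG := MemLp.conj (hone.add hprod)
  set g : L2 := hG.toLp _
  have hg : ∀ᵐ k : ℝ, conj (g k) =
      s.indicator (fun _ => 1) k + conj (φ k) * (2 * Real.pi * Complex.I * A k) := by
    filter_upwards [hG.coeFn_toLp] with k hk
    rw [hk]
    exact Complex.conj_conj _
  -- Since φψ = 0, multiplying by ψ removes the second term of conj g. The boundary value in that
  -- term is therefore the one generated by g itself, and the equation for g closes up.
  have hcut : (fun x => ψ x * conj (g x)) =ᵐ[volume] s.indicator ψ := by
    filter_upwards [hg, hdisj] with k h1 h2
    rw [h1, mul_add]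
    have h3 : ψ k * (conj (φ k) * (2 * Real.pi * Complex.I * A k)) = 0 := by
      rcases mul_eq_zero.1 h2 with h | h <;> simp [h]
    rw [h3, add_zero]
    by_cases hk : k ∈ s <;> simp [hk]
  refine ⟨g, A, B, ?_, hA, hB, hAq, hv q', hsp, hg⟩
  rw [E.mem_orthogonal_iff hdisj hφ hψ, cutProduct_eq, upperValue_congr hcut]
  filter_upwards [hg, hcut, hsp.upperValue_eq, hunit] with k h1 h2 h3 h4
  rw [h2, h3, h1, add_comm]
  congr 1
  by_cases hk : k ∈ s
  · rw [indicator_of_mem hk, indicator_of_mem hk]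
    exact (h4 hk).symm
  · rw [indicator_of_notMem hk, indicator_of_notMem hk, mul_zero]

/-- The part of `T` that is bounded and on which `ψ` is bounded. -/
def truncation (ψ : L2) (T : Set ℝ) (N : ℕ) : Set ℝ :=
  T ∩ (Icc (-(N : ℝ)) N ∩ {x | ‖ψ x‖ ≤ N})

theorem measurableSet_truncation (ψ : L2) {T : Set ℝ} (hT : MeasurableSet T) (N : ℕ) :
    MeasurableSet (truncation ψ T N) :=
  hT.inter (measurableSet_Icc.inter
    (measurableSet_le (Lp.stronglyMeasurable ψ).measurable.norm measurable_const))

theorem volume_truncation_ne_top (ψ : L2) (T : Set ℝ) (N : ℕ) :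
    volume (truncation ψ T N) ≠ ∞ :=
  ne_top_of_le_ne_top measure_Icc_lt_top.ne
    (measure_mono (inter_subset_right.trans inter_subset_left))

theorem exists_mem_truncation (ψ : L2) {T : Set ℝ} {x : ℝ} (hx : x ∈ T) :
    ∃ N, x ∈ truncation ψ T N := by
  obtain ⟨N, hN⟩ := exists_nat_ge (max |x| ‖ψ x‖)
  exact ⟨N, hx, abs_le.1 ((le_max_left _ _).trans hN), (le_max_right _ _).trans hN⟩

/-- On the unit set ψ ≠ 0, so φ = 0 there and the constructed element equals 1 on s. If all these
elements vanish, every truncation is null, hence so is the unit set. -/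
theorem Exponents.orthogonal_ne_bot {p q r p' q' r' : ℝ≥0∞} (E : Exponents p q r)
    (E' : Exponents p' q' r') {φ ψ : L2}
    (hdisj : ∀ᵐ x : ℝ, φ x * ψ x = 0) (hφ : MemLp φ q volume) (hψ : MemLp ψ r volume)
    (hφ' : MemLp φ r' volume) (h0 : volume (unitSet φ ψ) ≠ 0) : (detectable φ ψ)ᗮ ≠ ⊥ := by
  intro hbot
  apply h0
  obtain ⟨T, hT, hTu⟩ := exists_measurable_unitSet (φ := φ) (ψ := ψ)
  have hnull : ∀ N, volume (truncation ψ T N) = 0 := by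
    intro N
    have hsub : ∀ᵐ k : ℝ, k ∈ truncation ψ T N → k ∈ unitSet φ ψ := by
      filter_upwards [hTu] with k hk h
      exact hk.2 h.1
    obtain ⟨g, A, B, hg, -, -, -, -, -, hge⟩ := E.exists_orthogonal E' hdisj hφ hψ hφ'
      (measurableSet_truncation ψ hT N) (volume_truncation_ne_top ψ T N) hsub
      (fun x hx => hx.2.2)
    rw [hbot, Submodule.mem_bot, Lp.eq_zero_iff_ae_eq_zero] at hg
    rw [measure_eq_zero_iff_ae_notMem]
    filter_upwards [hg, hge, hsub, hdisj] with k h1 h2 h3 h4 hk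
    have h5 : lowerValue (fun x => conj (φ x)) k * ψ k = 1 := h3 hk
    have h6 : ψ k ≠ 0 := fun h => by rw [h, mul_zero] at h5; exact zero_ne_one h5
    have h7 : φ k = 0 := (mul_eq_zero.1 h4).resolve_right h6
    rw [h1, indicator_of_mem hk, h7] at h2
    simp at h2
  have hT0 : volume T = 0 := by
    refine measure_mono_null (fun x hx => mem_iUnion.2 (exists_mem_truncation ψ hx))
      (measure_iUnion_null hnull)
  rw [measure_eq_zero_iff_ae_notMem] at hT0 ⊢
  filter_upwards [hT0, hTu] with k h1 h2
  rwa [h2]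

theorem Exponents.memLp_mul_conj' {p q r : ℝ≥0∞} (E : Exponents p q r) {φ : L2}
    (hφ : MemLp φ r volume) (f : L2) : MemLp (fun x => f x * conj (φ x)) p volume := by
  have := E.holderTriple
  have h := (Lp.memLp f).mul (p := r) (q := 2) (r := p) (MemLp.conj hφ)
  refine h.ae_eq (Eventually.of_forall fun x => ?_)
  simp [mul_comm]

/-- Orthogonality of f to the element built from s reads ∫_s f + 2πi ∫ (f conj φ)A = 0. Duality
replaces the second integral by ∫_s Dψ, with D the lower part of f conj φ. As s is arbitrary inside
a truncation, f = -2πi Dψ there. -/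
theorem Exponents.eq_mul_lowerValue {p q r p' q' r' : ℝ≥0∞} (E : Exponents p q r)
    (E' : Exponents p' q' r') {φ ψ : L2}
    (hdisj : ∀ᵐ x : ℝ, φ x * ψ x = 0) (hφ : MemLp φ q volume) (hψ : MemLp ψ r volume)
    (hφ' : MemLp φ r' volume) {f : L2} (hf : f ∈ detectable φ ψ) :
    ∀ᵐ k : ℝ, k ∈ unitSet φ ψ → f k = ψ k * lowerValue (fun x => f x * conj (φ x)) k := by
  have := E'.holderConjugate
  have hfφ := E'.memLp_mul_conj' hφ' f
  obtain ⟨C, D, hC, hD, hs, hdual⟩ := E'.exists_split hfφ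
  obtain ⟨T, hT, hTu⟩ := exists_measurable_unitSet (φ := φ) (ψ := ψ)
  set F : ℝ → ℂ := fun x => f x + 2 * Real.pi * Complex.I * (D x * ψ x) with hF
  have hp1 : 1 ≤ p' := by
    rw [← ENNReal.ofReal_one]
    exact ENNReal.ofReal_le_of_le_toReal E'.toReal_holderConjugate.lt.le
  have hzero : ∀ N, ∀ᵐ k : ℝ, k ∈ truncation ψ T N → F k = 0 := by
    intro N
    set S := truncation ψ T N
    have hSm : MeasurableSet S := measurableSet_truncation ψ hT N
    have hSf : volume S ≠ ∞ := volume_truncation_ne_top ψ T N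
    have hfin : IsFiniteMeasure (volume.restrict S) := ⟨by simpa using hSf.lt_top⟩
    have hi1 : IntegrableOn f S := by
      have := (Lp.memLp f).restrict S
      exact memLp_one_iff_integrable.1 (this.mono_exponent (by norm_num))
    have hi2 : IntegrableOn (fun x => D x * ψ x) S := by
      have h1 : IntegrableOn D S :=
        memLp_one_iff_integrable.1 ((hD.restrict S).mono_exponent hp1)
      refine h1.mul_bdd (c := N) (Lp.stronglyMeasurable ψ).aestronglyMeasurable ?_
      filter_upwards [ae_restrict_mem hSm] with x hx
      exact hx.2.2
    have hFi : IntegrableOn F S := hi1.add (hi2.const_mul _)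
    rw [← ae_restrict_iff' hSm]
    refine hFi.ae_eq_zero_of_forall_setIntegral_eq_zero fun s hs' _ => ?_
    rw [Measure.restrict_restrict hs']
    set s' := s ∩ S
    have hs'm : MeasurableSet s' := hs'.inter hSm
    have hsub : ∀ᵐ k : ℝ, k ∈ s' → k ∈ unitSet φ ψ := by
      filter_upwards [hTu] with k hk h
      exact hk.2 h.2.1
    obtain ⟨g, A, B, hg, hA, hB, hAq, hvq, hsp, hge⟩ := E.exists_orthogonal E' hdisj hφ hψ hφ'
      hs'm (ne_top_of_le_ne_top hSf (measure_mono inter_subset_right)) hsub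
      (fun x hx => hx.2.2.2)
    have h1 := (Submodule.mem_orthogonal' _ _).1 hg f hf
    rw [inner_eq_integral] at h1
    have hj1 : Integrable fun x => s'.indicator f x :=
      (hi1.mono_set inter_subset_right).integrable_indicator hs'm
    have hj2 : Integrable fun x => 2 * Real.pi * Complex.I * ((f x * conj (φ x)) * A x) :=
      (integrable_mul_of_memLp p' q' hfφ hAq).const_mul _
    have h2 : ∫ x, f x * conj (g x) = ∫ x, (s'.indicator f x +
        2 * Real.pi * Complex.I * ((f x * conj (φ x)) * A x)) := by
      refine integral_congr_ae ?_
      filter_upwards [hge] with x hx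
      rw [hx]
      by_cases hxs : x ∈ s'
      · rw [indicator_of_mem hxs, indicator_of_mem hxs]
        ring
      · rw [indicator_of_notMem hxs, indicator_of_notMem hxs]
        ring
    rw [h2, integral_add hj1 hj2, integral_const_mul, (hdual _ A B hvq hA hB hsp).2,
      integral_indicator hs'm] at h1
    have h3 : ∫ x, D x * s'.indicator ψ x = ∫ x in s', D x * ψ x := by
      rw [← integral_indicator hs'm]
      refine integral_congr_ae (Eventually.of_forall fun x => ?_)
      by_cases hxs : x ∈ s' <;> simp [hxs]
    rw [h3] at h1
    rw [← h1, ← integral_const_mul, ← integral_add (hi1.mono_set inter_subset_right)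
      (Integrable.const_mul (hi2.mono_set inter_subset_right) _)]
  filter_upwards [ae_all_iff.2 hzero, hs.lowerValue_eq, hTu] with k h1 h2 h3 hk
  obtain ⟨N, hN⟩ := exists_mem_truncation ψ (h3.1 hk)
  have h4 := h1 N hN
  rw [h2]
  simp only [hF] at h4
  linear_combination h4

theorem mem_detectable_of_bounded {φ ψ : L2} (hdisj : ∀ᵐ x : ℝ, φ x * ψ x = 0)
    (hφ : MemLp φ ∞ volume) (hψ : MemLp ψ ∞ volume) {f : L2}
    (hf : ∀ᵐ k : ℝ, k ∈ unitSet φ ψ → f k = ψ k * lowerValue (fun x => f x * conj (φ x)) k) :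
    f ∈ detectable φ ψ := by
  have E := exponents_two_pow 0
  simp only [zero_add, pow_one, tsub_self, ENNReal.inv_zero] at E
  rw [← Submodule.orthogonal_orthogonal (detectable φ ψ), Submodule.mem_orthogonal]
  intro g hg
  have htr : ENNReal.HolderTriple ∞ 2 2 := inferInstance
  have hv : MemLp (fun x => ψ x * conj (g x)) 2 volume :=
    (MemLp.conj (Lp.memLp g)).mul (p := ∞) (q := 2) (r := 2) hψ
  have hw : MemLp (fun x => f x * conj (φ x)) 2 volume := by
    have h := (Lp.memLp f).mul (p := ∞) (q := 2) (r := 2) (MemLp.conj hφ)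
    refine h.ae_eq (Eventually.of_forall fun x => ?_)
    simp [mul_comm]
  obtain ⟨C, D, hC, hD, hs, _⟩ := Friedrichs.exists_split hv
  obtain ⟨C', D', hC', hD', hs', _⟩ := Friedrichs.exists_split hw
  have hE := (E.mem_orthogonal_iff hdisj (Lp.memLp φ) hψ g).1 hg
  rw [cutProduct_eq] at hE
  have hdual := hs.integral_mul hs' hC hD hC' hD'
  have hi1 : Integrable fun x => 2 * Real.pi * Complex.I * (C x * (f x * conj (φ x))) :=
    (integrable_mul_of_memLp_two hC hw).const_mul _
  have hi2 : Integrable fun x => 2 * Real.pi * Complex.I * ((ψ x * conj (g x)) * D' x) :=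
    (integrable_mul_of_memLp_two hv hD').const_mul _
  -- Where ψ = 0 the equation for g gives conj g = 2πi C conj φ. Where ψ ≠ 0, g can be nonzero only
  -- on the unit set, and there f = -2πi D'ψ. The two integrals then cancel by duality.
  have hkey : (fun x => f x * conj (g x)) =ᵐ[volume] fun x =>
      2 * Real.pi * Complex.I * (C x * (f x * conj (φ x))) -
        2 * Real.pi * Complex.I * ((ψ x * conj (g x)) * D' x) := by
    filter_upwards [hE, hf, hs.upperValue_eq, hs'.lowerValue_eq, hdisj] with k h1 h2 h3 h4 h5
    rw [h3] at h1
    rw [h4] at h2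
    by_cases hψk : ψ k = 0
    · rw [hψk, zero_mul, mul_zero, add_zero] at h1
      rw [h1, hψk]
      ring
    · have hφk : φ k = 0 := (mul_eq_zero.1 h5).resolve_right hψk
      by_cases hgk : conj (g k) = 0
      · rw [hgk, hφk]
        simp
      · rw [hφk, map_zero, zero_mul, zero_add] at h1
        have hu : k ∈ unitSet φ ψ := by
          have h6 : conj (g k) * (lowerValue (fun x => conj (φ x)) k * ψ k) = conj (g k) * 1 := by
            linear_combination -h1
          exact mul_left_cancel₀ hgk h6
        rw [h2 hu, hφk]
        simp only [map_zero]
        ring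
  rw [inner_eq_integral, integral_congr_ae hkey, integral_sub hi1 hi2, integral_const_mul,
    integral_const_mul, hdual, sub_self]

/-! ### Choice of exponents from the integrability hypotheses -/

/-- As q = 2^(n+1) grows, r decreases to 2, so r ≤ 2 + ε for large n and φ lies in L^r by
interpolation. -/
theorem exists_exponents_of_two_lt {φ : L2} {ε : ℝ} (hε : 0 < ε)
    (h : MemLp φ (ENNReal.ofReal (2 + ε)) volume) :
    ∃ p q r, Exponents p q r ∧ MemLp φ r volume := by
  set t := ENNReal.ofReal (2 + ε)
  have ht : 2 < t := by
    rw [show (2 : ℝ≥0∞) = ENNReal.ofReal 2 by norm_num]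
    exact (ENNReal.ofReal_lt_ofReal_iff (by linarith)).2 (by linarith)
  have hd : (0 : ℝ≥0∞) < 2⁻¹ - t⁻¹ := tsub_pos_of_lt (ENNReal.inv_lt_inv.2 ht)
  have hlim : Tendsto (fun n : ℕ => (2⁻¹ : ℝ≥0∞) ^ (n + 1)) atTop (𝓝 0) :=
    (ENNReal.tendsto_pow_atTop_nhds_zero_of_lt_one (by norm_num)).comp (tendsto_add_atTop_nat 1)
  obtain ⟨n, hn⟩ := ((tendsto_order.1 hlim).2 _ hd).exists
  rw [← ENNReal.inv_pow] at hn
  refine ⟨_, _, _, exponents_two_pow n, ?_⟩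
  have htn : t⁻¹ ≤ 2⁻¹ - (2 ^ (n + 1))⁻¹ := by
    refine ENNReal.le_sub_of_add_le_left (ne_top_of_lt hn) ?_
    calc _ ≤ (2⁻¹ - t⁻¹) + t⁻¹ := by gcongr
      _ = 2⁻¹ := tsub_add_cancel_of_le (ENNReal.inv_le_inv.2 ht.le)
  refine memLp_of_memLp_memLp two_ne_zero ?_ ?_ ENNReal.ofReal_ne_top (Lp.memLp φ) h
  · rw [ENNReal.le_inv_iff_le_inv]
    exact tsub_le_self
  · rw [ENNReal.inv_le_iff_inv_le]
    exact htn

theorem two_inv_sub_four_inv : ((2 : ℝ≥0∞)⁻¹ - 4⁻¹)⁻¹ = 4 := by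
  have h : (2 : ℝ≥0∞)⁻¹ = 4⁻¹ + 4⁻¹ := by
    rw [← two_mul, show (4 : ℝ≥0∞) = 2 * 2 by norm_num,
      ENNReal.mul_inv (Or.inl (by norm_num)) (Or.inl (by norm_num)), ← mul_assoc,
      ENNReal.mul_inv_cancel (by norm_num) (by norm_num), one_mul]
  rw [h, ENNReal.add_sub_cancel_right (by norm_num), inv_inv]

theorem exists_exponents {φ ψ : L2}
    (hstar : MemLp ψ ∞ volume ∨ (MemLp φ 4 volume ∧ MemLp ψ 4 volume)) :
    ∃ p q r, Exponents p q r ∧ MemLp φ q volume ∧ MemLp ψ r volume := by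
  rcases hstar with h | h
  · have E := exponents_two_pow 0
    simp only [zero_add, pow_one, tsub_self, ENNReal.inv_zero] at E
    exact ⟨_, _, _, E, Lp.memLp φ, h⟩
  · have E := exponents_two_pow 1
    rw [show (2 : ℝ≥0∞) ^ (1 + 1) = 4 by norm_num, two_inv_sub_four_inv] at E
    exact ⟨_, _, _, E, h⟩

end Friedrichs

end

theorem theorem8p4 (φ ψ : Friedrichs.L2)
    (hdisj : ∀ᵐ x : ℝ, φ x * ψ x = 0)
    (hstar : MemLp ψ ∞ volume ∨ (MemLp φ 4 volume ∧ MemLp ψ 4 volume)) :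
    -- the boundary values that occur exist almost everywhere
    (∀ᵐ k : ℝ, ∃ v, Friedrichs.HasLowerValue (fun x => conj (φ x)) k v) ∧
    (∀ g : Friedrichs.L2, ∀ᵐ k : ℝ, ∃ v,
      Friedrichs.HasUpperValue (Friedrichs.cutProduct ψ g) k v) ∧
    -- the characterisation of the orthogonal complement
    (∀ g : Friedrichs.L2, g ∈ (Friedrichs.detectable φ ψ)ᗮ ↔
      (∀ᵐ k : ℝ, (Friedrichs.nonzeroSet φ).indicator (fun x => conj (g x)) k =
        conj (φ k) * Friedrichs.upperValue (Friedrichs.cutProduct ψ g) k) ∧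
      (∀ᵐ k : ℝ, (Friedrichs.nonzeroSet ψ).indicator (fun x => conj (g x)) k *
        (1 - Friedrichs.lowerValue (fun x => conj (φ x)) k * ψ k) = 0) ∧
      (∀ᵐ k : ℝ, k ∈ (Friedrichs.nonzeroSet ψ ∪ Friedrichs.nonzeroSet φ)ᶜ → g k = 0)) ∧
    -- the unit set is null
    (volume (Friedrichs.unitSet φ ψ) = 0 → Friedrichs.detectable φ ψ = ⊤) ∧
    -- the unit set is not null; an inclusion
    (((∃ ε : ℝ, 0 < ε ∧ MemLp φ (ENNReal.ofReal (2 + ε)) volume) ∧ MemLp ψ ∞ volume ∨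
        (MemLp φ 4 volume ∧ MemLp ψ 4 volume)) →
      (volume (Friedrichs.unitSet φ ψ) ≠ 0 → (Friedrichs.detectable φ ψ)ᗮ ≠ ⊥) ∧
      (∀ f : Friedrichs.L2, ∀ᵐ k : ℝ, ∃ v,
        Friedrichs.HasLowerValue (fun x => f x * conj (φ x)) k v) ∧
      (∀ f ∈ Friedrichs.detectable φ ψ, ∀ᵐ k : ℝ, k ∈ Friedrichs.unitSet φ ψ →
        f k = ψ k * Friedrichs.lowerValue (fun x => f x * conj (φ x)) k)) ∧
    -- bounded data: the exact description
    (MemLp φ ∞ volume → MemLp ψ ∞ volume →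
      ∀ f : Friedrichs.L2, f ∈ Friedrichs.detectable φ ψ ↔
        ∀ᵐ k : ℝ, k ∈ Friedrichs.unitSet φ ψ →
          f k = ψ k * Friedrichs.lowerValue (fun x => f x * conj (φ x)) k) := by
  obtain ⟨p, q, r, E, hφ, hψ⟩ := Friedrichs.exists_exponents hstar
  refine ⟨?_, fun g => ?_, fun g => ?_, E.detectable_eq_top hdisj hφ hψ, fun h => ?_,
    fun hφt hψt f => ⟨fun hf => ?_, Friedrichs.mem_detectable_of_bounded hdisj hφt hψt⟩⟩
  · obtain ⟨A, B, -, -, hs, -⟩ := Friedrichs.exists_split (Friedrichs.MemLp.conj (Lp.memLp φ))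
    exact hs.hasLowerValue.mono fun k hk => ⟨_, hk⟩
  · obtain ⟨C, D, -, -, hs, -⟩ := E.exists_split (E.memLp_mul_conj hψ g)
    rw [Friedrichs.cutProduct_eq]
    exact hs.hasUpperValue.mono fun k hk => ⟨_, hk⟩
  · rw [E.mem_orthogonal_iff hdisj hφ hψ]
    exact Friedrichs.conditions_iff hdisj g _ _
  -- Two systems of exponents are in play: the first comes from the standing hypothesis, the second
  -- only needs φ in some L^{2+ε}. The L⁴ case is ε = 2.
  · obtain ⟨ε, hε, hφε⟩ : ∃ ε : ℝ, 0 < ε ∧ MemLp φ (ENNReal.ofReal (2 + ε)) volume := by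
      rcases h with h | h
      · exact h.1
      · refine ⟨2, two_pos, ?_⟩
        rw [show ENNReal.ofReal (2 + 2) = 4 by norm_num]
        exact h.1
    obtain ⟨p', q', r', E', hφ'⟩ := Friedrichs.exists_exponents_of_two_lt hε hφε
    refine ⟨E.orthogonal_ne_bot E' hdisj hφ hψ hφ', fun f => ?_,
      fun f hf => E.eq_mul_lowerValue E' hdisj hφ hψ hφ' hf⟩
    obtain ⟨C, D, -, -, hs, -⟩ := E'.exists_split (E'.memLp_mul_conj' hφ' f)
    exact hs.hasLowerValue.mono fun k hk => ⟨_, hk⟩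
  · obtain ⟨p', q', r', E', hφ'⟩ := Friedrichs.exists_exponents_of_two_lt (φ := φ) one_pos
      (Friedrichs.memLp_of_memLp_top two_ne_zero (by
        rw [show (2 : ℝ≥0∞) = ENNReal.ofReal 2 by norm_num]
        exact ENNReal.ofReal_le_ofReal (by norm_num)) (Lp.memLp φ) hφt)
    exact E.eq_mul_lowerValue E' hdisj hφ hψ hφ' hf
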